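/- Let $K$ be a field and let $E=(E^0,E^1,r,s)$ be a row-finite directed graph (every vertex emits only finitely many edges; no finiteness or countability of $E^0$ is assumed). Let $L=L_K(E)$ be its Leavitt path algebra, which is in general non-unital, and let $\mathrm{Spec}(L)$ be the set of its prime two-sided ideals with the Zariski (hull-kernel) topology. For vertices $v,w$ write $v\ge w$ if $v=w$ or there is a path from $v$ to $w$. A maximal tail is a nonempty set $M\subseteq E^0$ such that (1) $v\ge w\in M$ implies $v\in M$; (2) every $v\in M$ that emits an edge emits an edge $e$ with $r(e)\in M$; (3) for all $v,w\in M$ there is $y\in M$ with $v\ge y$ and $w\ge y$. Let $\mathcal M(E)$ be the set of maximal tails, and for $M\in\mathcal M(E)$ put $$\mathrm{Spec}_M(L)=\{P\in \mathrm{Spec}(L) : P\cap E^0=E^0\setminus M\},$$ with the subspace topology. Then: 1. $\mathrm{Spec}(L)=\bigsqcup_{M\in\mathcal M(E)}\mathrm{Spec}_M(L)$ (disjoint union of sets). 2. Let $M\in\mathcal M(E)$. If $M$ contains a cycle without an exit in $M$ (that is, the graph with vertex set $M$ and all edges of $E$ with source and range in $M$ has a cycle without exit), then $\mathrm{Spec}_M(L)$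 is homeomorphic to $\mathrm{Spec}(K[x,x^{-1}])$; otherwise it is homeomorphic to $\mathrm{Spec}(K)$. 3. A two-sided ideal of $L$ is left primitive (the annihilator of a simple left module) if and only if it is a prime ideal that is maximal, with respect to inclusion, among the members of its stratum $\mathrm{Spec}_M(L)$; the same holds for right primitive ideals. 4. Suppose that $K$ is infinite. Let $L=\bigoplus_{n\in\mathbb Z} L_n$ be the grading in which vertices, edges $e$ and ghost edges $e^*$ have degrees $0$, $1$ and $-1$, and let $H=K^\times$ act on $L$ by $h\cdot a=h^na$ for $a\in L_n$. This is a rational action by $K$-algebra automorphisms, i.e. there is a $K$-algebra homomorphism $\Delta:L\to L\otimes_K K[x,x^{-1}]$ such that $h\cdot a$ is obtained from $\Delta(a)$ by evaluating at $x=h$. The map $P\mapsto E^0\setminus(P\cap E^0)$ is a bijection from the $H$-primes (the $H$-invariant prime ideals of $L$) onto $\mathcal M(E)$. If the $H$-prime $P$ corresponds to $M$, then the $H$-stratum of $P$, i.e. the set of primes $Q$ such that $P$ is the largest $H$-prime contained in $Q$, is equal to $\mathrm{Spec}_M(L)$. -/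

import Mathlib

open scoped TensorProduct LaurentPolynomial

universe u v w

/-! ### Directed graphs -/

/-- A directed graph with vertex set `V` and edge set `E` (loops and parallel edges allowed). -/
structure DirGraph (V : Type u) (E : Type v) where
  /-- the source map -/
  s : E → V
  /-- the range map -/
  r : E → V

namespace DirGraph

variable {V : Type u} {E : Type v} (G : DirGraph V E)

/-- Every vertex emits finitely many edges. -/
def RowFinite : Prop := ∀ x : V, {e : E | G.s e = x}.Finite

/-- `x ≥ y` : either `x = y` or there is a path from `x` to `y`. -/
def Reaches (x y : V) : Prop :=
  Relation.ReflTransGen (fun a b => ∃ e : E, G.s e = a ∧ G.r e = b) x y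

/-- A cycle, as the list of its edges: a nonempty closed path whose edges have pairwise distinct
sources. -/
def IsCycle (c : List E) : Prop :=
  c.IsChain (fun e f => G.r e = G.s f) ∧
  (∃ h : c ≠ [], G.r (c.getLast h) = G.s (c.head h)) ∧
  (c.map G.s).Nodup

/-- `f` is an exit for the path `c`. -/
def IsExit (c : List E) (f : E) : Prop := ∃ e ∈ c, G.s f = G.s e ∧ f ≠ e

/-- Condition (L): every cycle has an exit. -/
def ConditionL : Prop := ∀ c : List E, G.IsCycle c → ∃ f : E, G.IsExit c f

/-- The graph with vertex set `M` and all the edges of `G` that join vertices of `M`.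
If `M` is a maximal tail, this is the quotient graph of `G` by the hereditary set `Mᶜ`. -/
def restrict (M : Set V) : DirGraph M {e : E // G.s e ∈ M ∧ G.r e ∈ M} where
  s e := ⟨G.s e.1, e.2.1⟩
  r e := ⟨G.r e.1, e.2.2⟩

/-- Maximal tails. -/
structure IsMaximalTail (M : Set V) : Prop where
  nonempty : M.Nonempty
  mem_of_reaches : ∀ x y : V, y ∈ M → G.Reaches x y → x ∈ M
  exists_edge : ∀ x ∈ M, (∃ e : E, G.s e = x) → ∃ e : E, G.s e = x ∧ G.r e ∈ M
  directed : ∀ x ∈ M, ∀ y ∈ M, ∃ z ∈ M, G.Reaches x z ∧ G.Reaches y z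

/-- `𝓜(G)`, the set of maximal tails. -/
def maximalTails : Set (Set V) := {M | G.IsMaximalTail M}

/-- The maximal tails `M` such that every cycle in `M` has an exit in `M`. -/
def maximalTailsGamma : Set (Set V) := {M | G.IsMaximalTail M ∧ (G.restrict M).ConditionL}

/-- The maximal tails `M` containing a cycle that has no exit in `M`. -/
def maximalTailsTau : Set (Set V) := G.maximalTails \ G.maximalTailsGamma

end DirGraph

/-! ### Prime and primitive ideals of rings without identity -/

section Ideals

variable {A : Type u} [NonUnitalRing A]

/-- A prime ideal: a proper two-sided ideal `P` such that `I J ⊆ P` implies `I ⊆ P` or `J ⊆ P`,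
for all two-sided ideals `I`, `J`. -/
structure TwoSidedIdeal.IsPrimeIdeal (P : TwoSidedIdeal A) : Prop where
  ne_top : P ≠ ⊤
  le_or_le : ∀ I J : TwoSidedIdeal A, (∀ a ∈ I, ∀ b ∈ J, a * b ∈ P) → I ≤ P ∨ J ≤ P

/-- `P` is the annihilator of a simple left `A`-module `N`. The module is given by
`ρ : A → End N`; simple means `A N ≠ 0` and that there are no submodules except `0` and `N`. -/
def TwoSidedIdeal.IsLeftPrimitive (P : TwoSidedIdeal A) : Prop :=
  ∃ (N : Type u) (_ : AddCommGroup N) (ρ : A →ₙ+* AddMonoid.End N),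
    (∃ a n, ρ a n ≠ 0) ∧
    (∀ W : AddSubgroup N, (∀ a, ∀ n ∈ W, ρ a n ∈ W) → W = ⊥ ∨ W = ⊤) ∧
    ∀ a, a ∈ P ↔ ∀ n, ρ a n = 0

/-- `P` is the annihilator of a simple right `A`-module `N`, with `n · a = ρ a n`. -/
def TwoSidedIdeal.IsRightPrimitive (P : TwoSidedIdeal A) : Prop :=
  ∃ (N : Type u) (_ : AddCommGroup N) (ρ : A →ₙ+* (AddMonoid.End N)ᵐᵒᵖ),
    (∃ a n, (ρ a).unop n ≠ 0) ∧
    (∀ W : AddSubgroup N, (∀ a, ∀ n ∈ W, (ρ a).unop n ∈ W) → W = ⊥ ∨ W = ⊤) ∧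
    ∀ a, a ∈ P ↔ ∀ n, (ρ a).unop n = 0

variable (A) in
/-- The prime spectrum of a ring that need be neither commutative nor unital. -/
@[ext] structure PrimeSpec where
  /-- the underlying ideal -/
  asIdeal : TwoSidedIdeal A
  isPrime : asIdeal.IsPrimeIdeal

/-- The Zariski (hull-kernel) topology: the closed sets are the sets `{P | I ⊆ P}`. -/
instance PrimeSpec.zariskiTopology : TopologicalSpace (PrimeSpec A) :=
  TopologicalSpace.ofClosed
    (Set.range fun I : TwoSidedIdeal A => {P : PrimeSpec A | I ≤ P.asIdeal})
    ⟨⊤, by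
      ext P
      simpa using P.isPrime.ne_top⟩
    (by
      intro S hS
      refine ⟨sSup {I | {P : PrimeSpec A | I ≤ P.asIdeal} ∈ S}, ?_⟩
      ext P
      simp only [Set.mem_ofPred_eq, sSup_le_iff, Set.mem_sInter]
      constructor
      · intro h Z hZ
        obtain ⟨I, rfl⟩ := hS hZ
        exact h I hZ
      · intro h I hI
        exact h _ hI)
    (by
      rintro _ ⟨I, rfl⟩ _ ⟨J, rfl⟩
      refine ⟨I ⊓ J, ?_⟩
      ext P
      simp only [Set.mem_ofPred_eq, Set.mem_union]
      constructor
      · intro h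
        exact P.isPrime.le_or_le I J fun a ha b hb =>
          h ⟨TwoSidedIdeal.mul_mem_right I a b ha, TwoSidedIdeal.mul_mem_left J a b hb⟩
      · rintro (h | h)
        · exact le_trans inf_le_left h
        · exact le_trans inf_le_right h)

end Ideals

/-! ### Rational actions of the multiplicative group -/

section Actions

variable {K : Type w} [Field K] {A : Type u} [NonUnitalRing A] [Module K A]
  [IsScalarTower K A A] [SMulCommClass K A A]

/-- `ρ` is an action of `Kˣ` on `A` by `K`-algebra automorphisms, and the action is rational:
there is an algebra homomorphism `Δ : A → A ⊗ K[x,x⁻¹]` such that `ρ h a` is obtained from `Δ a`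
by evaluating the second tensor factor at `h`. -/
structure IsRationalAction (ρ : Kˣ → A →ₙₐ[K] A) : Prop where
  one : ∀ a, ρ 1 a = a
  mul : ∀ g h a, ρ (g * h) a = ρ g (ρ h a)
  rational : ∃ Δ : A →ₙₐ[K] A ⊗[K] K[T;T⁻¹], ∀ h a,
    ρ h a = TensorProduct.rid K A ((LaurentPolynomial.leval K h).lTensor A (Δ a))

/-- The `H`-primes: the prime ideals that are invariant under the action. -/
def hSpec (ρ : Kˣ → A →ₙₐ[K] A) : Set (PrimeSpec A) :=
  {P | ∀ h, ∀ a ∈ P.asIdeal, ρ h a ∈ P.asIdeal}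

/-- The `H`-stratum of `P`: the primes `Q` such that `P` is the largest `H`-prime contained
in `Q`. -/
def hStratum (ρ : Kˣ → A →ₙₐ[K] A) (P : PrimeSpec A) : Set (PrimeSpec A) :=
  {Q | P ∈ hSpec ρ ∧ P.asIdeal ≤ Q.asIdeal ∧
    ∀ P' ∈ hSpec ρ, P'.asIdeal ≤ Q.asIdeal → P'.asIdeal ≤ P.asIdeal}

end Actions

/-! ### Leavitt path algebras -/

namespace Leavitt

/-- The generators: vertices `v`, edges `e` and ghost edges `e*`. -/
inductive Gen (V : Type u) (E : Type v) : Type (max u v)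
  | vert (x : V)
  | edge (e : E)
  | ghost (e : E)

variable (K : Type w) [Field K] {V : Type u} {E : Type v} (G : DirGraph V E)

/-- The free associative `K`-algebra (without identity) on the generators. -/
abbrev FreeAlg (V : Type u) (E : Type v) : Type (max u v w) :=
  MonoidAlgebra K (FreeSemigroup (Gen V E))

/-- A generator, as an element of the free algebra. -/
noncomputable def gen (g : Gen V E) : FreeAlg K V E :=
  MonoidAlgebra.ofMagma K _ (FreeSemigroup.of g)

/-- The defining relations. The relation `ck2` is imposed at the vertices that emit at least one
and only finitely many edges. -/
inductive Rel : FreeAlg K V E → FreeAlg K V E → Prop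
  | vert_idem (x : V) : Rel (gen K (.vert x) * gen K (.vert x)) (gen K (.vert x))
  | vert_orth (x y : V) (h : x ≠ y) : Rel (gen K (.vert x) * gen K (.vert y)) 0
  | source_edge (e : E) : Rel (gen K (.vert (G.s e)) * gen K (.edge e)) (gen K (.edge e))
  | edge_range (e : E) : Rel (gen K (.edge e) * gen K (.vert (G.r e))) (gen K (.edge e))
  | range_ghost (e : E) : Rel (gen K (.vert (G.r e)) * gen K (.ghost e)) (gen K (.ghost e))
  | ghost_source (e : E) : Rel (gen K (.ghost e) * gen K (.vert (G.s e))) (gen K (.ghost e))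
  | ck1_same (e : E) : Rel (gen K (.ghost e) * gen K (.edge e)) (gen K (.vert (G.r e)))
  | ck1_ne (e f : E) (h : e ≠ f) : Rel (gen K (.ghost e) * gen K (.edge f)) 0
  | ck2 (x : V) (hfin : {e : E | G.s e = x}.Finite) (hne : ∃ e : E, G.s e = x) :
      Rel (∑ e ∈ hfin.toFinset, gen K (.edge e) * gen K (.ghost e)) (gen K (.vert x))

/-- The ring congruence generated by all scalar multiples of the defining relations, that is, the
smallest congruence of `K`-algebras containing the defining relations. -/
noncomputable def con : RingCon (FreeAlg K V E) :=
  ringConGen fun a b => ∃ (k : K) (p q : FreeAlg K V E), Rel K G p q ∧ a = k • p ∧ b = k • q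

theorem con_smul (k : K) {a b : FreeAlg K V E} (h : con K G a b) : con K G (k • a) (k • b) := by
  change RingConGen.Rel _ a b at h
  change RingConGen.Rel _ _ _
  induction h with
  | of a b h =>
    obtain ⟨l, p, q, hpq, rfl, rfl⟩ := h
    exact .of _ _ ⟨k * l, p, q, hpq, by rw [mul_smul], by rw [mul_smul]⟩
  | refl a => exact .refl _
  | symm _ ih => exact .symm ih
  | trans _ _ ih₁ ih₂ => exact .trans ih₁ ih₂
  | add _ _ ih₁ ih₂ => rw [smul_add, smul_add]; exact .add ih₁ ih₂
  | mul _ h₂ ih₁ _ => rw [← smul_mul_assoc, ← smul_mul_assoc]; exact .mul ih₁ h₂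

end Leavitt

/-- The Leavitt path algebra `L_K(G)`, in general without identity. -/
def LeavittPathAlgebra (K : Type w) [Field K] {V : Type u} {E : Type v} (G : DirGraph V E) :
    Type (max u v w) :=
  (Leavitt.con K G).Quotient

namespace LeavittPathAlgebra

open Leavitt

variable (K : Type w) [Field K] {V : Type u} {E : Type v} (G : DirGraph V E)

noncomputable instance : NonUnitalRing (LeavittPathAlgebra K G) :=
  inferInstanceAs (NonUnitalRing (con K G).Quotient)

/-- The quotient map from the free algebra. -/
noncomputable def mk (a : FreeAlg K V E) : LeavittPathAlgebra K G := (con K G).toQuotient a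

variable {K G} in
theorem mk_surjective : Function.Surjective (mk K G) := fun a => Quotient.exists_rep a

noncomputable instance : SMul K (LeavittPathAlgebra K G) where
  smul k := Quotient.map' (k • ·) fun _ _ h => con_smul K G k h

theorem mk_add (a b : FreeAlg K V E) : mk K G (a + b) = mk K G a + mk K G b := rfl

theorem mk_mul (a b : FreeAlg K V E) : mk K G (a * b) = mk K G a * mk K G b := rfl

theorem mk_zero : mk K G 0 = 0 := rfl

theorem mk_smul (k : K) (a : FreeAlg K V E) : mk K G (k • a) = k • mk K G a := rfl

theorem mk_sum {α : Type*} (t : Finset α) (f : α → FreeAlg K V E) :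
    mk K G (∑ i ∈ t, f i) = ∑ i ∈ t, mk K G (f i) :=
  map_sum (AddMonoidHom.mk' (mk K G) (mk_add K G)) f t

noncomputable instance : Module K (LeavittPathAlgebra K G) where
  one_smul a := by
    obtain ⟨a, rfl⟩ := mk_surjective a
    rw [← mk_smul, one_smul]
  mul_smul k l a := by
    obtain ⟨a, rfl⟩ := mk_surjective a
    simp only [← mk_smul, mul_smul]
  smul_zero k := by
    rw [← mk_zero, ← mk_smul, smul_zero]
  smul_add k a b := by
    obtain ⟨a, rfl⟩ := mk_surjective a
    obtain ⟨b, rfl⟩ := mk_surjective b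
    simp only [← mk_smul, ← mk_add, smul_add]
  add_smul k l a := by
    obtain ⟨a, rfl⟩ := mk_surjective a
    simp only [← mk_smul, ← mk_add, add_smul]
  zero_smul a := by
    obtain ⟨a, rfl⟩ := mk_surjective a
    rw [← mk_smul, zero_smul, mk_zero]

instance : IsScalarTower K (LeavittPathAlgebra K G) (LeavittPathAlgebra K G) where
  smul_assoc k a b := by
    obtain ⟨a, rfl⟩ := mk_surjective a
    obtain ⟨b, rfl⟩ := mk_surjective b
    simp only [smul_eq_mul, ← mk_smul, ← mk_mul, smul_mul_assoc]

instance : SMulCommClass K (LeavittPathAlgebra K G) (LeavittPathAlgebra K G) where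
  smul_comm k a b := by
    obtain ⟨a, rfl⟩ := mk_surjective a
    obtain ⟨b, rfl⟩ := mk_surjective b
    simp only [smul_eq_mul, ← mk_smul, ← mk_mul, mul_smul_comm]

/-- The image of a generator in `L_K(G)`. -/
noncomputable def ι (g : Gen V E) : LeavittPathAlgebra K G := mk K G (gen K g)

/-- A vertex, as an element of `L_K(G)`. -/
noncomputable def vertex (x : V) : LeavittPathAlgebra K G := ι K G (.vert x)

theorem mk_eq_of_rel {p q : FreeAlg K V E} (h : Rel K G p q) : mk K G p = mk K G q :=
  (RingCon.eq (con K G)).2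
    (RingConGen.Rel.of _ _ ⟨1, p, q, h, (one_smul K p).symm, (one_smul K q).symm⟩)

section lift

variable {A : Type*} [NonUnitalRing A] [Module K A] [IsScalarTower K A A] [SMulCommClass K A A]

/-- The homomorphism from the free algebra that extends `f`. -/
noncomputable def liftFree (f : Gen V E → A) : FreeAlg K V E →ₙₐ[K] A :=
  MonoidAlgebra.liftMagma K (FreeSemigroup.lift f)

@[simp] theorem liftFree_gen (f : Gen V E → A) (g : Gen V E) :
    liftFree K f (gen K g) = f g := by
  simp [liftFree, gen]

theorem liftFree_eq (f : Gen V E → A)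
    (hf : ∀ p q, Rel K G p q → liftFree K f p = liftFree K f q)
    {a b : FreeAlg K V E} (h : con K G a b) : liftFree K f a = liftFree K f b := by
  change RingConGen.Rel _ a b at h
  induction h with
  | of a b h =>
    obtain ⟨l, p, q, hpq, rfl, rfl⟩ := h
    rw [map_smul, map_smul, hf p q hpq]
  | refl a => rfl
  | symm _ ih => exact ih.symm
  | trans _ _ ih₁ ih₂ => exact ih₁.trans ih₂
  | add _ _ ih₁ ih₂ => rw [map_add, map_add, ih₁, ih₂]
  | mul _ _ ih₁ ih₂ => rw [map_mul, map_mul, ih₁, ih₂]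

/-- The homomorphism from `L_K(G)` given by a family of elements satisfying the relations. -/
noncomputable def lift (f : Gen V E → A)
    (hf : ∀ p q, Rel K G p q → liftFree K f p = liftFree K f q) :
    LeavittPathAlgebra K G →ₙₐ[K] A where
  toFun := Quotient.lift (liftFree K f) fun _ _ h => liftFree_eq K G f hf h
  map_smul' k a := by
    obtain ⟨a, rfl⟩ := mk_surjective a
    exact map_smul (liftFree K f) k a
  map_zero' := map_zero (liftFree K f)
  map_add' a b := by
    obtain ⟨a, rfl⟩ := mk_surjective a
    obtain ⟨b, rfl⟩ := mk_surjective b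
    exact map_add (liftFree K f) a b
  map_mul' a b := by
    obtain ⟨a, rfl⟩ := mk_surjective a
    obtain ⟨b, rfl⟩ := mk_surjective b
    exact map_mul (liftFree K f) a b

end lift

/-- The weight of a generator: `0` for a vertex, `1` for an edge, `-1` for a ghost edge. -/
def weight : Gen V E → ℤ
  | .vert _ => 0
  | .edge _ => 1
  | .ghost _ => -1

/-- The weight of a word in the generators: the sum of the weights of its letters. -/
def wordWeight (m : FreeSemigroup (Gen V E)) : ℤ :=
  (FreeSemigroup.lift (fun g => Multiplicative.ofAdd (weight g)) m).toAdd

/-- The component of degree `n` of the grading: the span of the monomials of weight `n`. -/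
noncomputable def homogeneous (n : ℤ) : Submodule K (LeavittPathAlgebra K G) :=
  Submodule.span K {a | ∃ m : FreeSemigroup (Gen V E),
    wordWeight m = n ∧ a = FreeSemigroup.lift (ι K G) m}

theorem gauge_rel (h : Kˣ) (p q : FreeAlg K V E) (hpq : Rel K G p q) :
    liftFree K (fun g : Gen V E => ((h ^ weight g : Kˣ) : K) • ι K G g) p =
      liftFree K (fun g : Gen V E => ((h ^ weight g : Kˣ) : K) • ι K G g) q := by
  have key := mk_eq_of_rel K G hpq
  cases hpq <;>
    simp only [map_mul, map_zero, map_sum, liftFree_gen, weight, smul_mul_assoc, mul_smul_comm,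
      smul_smul, zpow_zero, zpow_one, zpow_neg, Units.val_one, one_smul, Units.inv_mul,
      Units.mul_inv, ι, ← mk_mul, ← mk_sum, key, mk_zero, smul_zero]

/-- The action of `Kˣ` on `L_K(G)` given by the grading: `h · v = v`, `h · e = h e` and
`h · e* = h⁻¹ e*` for vertices `v` and edges `e`. -/
noncomputable def gauge (h : Kˣ) : LeavittPathAlgebra K G →ₙₐ[K] LeavittPathAlgebra K G :=
  lift K G (fun g => ((h ^ weight g : Kˣ) : K) • ι K G g) (gauge_rel K G h)

/-- `E⁰ \ (E⁰ ∩ P)`, the set of vertices that do not lie in `P`. -/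
def tail (P : PrimeSpec (LeavittPathAlgebra K G)) : Set V := {x | vertex K G x ∉ P.asIdeal}

/-- The stratum `Spec_M(L_K(G))`: the primes `P` with `P ∩ E⁰ = E⁰ \ M`. -/
def stratum (M : Set V) : Set (PrimeSpec (LeavittPathAlgebra K G)) :=
  {P | {x : V | vertex K G x ∈ P.asIdeal} = Mᶜ}

end LeavittPathAlgebra

/-! Decomposition. For a prime `P` the vertices outside `P` form a maximal tail. The Cuntz-Krieger
relations give closure under predecessors and the existence of outgoing edges. Directedness comes
from primeness: `v L w` is spanned by monomials `α β*` with `α` from `v` and `β` from `w` to a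
common vertex `z`, and if all such `z` lay in `P`, so would `v L w`.

Strata. Let `I` be the ideal generated by the vertices outside `M` (`coIdeal`). A branching system
on `M × ℕ` gives a representation in which exactly the vertices of `M` act nontrivially. If every
cycle of `M` has an exit in `M`, a Cuntz-Krieger uniqueness argument (`le_of_conditionL`) shows that
an ideal is determined by its set of vertices once that set is the complement of `M`. The stratum is
then a single point, which exists because an ideal maximal among those with these vertices is prime
(`stratum_nonempty`).

If `M` contains a cycle `c` at `x` without exit in `M`, every vertex of `M` reaches `x`, so the
stratum consists of the primes that contain `I` but not `x`. In `L/I` the only closed paths at `x`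
are the powers of `c`, and `c` is invertible in the corner at `x`. That corner is therefore
`K[c,c⁻¹]`, the powers of `c` being independent because they have different degrees
(`isCornerMap_cycleMap`). Primes that avoid an idempotent correspond homeomorphically to the primes
of its corner (`nonempty_homeomorph`).

Primitivity. If `N` is a simple module with annihilator `P`, then `x N` is simple over the
commutative corner, so `P` has a maximal trace there and is maximal in its stratum
(`le_of_isLeftPrimitive`). Conversely, by row-finiteness a vertex reaches only countably many
others, so `M` has a cofinal decreasing sequence of idempotents. A left ideal that is maximal
subject to avoiding this sequence modulo `P` yields a primitive ideal above `P` in the same stratum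
(`exists_isLeftPrimitive`), which equals `P` if `P` is maximal there. The involution of `L`
transfers this to right modules.

Group action. Over an infinite field an invariant ideal is graded. A graded ideal that contains `I`
but not `x` has zero trace on `K[c,c⁻¹]`, since nonzero homogeneous elements there are units. So
each stratum has a least element, which is its unique invariant prime (`exists_least_of_stratum`).
-/

namespace TwoSidedIdeal

/-! ### Elementwise criterion for primeness without identity -/

section Prime

variable {A : Type u} [NonUnitalRing A] {P : TwoSidedIdeal A}

theorem mem_congr {I : TwoSidedIdeal A} (h : I ≤ P) {a b : A} (hab : a - b ∈ I) :
    a ∈ P ↔ b ∈ P :=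
  ⟨fun ha => by simpa using P.sub_mem ha (h hab), fun hb => by simpa using P.add_mem (h hab) hb⟩

theorem mul_sub_mul_mem {I : TwoSidedIdeal A} {a b c d : A} (h : a - b ∈ I) (h' : c - d ∈ I) :
    a * c - b * d ∈ I := by
  rw [show a * c - b * d = a * (c - d) + (a - b) * d by noncomm_ring]
  exact I.add_mem (I.mul_mem_left _ _ h') (I.mul_mem_right _ _ h)

/-- Without an identity, `a` need not lie in the ideal spanned by the products `a x`, so three
auxiliary ideals are used: `J = {z | a A z ⊆ P}`, `I = {y | y J ⊆ P}` and `N = {y | y A ⊆ P}`. From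
`I J ⊆ P` either `b ∈ J ≤ P`, or `a A ⊆ I ≤ P`. In the second case `a ∈ N`, and `N ≤ P` because `N A
⊆ P` with `P` proper. -/
theorem IsPrimeIdeal.mem_or_mem (hP : P.IsPrimeIdeal) {a b : A} (h : ∀ x, a * x * b ∈ P) :
    a ∈ P ∨ b ∈ P := by
  let J : TwoSidedIdeal A := .mk' {z | ∀ x, a * x * z ∈ P}
    (fun x => by simp)
    (fun hx hy x => by simpa [mul_add] using P.add_mem (hx x) (hy x))
    (fun hx x => by simpa using P.neg_mem (hx x))
    (fun {x y} hy z => by simpa [mul_assoc] using hy (z * x))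
    (fun {x y} hx z => by simpa [mul_assoc] using P.mul_mem_right _ y (hx z))
  let I : TwoSidedIdeal A := .mk' {y | ∀ z ∈ J, y * z ∈ P}
    (fun x => by simp)
    (fun hx hy x h => by simpa [add_mul] using P.add_mem (hx x h) (hy x h))
    (fun hx x h => by simpa using P.neg_mem (hx x h))
    (fun {x y} hy z h => by simpa [mul_assoc] using P.mul_mem_left x _ (hy z h))
    (fun {x y} hx z h => by simpa [mul_assoc] using hx _ (J.mul_mem_left y z h))
  let N : TwoSidedIdeal A := .mk' {y | ∀ z, y * z ∈ P}
    (fun x => by simp)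
    (fun hx hy x => by simpa [add_mul] using P.add_mem (hx x) (hy x))
    (fun hx x => by simpa using P.neg_mem (hx x))
    (fun {x y} hy z => by simpa [mul_assoc] using P.mul_mem_left x _ (hy z))
    (fun {x y} hx z => by simpa [mul_assoc] using hx (y * z))
  have hI : ∀ y, y ∈ I ↔ ∀ z ∈ J, y * z ∈ P := fun y => TwoSidedIdeal.mem_mk' _ _ _ _ _ _ _
  have hJ : ∀ z, z ∈ J ↔ ∀ x, a * x * z ∈ P := fun y => TwoSidedIdeal.mem_mk' _ _ _ _ _ _ _
  have hN : ∀ y, y ∈ N ↔ ∀ z, y * z ∈ P := fun y => TwoSidedIdeal.mem_mk' _ _ _ _ _ _ _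
  rcases hP.le_or_le I J fun y hy z hz => (hI y).1 hy z hz with h1 | h1
  · rcases hP.le_or_le N ⊤ fun y hy z _ => (hN y).1 hy z with h2 | h2
    · left
      exact h2 ((hN a).2 fun x => h1 ((hI _).2 fun z hz => (hJ z).1 hz x))
    · exact absurd (top_le_iff.1 h2) hP.ne_top
  · exact .inr (h1 ((hJ b).2 h))

theorem isPrimeIdeal_of_mem_or_mem (hP : P ≠ ⊤)
    (h : ∀ a b, (∀ x, a * x * b ∈ P) → a ∈ P ∨ b ∈ P) : P.IsPrimeIdeal where
  ne_top := hP
  le_or_le I J hIJ := by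
    by_contra! hc
    obtain ⟨a, ha, haP⟩ := SetLike.not_le_iff_exists.1 hc.1
    obtain ⟨b, hb, hbP⟩ := SetLike.not_le_iff_exists.1 hc.2
    rcases h a b fun x => hIJ _ (I.mul_mem_right _ _ ha) _ hb with h | h
    exacts [haP h, hbP h]

end Prime

/-! ### Simple modules and a construction of primitive ideals -/

section Primitive

variable {A : Type u} [NonUnitalRing A] {P : TwoSidedIdeal A}

/-- The elements killed by all of `A` form a proper submodule because `A N ≠ 0`, hence the zero
submodule. So `A m ≠ 0` for `m ≠ 0`, and `A m` is everything. -/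
theorem exists_apply_eq_of_simple {N : Type*} [AddCommGroup N] (ρ : A →ₙ+* AddMonoid.End N)
    (h0 : ∃ a n, ρ a n ≠ 0)
    (hs : ∀ W : AddSubgroup N, (∀ a, ∀ n ∈ W, ρ a n ∈ W) → W = ⊥ ∨ W = ⊤)
    {m : N} (hm : m ≠ 0) (n : N) : ∃ a, ρ a m = n := by
  let Z : AddSubgroup N := ⨅ a, (ρ a).ker
  have hZ : ∀ n, n ∈ Z ↔ ∀ a, ρ a n = 0 := fun n => by
    simp only [Z, AddSubgroup.mem_iInf]; rfl
  have hZ0 : Z = ⊥ := by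
    refine (hs Z fun a n hn => ?_).resolve_right fun h => ?_
    · rw [(hZ n).1 hn a]; exact Z.zero_mem
    · obtain ⟨a, n, han⟩ := h0
      exact han ((hZ n).1 (h ▸ AddSubgroup.mem_top n) a)
  let W : AddSubgroup N := ((AddMonoidHom.eval m).comp (ρ : A →+ AddMonoid.End N)).range
  have hW : ∀ n, n ∈ W ↔ ∃ a, ρ a m = n := fun n => Iff.rfl
  rw [← hW]
  rcases hs W (fun a n hn => by
    obtain ⟨b, rfl⟩ := (hW n).1 hn
    exact (hW _).2 ⟨a * b, by rw [map_mul]; rfl⟩) with h | h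
  · refine absurd ?_ hm
    rw [← AddSubgroup.mem_bot, ← hZ0, hZ]
    intro a
    rw [← AddSubgroup.mem_bot, ← h, hW]
    exact ⟨a, rfl⟩
  · rw [h]; trivial

theorem IsLeftPrimitive.isPrimeIdeal (hP : P.IsLeftPrimitive) : P.IsPrimeIdeal := by
  obtain ⟨N, _, ρ, h0, hs, hN⟩ := hP
  refine isPrimeIdeal_of_mem_or_mem ?_ fun a b h => ?_
  · rintro rfl
    obtain ⟨a, n, han⟩ := h0
    exact han ((hN a).1 trivial n)
  · by_contra! hc
    obtain ⟨ha, hb⟩ := hc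
    rw [hN] at ha hb
    push Not at ha hb
    obtain ⟨n, hn⟩ := ha
    obtain ⟨m, hm⟩ := hb
    obtain ⟨x, hx⟩ := exists_apply_eq_of_simple ρ h0 hs hm n
    apply hn
    have := (hN _).1 (h x) m
    rw [map_mul, map_mul] at this
    rw [← hx]
    exact this

/-- The action of `A` on its quotient by a left ideal. -/
def leftQuotientAction (J : AddSubgroup A) (hJ : ∀ a, ∀ x ∈ J, a * x ∈ J) :
    A →ₙ+* AddMonoid.End (A ⧸ J) where
  toFun a := QuotientAddGroup.map J J (AddMonoidHom.mulLeft a) fun x hx => hJ a x hx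
  map_mul' a b := by
    refine AddMonoidHom.ext fun n => ?_
    obtain ⟨x, rfl⟩ := QuotientAddGroup.mk_surjective n
    exact congrArg (QuotientAddGroup.mk (s := J)) (mul_assoc a b x)
  map_zero' := by
    refine AddMonoidHom.ext fun n => ?_
    obtain ⟨x, rfl⟩ := QuotientAddGroup.mk_surjective n
    exact congrArg (QuotientAddGroup.mk (s := J)) (zero_mul x)
  map_add' a b := by
    refine AddMonoidHom.ext fun n => ?_
    obtain ⟨x, rfl⟩ := QuotientAddGroup.mk_surjective n
    exact congrArg (QuotientAddGroup.mk (s := J)) (add_mul a b x)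

theorem leftQuotientAction_mk (J : AddSubgroup A) (hJ : ∀ a, ∀ x ∈ J, a * x ∈ J) (a x : A) :
    leftQuotientAction J hJ a (x : A ⧸ J) = ((a * x : A) : A ⧸ J) := rfl

/-- The left ideal `J₀` of all `a` with `a e m ∈ P` for large `m` omits `e 0`. Take `J ⊇ J₀` maximal
among left ideals that omit `e 0`. Modulo `J₀` all `e n` agree with `e 0`, which is a right unit, so
`A ⧸ J` is simple. It is killed by `P`, since `P A ⊆ P ⊆ J₀`, but by no `e n`: otherwise `e n * e 0
∈ J`, hence `e n ∈ J` and `e 0 ∈ J`. -/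
theorem exists_isLeftPrimitive (P : TwoSidedIdeal A) (e : ℕ → A)
    (he : ∀ i j, i ≤ j → e i * e j = e j) (hP : ∀ n, e n ∉ P) :
    ∃ Q : TwoSidedIdeal A, Q.IsLeftPrimitive ∧ P ≤ Q ∧ ∀ n, e n ∉ Q := by
  let J₀ : AddSubgroup A :=
    { carrier := {a | ∃ n, ∀ m, n ≤ m → a * e m ∈ P}
      zero_mem' := ⟨0, fun m _ => by simp⟩
      add_mem' := by
        rintro a b ⟨n, hn⟩ ⟨n', hn'⟩
        exact ⟨max n n', fun m hm => by
          simpa [add_mul] using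
            P.add_mem (hn m (le_trans (le_max_left _ _) hm)) (hn' m (le_trans (le_max_right _ _) hm))⟩
      neg_mem' := by
        rintro a ⟨n, hn⟩
        exact ⟨n, fun m hm => by simpa using P.neg_mem (hn m hm)⟩ }
  have hJ₀ : ∀ a, a ∈ J₀ ↔ ∃ n, ∀ m, n ≤ m → a * e m ∈ P := fun a => Iff.rfl
  let S : Set (AddSubgroup A) := {J | J₀ ≤ J ∧ (∀ a, ∀ x ∈ J, a * x ∈ J) ∧ e 0 ∉ J}
  have hJS : J₀ ∈ S := by
    refine ⟨le_rfl, ?_, ?_⟩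
    · rintro a x ⟨n, hn⟩
      exact ⟨n, fun m hm => by simpa [mul_assoc] using P.mul_mem_left a _ (hn m hm)⟩
    · rintro ⟨n, hn⟩
      have := hn n le_rfl
      rw [he 0 n (Nat.zero_le _)] at this
      exact hP n this
  obtain ⟨J, -, ⟨hJ₀J, hJl, hJe⟩, hmax⟩ := zorn_le_nonempty₀ S (by
    intro c hc hch y hy
    have hmem : ∀ x, x ∈ sSup c ↔ ∃ W ∈ c, x ∈ W := fun x =>
      AddSubgroup.mem_sSup_of_directedOn ⟨y, hy⟩ hch.directedOn
    refine ⟨sSup c, ⟨(hc hy).1.trans (le_sSup hy), fun a x hx => ?_, fun h => ?_⟩,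
      fun z hz => le_sSup hz⟩
    · obtain ⟨W, hW, hx⟩ := (hmem x).1 hx
      exact (hmem _).2 ⟨W, hW, (hc hW).2.1 a x hx⟩
    · obtain ⟨W, hW, hx⟩ := (hmem _).1 h
      exact (hc hW).2.2 hx) J₀ hJS
  have hee : ∀ n, e n * e n = e n := fun n => he n n le_rfl
  -- `J` is modular with right unit `e 0`: a left ideal that contains `J` and `e 0` is all of `A`.
  have hsub : ∀ a, a - a * e 0 ∈ J := fun a => hJ₀J <| (hJ₀ _).2 ⟨0, fun m _ => by
    simp [sub_mul, mul_assoc, he 0 m (Nat.zero_le _)]⟩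
  have hsub' : ∀ n, e 0 - e n ∈ J := fun n => hJ₀J <| (hJ₀ _).2 ⟨n, fun m hm => by
    simp [sub_mul, he 0 m (Nat.zero_le _), he n m hm]⟩
  let ρ := leftQuotientAction J hJl
  have hρ : ∀ a x : A, ρ a (x : A ⧸ J) = ((a * x : A) : A ⧸ J) := leftQuotientAction_mk J hJl
  have hzero : ∀ x : A, (x : A ⧸ J) = 0 ↔ x ∈ J := fun x => QuotientAddGroup.eq_zero_iff x
  refine ⟨TwoSidedIdeal.ker ρ, ⟨A ⧸ J, inferInstance, ρ, ⟨e 0, (e 0 : A), ?_⟩, ?_, ?_⟩, ?_, ?_⟩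
  · rw [hρ, hee, Ne, hzero]
    exact hJe
  · intro W hW
    let W' : AddSubgroup A := W.comap (QuotientAddGroup.mk' J)
    have hW' : ∀ x, x ∈ W' ↔ (x : A ⧸ J) ∈ W := fun x => Iff.rfl
    have hJW : J ≤ W' := fun x hx => by
      rw [hW', (hzero x).2 hx]; exact W.zero_mem
    by_cases h : e 0 ∈ W'
    · right
      refine eq_top_iff.2 fun n _ => ?_
      obtain ⟨x, rfl⟩ := QuotientAddGroup.mk_surjective n
      have h1 : x * e 0 ∈ W' := hW x _ h
      have := W'.add_mem (hJW (hsub x)) h1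
      rw [sub_add_cancel] at this
      exact this
    · left
      refine eq_bot_iff.2 fun n hn => ?_
      obtain ⟨x, rfl⟩ := QuotientAddGroup.mk_surjective n
      exact (hzero x).2 (hmax ⟨hJ₀J.trans hJW, fun a x hx => hW a _ hx, h⟩ hJW hn)
  · intro a
    rw [TwoSidedIdeal.mem_ker]
    exact ⟨fun h n => by rw [h]; rfl, fun h => AddMonoidHom.ext h⟩
  · intro a ha
    rw [TwoSidedIdeal.mem_ker]
    refine AddMonoidHom.ext fun n => ?_
    obtain ⟨x, rfl⟩ := QuotientAddGroup.mk_surjective n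
    exact (hzero _).2 (hJ₀J ((hJ₀ _).2 ⟨0, fun m _ => by
      simpa [mul_assoc] using P.mul_mem_right _ (x * e m) ha⟩))
  · intro n hn
    rw [TwoSidedIdeal.mem_ker] at hn
    have h1 : ρ (e n) (e 0 : A) = 0 := by rw [hn]; rfl
    rw [hρ, hzero] at h1
    have h2 := J.sub_mem (hJl (e n) _ (hsub' n)) h1
    have h3 : e n ∈ J := by
      have h4 := J.neg_mem h2
      simpa [mul_sub, hee] using h4
    apply hJe
    simpa using J.add_mem (hsub' n) h3

end Primitive

end TwoSidedIdeal

/-! ### Prime ideals of a ring and of a commutative corner -/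

theorem PrimeSpec.isClosed_iff {A : Type u} [NonUnitalRing A] {Z : Set (PrimeSpec A)} :
    IsClosed Z ↔ ∃ I : TwoSidedIdeal A, Z = {P | I ≤ P.asIdeal} := by
  rw [← isOpen_compl_iff]
  change Zᶜᶜ ∈ _ ↔ _
  rw [compl_compl]
  exact ⟨fun ⟨I, h⟩ => ⟨I, h.symm⟩, fun ⟨I, h⟩ => ⟨I, h.symm⟩⟩

/-- `θ` identifies the commutative ring `R` with the corner of `A ⧸ I` at the idempotent `θ 1`. -/
structure IsCornerMap {A : Type u} [NonUnitalRing A] (I : TwoSidedIdeal A) {R : Type v} [CommRing R]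
    (θ : R →+ A) : Prop where
  mul : ∀ p q, θ (p * q) - θ p * θ q ∈ I
  surj : ∀ a, ∃ p, θ p - θ 1 * a * θ 1 ∈ I
  inj : ∀ p, θ p ∈ I → p = 0

namespace IsCornerMap

variable {A : Type u} [NonUnitalRing A] {I : TwoSidedIdeal A} {R : Type v} [CommRing R]
  {θ : R →+ A}

theorem eq_of_sub_mem (hθ : IsCornerMap I θ) {p q : R} (h : θ p - θ q ∈ I) : p = q :=
  sub_eq_zero.1 (hθ.inj _ (by rwa [map_sub]))

/-- The element of `R` that corresponds to the compression of `a` to the corner. -/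
noncomputable def coord (hθ : IsCornerMap I θ) (a : A) : R := (hθ.surj a).choose

theorem coord_spec (hθ : IsCornerMap I θ) (a : A) : θ (hθ.coord a) - θ 1 * a * θ 1 ∈ I :=
  (hθ.surj a).choose_spec

theorem coord_eq_of_mem (hθ : IsCornerMap I θ) {a : A} {p : R} (h : θ p - θ 1 * a * θ 1 ∈ I) :
    hθ.coord a = p := by
  refine hθ.eq_of_sub_mem ?_
  simpa using I.sub_mem (hθ.coord_spec a) h

theorem coord_add (hθ : IsCornerMap I θ) (a b : A) :
    hθ.coord (a + b) = hθ.coord a + hθ.coord b := by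
  refine hθ.coord_eq_of_mem ?_
  have := I.add_mem (hθ.coord_spec a) (hθ.coord_spec b)
  rwa [show θ (hθ.coord a + hθ.coord b) - θ 1 * (a + b) * θ 1 =
    θ (hθ.coord a) - θ 1 * a * θ 1 + (θ (hθ.coord b) - θ 1 * b * θ 1) by
      rw [map_add]; noncomm_ring]

theorem coord_zero (hθ : IsCornerMap I θ) : hθ.coord 0 = 0 :=
  hθ.coord_eq_of_mem (by simp)

theorem coord_neg (hθ : IsCornerMap I θ) (a : A) : hθ.coord (-a) = -hθ.coord a := by
  rw [eq_neg_iff_add_eq_zero, ← coord_add, neg_add_cancel, coord_zero]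

theorem one_mul_sub_mem (hθ : IsCornerMap I θ) (p : R) : θ p - θ 1 * θ p ∈ I := by
  simpa using hθ.mul 1 p

theorem mul_one_sub_mem (hθ : IsCornerMap I θ) (p : R) : θ p - θ p * θ 1 ∈ I := by
  simpa using hθ.mul p 1

theorem coord_apply (hθ : IsCornerMap I θ) (p : R) : hθ.coord (θ p) = p := by
  refine hθ.coord_eq_of_mem ?_
  have := I.add_mem (hθ.mul_one_sub_mem p) (I.mul_mem_right _ (θ 1) (hθ.one_mul_sub_mem p))
  rwa [sub_mul, sub_add_sub_cancel] at this

theorem coord_of_mem (hθ : IsCornerMap I θ) {a : A} (ha : a ∈ I) : hθ.coord a = 0 :=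
  hθ.coord_eq_of_mem (by
    rw [map_zero, zero_sub]
    exact I.neg_mem (I.mul_mem_right _ _ (I.mul_mem_left _ _ ha)))

theorem coord_congr (hθ : IsCornerMap I θ) {a b : A} (h : a - b ∈ I) : hθ.coord a = hθ.coord b := by
  have := hθ.coord_of_mem h
  rwa [sub_eq_add_neg, coord_add, coord_neg, ← sub_eq_add_neg, sub_eq_zero] at this

theorem one_sub_mem (hθ : IsCornerMap I θ) : θ 1 - θ 1 * θ 1 ∈ I := hθ.one_mul_sub_mem 1

/-- Compression to a corner is not multiplicative; it becomes so when the idempotent is inserted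
between the factors. -/
theorem coord_mul (hθ : IsCornerMap I θ) (a b : A) :
    hθ.coord (a * θ 1 * b) = hθ.coord a * hθ.coord b := by
  refine hθ.coord_eq_of_mem ?_
  have h1 := hθ.mul (hθ.coord a) (hθ.coord b)
  have h2 := TwoSidedIdeal.mul_sub_mul_mem (hθ.coord_spec a) (hθ.coord_spec b)
  have h3 := I.mul_mem_left (θ 1 * a) _ (I.mul_mem_right _ (b * θ 1) hθ.one_sub_mem)
  have := I.sub_mem (I.add_mem h1 h2) h3
  rwa [show θ (hθ.coord a * hθ.coord b) - θ 1 * (a * θ 1 * b) * θ 1 =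
    θ (hθ.coord a * hθ.coord b) - θ (hθ.coord a) * θ (hθ.coord b) +
    (θ (hθ.coord a) * θ (hθ.coord b) - θ 1 * a * θ 1 * (θ 1 * b * θ 1)) -
    θ 1 * a * ((θ 1 - θ 1 * θ 1) * (b * θ 1)) by noncomm_ring]

theorem coord_one (hθ : IsCornerMap I θ) : hθ.coord (θ 1) = 1 := hθ.coord_apply 1

theorem coord_mul_one (hθ : IsCornerMap I θ) (a : A) : hθ.coord (a * θ 1) = hθ.coord a := by
  have h := hθ.coord_mul a (θ 1)
  rw [coord_one, mul_one] at h
  rw [← h]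
  refine hθ.coord_congr ?_
  have := I.mul_mem_left a _ hθ.one_sub_mem
  rwa [mul_sub, ← mul_assoc] at this

theorem coord_one_mul (hθ : IsCornerMap I θ) (a : A) : hθ.coord (θ 1 * a) = hθ.coord a := by
  have h := hθ.coord_mul (θ 1) a
  rw [coord_one, one_mul] at h
  rw [← h]
  refine hθ.coord_congr ?_
  have := I.mul_mem_right _ a hθ.one_sub_mem
  rwa [sub_mul] at this

theorem coord_mul_apply_mul (hθ : IsCornerMap I θ) (x y : A) (p : R) :
    hθ.coord (x * θ p * y) = hθ.coord x * p * hθ.coord y := by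
  have h : θ p - θ 1 * θ p * θ 1 ∈ I := by
    simpa [coord_apply] using hθ.coord_spec (θ p)
  rw [hθ.coord_congr (b := x * θ 1 * (θ p * θ 1 * y)), coord_mul, coord_mul, coord_apply,
    mul_assoc]
  have := I.mul_mem_left x _ (I.mul_mem_right _ y h)
  rwa [show x * θ p * y - x * θ 1 * (θ p * θ 1 * y) = x * ((θ p - θ 1 * θ p * θ 1) * y) by
    noncomm_ring]

theorem apply_coord_mem_iff (hθ : IsCornerMap I θ) {P : TwoSidedIdeal A} (hP : I ≤ P) (a : A) :
    θ (hθ.coord a) ∈ P ↔ θ 1 * a * θ 1 ∈ P :=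
  TwoSidedIdeal.mem_congr hP (hθ.coord_spec a)

/-- The trace of an ideal on the corner. -/
def restrictIdeal (hθ : IsCornerMap I θ) (P : TwoSidedIdeal A) (hP : I ≤ P) : Ideal R where
  carrier := {p | θ p ∈ P}
  zero_mem' := by simp
  add_mem' hp hq := by simpa using P.add_mem hp hq
  smul_mem' r p hp := (TwoSidedIdeal.mem_congr hP (hθ.mul r p)).2 (P.mul_mem_left _ _ hp)

/-- A prime that omits the idempotent is determined by its trace on the corner: two uses of
primeness strip the factors `θ 1` from `θ 1 * x * a * y * θ 1`. -/
theorem mem_iff_forall_coord (hθ : IsCornerMap I θ) {P : TwoSidedIdeal A} (hP : P.IsPrimeIdeal)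
    (hI : I ≤ P) (h1 : θ 1 ∉ P) (a : A) :
    a ∈ P ↔ ∀ x y, θ (hθ.coord (x * a * y)) ∈ P := by
  simp only [hθ.apply_coord_mem_iff hI]
  refine ⟨fun h x y => P.mul_mem_right _ _ (P.mul_mem_left _ _
    (P.mul_mem_right _ _ (P.mul_mem_left _ _ h))), fun h => ?_⟩
  refine (hP.mem_or_mem (a := a) (b := θ 1) fun y => ?_).resolve_right h1
  refine (hP.mem_or_mem (a := θ 1) fun x => ?_).resolve_left h1
  simpa [mul_assoc] using h x y

/-- Commutativity of the corner is essential: `θ p * x * θ q` has coordinate `coord x * (p * q)` for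
every `x`, so `p q` in the trace forces `θ p * A * θ q ⊆ P`. -/
theorem isPrime_restrictIdeal (hθ : IsCornerMap I θ) {P : TwoSidedIdeal A} (hP : P.IsPrimeIdeal)
    (hI : I ≤ P) (h1 : θ 1 ∉ P) : (hθ.restrictIdeal P hI).IsPrime := by
  refine ⟨(Ideal.ne_top_iff_one _).2 h1, fun {p q} hpq => ?_⟩
  refine hP.mem_or_mem fun x => ?_
  have h2 : ∀ p, θ p - θ 1 * θ p * θ 1 ∈ I := fun p => by
    simpa [coord_apply] using hθ.coord_spec (θ p)
  have h3 : θ 1 * (θ p * x * θ q) * θ 1 ∈ P := by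
    rw [← hθ.apply_coord_mem_iff hI]
    have : hθ.coord (θ p * x * θ q) = hθ.coord x * (p * q) := by
      rw [← hθ.coord_mul_one, mul_assoc _ (θ q), ← hθ.coord_one_mul,
        show θ 1 * (θ p * x * (θ q * θ 1)) = θ 1 * θ p * (x * θ q * θ 1) by noncomm_ring,
        coord_mul_apply_mul, coord_mul_apply_mul, coord_one]
      ring
    rw [this]
    exact (hθ.restrictIdeal P hI).mul_mem_left _ hpq
  refine (TwoSidedIdeal.mem_congr hI ?_).2 h3
  have h4 := I.mul_mem_right _ (x * θ q) (hθ.one_mul_sub_mem p)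
  have h5 := I.mul_mem_left (θ 1 * θ p * x) _ (hθ.mul_one_sub_mem q)
  have := I.add_mem h4 h5
  rwa [show θ p * x * θ q - θ 1 * (θ p * x * θ q) * θ 1 =
    (θ p - θ 1 * θ p) * (x * θ q) + θ 1 * θ p * x * (θ q - θ q * θ 1) by noncomm_ring]

/-- The largest ideal of `A` with a given trace on the corner. -/
noncomputable def extendIdeal (hθ : IsCornerMap I θ) (q : Ideal R) : TwoSidedIdeal A :=
  .mk' {a | ∀ x y, hθ.coord (x * a * y) ∈ q}
    (fun x y => by simp [coord_zero])
    (fun ha hb x y => by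
      rw [mul_add, add_mul, coord_add]; exact q.add_mem (ha x y) (hb x y))
    (fun ha x y => by
      rw [mul_neg, neg_mul, coord_neg]; exact q.neg_mem (ha x y))
    (fun {z a} ha x y => by rw [← mul_assoc]; exact ha (x * z) y)
    (fun {a z} ha x y => by rw [← mul_assoc, mul_assoc]; exact ha x (z * y))

theorem mem_extendIdeal (hθ : IsCornerMap I θ) {q : Ideal R} {a : A} :
    a ∈ hθ.extendIdeal q ↔ ∀ x y, hθ.coord (x * a * y) ∈ q :=
  TwoSidedIdeal.mem_mk' _ _ _ _ _ _ _

theorem le_extendIdeal (hθ : IsCornerMap I θ) (q : Ideal R) : I ≤ hθ.extendIdeal q :=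
  fun a ha => hθ.mem_extendIdeal.2 fun x y => by
    rw [hθ.coord_of_mem (I.mul_mem_right _ _ (I.mul_mem_left _ _ ha))]
    exact q.zero_mem

theorem apply_mem_extendIdeal (hθ : IsCornerMap I θ) {q : Ideal R} {p : R} :
    θ p ∈ hθ.extendIdeal q ↔ p ∈ q := by
  rw [mem_extendIdeal]
  refine ⟨fun h => ?_, fun h x y => ?_⟩
  · simpa [coord_mul_apply_mul, coord_one] using h (θ 1) (θ 1)
  · rw [coord_mul_apply_mul]
    exact q.mul_mem_right _ (q.mul_mem_left _ h)

/-- If `x a y` and `x' b y'` have coordinates outside `q`, then `x a (y θ(1) x') b y'` has their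
product as coordinate, again outside `q`. -/
theorem isPrimeIdeal_extendIdeal (hθ : IsCornerMap I θ) {q : Ideal R} (hq : q.IsPrime) :
    (hθ.extendIdeal q).IsPrimeIdeal := by
  refine TwoSidedIdeal.isPrimeIdeal_of_mem_or_mem (fun h => ?_) fun a b h => ?_
  · refine hq.ne_top ((Ideal.eq_top_iff_one _).2 ?_)
    rw [← hθ.apply_mem_extendIdeal, h]
    trivial
  · by_contra! hc
    simp only [mem_extendIdeal] at h hc
    push Not at hc
    obtain ⟨⟨x, y, h1⟩, x', y', h2⟩ := hc
    have := h (y * θ 1 * x') x y'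
    rw [show x * (a * (y * θ 1 * x') * b) * y' = x * a * y * θ 1 * (x' * b * y') by noncomm_ring,
      coord_mul] at this
    rcases hq.mem_or_mem this with h | h
    exacts [h1 h, h2 h]

/-- The primes of `A` that contain `I` but not `θ 1` correspond to the primes of the corner. -/
theorem nonempty_homeomorph (hθ : IsCornerMap I θ) (S : Set (PrimeSpec A))
    (hS : ∀ P, P ∈ S ↔ I ≤ P.asIdeal ∧ θ 1 ∉ P.asIdeal) : Nonempty (S ≃ₜ PrimeSpectrum R) := by
  have hle := fun P : S => ((hS P).1 P.2).1
  have h1 := fun P : S => ((hS P).1 P.2).2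
  let Φ : S → PrimeSpectrum R := fun P =>
    ⟨hθ.restrictIdeal P.1.asIdeal (hle P), hθ.isPrime_restrictIdeal P.1.isPrime (hle P) (h1 P)⟩
  let Ψ : PrimeSpectrum R → S := fun q =>
    ⟨⟨hθ.extendIdeal q.asIdeal, hθ.isPrimeIdeal_extendIdeal q.isPrime⟩, (hS _).2
      ⟨hθ.le_extendIdeal _, fun h =>
        q.isPrime.ne_top ((Ideal.eq_top_iff_one _).2 (hθ.apply_mem_extendIdeal.1 h))⟩⟩
  refine ⟨{
    toFun := Φ
    invFun := Ψ
    left_inv := fun P => ?_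
    right_inv := fun q => ?_
    continuous_toFun := ?_
    continuous_invFun := ?_ }⟩
  · refine Subtype.ext (PrimeSpec.ext (TwoSidedIdeal.ext fun a => ?_))
    exact hθ.mem_extendIdeal.trans
      (hθ.mem_iff_forall_coord P.1.isPrime (hle P) (h1 P) a).symm
  · exact PrimeSpectrum.ext (Ideal.ext fun p => hθ.apply_mem_extendIdeal)
  · refine continuous_iff_isClosed.2 fun Z hZ => ?_
    obtain ⟨s, rfl⟩ := (PrimeSpectrum.isClosed_iff_zeroLocus _).1 hZ
    -- The preimage of the zero locus of `s` is the hull of the ideal generated by `θ '' s`.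
    refine isClosed_induced_iff.2
      ⟨_, PrimeSpec.isClosed_iff.2 ⟨TwoSidedIdeal.span (θ '' s), rfl⟩, ?_⟩
    ext P
    simp only [Set.mem_preimage, Set.mem_ofPred_eq, TwoSidedIdeal.span_le,
      PrimeSpectrum.mem_zeroLocus, Set.image_subset_iff]
    rfl
  · refine continuous_iff_isClosed.2 fun Z hZ => ?_
    obtain ⟨Z', hZ', rfl⟩ := isClosed_induced_iff.1 hZ
    obtain ⟨J, rfl⟩ := PrimeSpec.isClosed_iff.1 hZ'
    -- The primes whose extension contains `J` are the zeros of all coordinates of elements `x a y`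
    -- with `a ∈ J`.
    refine (PrimeSpectrum.isClosed_iff_zeroLocus _).2
      ⟨{p | ∃ a ∈ J, ∃ x y, p = hθ.coord (x * a * y)}, ?_⟩
    ext q
    simp only [Set.mem_preimage, Set.mem_ofPred_eq, PrimeSpectrum.mem_zeroLocus]
    constructor
    · rintro h _ ⟨a, ha, x, y, rfl⟩
      exact hθ.mem_extendIdeal.1 (h ha) x y
    · exact fun h a ha => hθ.mem_extendIdeal.2 fun x y => h ⟨a, ha, x, y, rfl⟩

/-- Maximality of the trace of `P`. If `r` comes from `Q` and does not kill the simple module, pick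
`m` in `θ 1 · N` with `r m ≠ 0` and `a` with `a r m = m`. Then `t = 1 - coord a * r` kills `m`, and
by commutativity of the corner it kills `A m = N`, so `θ t ∈ P ≤ Q`. As `θ (coord a * r) ∈ Q` too,
this gives `θ 1 ∈ Q`. -/
theorem le_of_isLeftPrimitive (hθ : IsCornerMap I θ) {P Q : TwoSidedIdeal A}
    (hP : P.IsLeftPrimitive) (hIP : I ≤ P) (hPQ : P ≤ Q) (hQ : θ 1 ∉ Q) : Q ≤ P := by
  intro q hq
  have hprime := hP.isPrimeIdeal
  rw [hθ.mem_iff_forall_coord hprime hIP fun h => hQ (hPQ h)]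
  intro x y
  set r := hθ.coord (x * q * y) with hr
  have hrQ : θ r ∈ Q := (hθ.apply_coord_mem_iff (hIP.trans hPQ) _).2
    (Q.mul_mem_right _ _ (Q.mul_mem_left _ _ (Q.mul_mem_right _ _ (Q.mul_mem_left _ _ hq))))
  obtain ⟨N, _, ρ, h0, hs, hN⟩ := hP
  have hmul : ∀ a b n, ρ (a * b) n = ρ a (ρ b n) := fun a b n => by rw [map_mul]; rfl
  have hcongr : ∀ a b, a - b ∈ I → ∀ n, ρ a n = ρ b n := fun a b h n => by
    have := (hN _).1 (hIP h) n
    rw [map_sub] at this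
    exact sub_eq_zero.1 this
  rw [hN]
  by_contra! hc
  obtain ⟨n, hn⟩ := hc
  set m := ρ (θ 1) n with hm
  have hrm : ρ (θ r) m = ρ (θ r) n := by
    rw [hm, ← hmul, hcongr _ _ (hθ.mul_one_sub_mem r) n]
  have hm0 : m ≠ 0 := fun h => hn (by rw [← hrm, h, map_zero])
  have hem : ρ (θ 1) m = m := by
    rw [hm, ← hmul]
    exact (hcongr _ _ hθ.one_sub_mem n).symm
  obtain ⟨a, ha⟩ := TwoSidedIdeal.exists_apply_eq_of_simple ρ h0 hs hn m
  have hcomp : ∀ a p, ρ (θ (hθ.coord a * p)) m = ρ (θ 1) (ρ a (ρ (θ p) m)) := fun a p => by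
    rw [hcongr _ _ (hθ.mul _ p), hmul, hcongr _ _ (hθ.coord_spec a), hmul, hmul, ← hmul (θ 1) (θ p),
      ← hcongr _ _ (hθ.one_mul_sub_mem p)]
  set t := 1 - hθ.coord a * r with ht
  have htm : ρ (θ t) m = 0 := by
    have h5 := hcomp a r
    rw [hrm, ha] at h5
    rw [ht, map_sub, map_sub]
    exact sub_eq_zero.2 h5.symm
  have htP : θ t ∈ P := by
    rw [hN]
    intro n'
    obtain ⟨b, rfl⟩ := TwoSidedIdeal.exists_apply_eq_of_simple ρ h0 hs hm0 n'
    rw [hcongr _ _ (hθ.mul_one_sub_mem t), hmul]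
    have h6 := hcomp b 1
    rw [hem] at h6
    rw [← h6, mul_one, ← hmul, ← hcongr _ _ (hθ.mul _ _), mul_comm, hcomp, htm, map_zero, map_zero]
  refine hQ ?_
  have h7 : θ (hθ.coord a * r) ∈ Q :=
    (TwoSidedIdeal.mem_congr (hIP.trans hPQ) (hθ.mul _ _)).2 (Q.mul_mem_left _ _ hrQ)
  have h8 := Q.add_mem (hPQ htP) h7
  rwa [← map_add, ht, sub_add_cancel] at h8

end IsCornerMap

/-! ### Paths with prescribed end points -/

namespace DirGraph

variable {V : Type u} {E : Type v} (G : DirGraph V E)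

/-- `l` is the list of the edges of a path from `x` to `y`. -/
def IsWalk : V → List E → V → Prop
  | x, [], y => x = y
  | x, e :: l, y => G.s e = x ∧ IsWalk (G.r e) l y

variable {G}

@[simp] theorem isWalk_nil {x y : V} : G.IsWalk x [] y ↔ x = y := Iff.rfl

@[simp] theorem isWalk_cons {x y : V} {e : E} {l : List E} :
    G.IsWalk x (e :: l) y ↔ G.s e = x ∧ G.IsWalk (G.r e) l y := Iff.rfl

theorem isWalk_append {x z : V} {l l' : List E} :
    G.IsWalk x (l ++ l') z ↔ ∃ y, G.IsWalk x l y ∧ G.IsWalk y l' z := by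
  induction l generalizing x with
  | nil => simp
  | cons e l ih => simp [ih, and_assoc]

theorem IsWalk.append {x y z : V} {l l' : List E} (h : G.IsWalk x l y) (h' : G.IsWalk y l' z) :
    G.IsWalk x (l ++ l') z := isWalk_append.2 ⟨y, h, h'⟩

theorem IsWalk.end_unique {x y y' : V} {l : List E} (h : G.IsWalk x l y) (h' : G.IsWalk x l y') :
    y = y' := by
  induction l generalizing x with
  | nil => exact h.symm.trans h'
  | cons e l ih => exact ih h.2 h'.2

theorem IsWalk.reaches {x y : V} {l : List E} (h : G.IsWalk x l y) : G.Reaches x y := by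
  induction l generalizing x with
  | nil => obtain rfl := h; exact .refl
  | cons e l ih => exact .head ⟨e, h.1, rfl⟩ (ih h.2)

theorem reaches_iff_exists_isWalk {x y : V} : G.Reaches x y ↔ ∃ l, G.IsWalk x l y := by
  refine ⟨fun h => ?_, fun ⟨l, h⟩ => h.reaches⟩
  induction h using Relation.ReflTransGen.head_induction_on with
  | refl => exact ⟨[], rfl⟩
  | head h _ ih =>
    obtain ⟨e, rfl, rfl⟩ := h
    obtain ⟨l, hl⟩ := ih
    exact ⟨e :: l, rfl, hl⟩

end DirGraph

/-! ### Monomials, local units and the tail of a prime ideal -/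

namespace LeavittPathAlgebra

open Leavitt

variable (K : Type w) [Field K] {V : Type u} {E : Type v} (G : DirGraph V E)

/-- An edge, as an element of `L_K(G)`. -/
noncomputable def edge (e : E) : LeavittPathAlgebra K G := ι K G (.edge e)

/-- A ghost edge, as an element of `L_K(G)`. -/
noncomputable def ghost (e : E) : LeavittPathAlgebra K G := ι K G (.ghost e)

section Relations

theorem vertex_mul_self (x : V) : vertex K G x * vertex K G x = vertex K G x :=
  mk_eq_of_rel K G (.vert_idem x)

theorem vertex_mul_of_ne {x y : V} (h : x ≠ y) : vertex K G x * vertex K G y = 0 :=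
  mk_eq_of_rel K G (.vert_orth x y h)

theorem source_mul_edge (e : E) : vertex K G (G.s e) * edge K G e = edge K G e :=
  mk_eq_of_rel K G (.source_edge e)

theorem edge_mul_range (e : E) : edge K G e * vertex K G (G.r e) = edge K G e :=
  mk_eq_of_rel K G (.edge_range e)

theorem range_mul_ghost (e : E) : vertex K G (G.r e) * ghost K G e = ghost K G e :=
  mk_eq_of_rel K G (.range_ghost e)

theorem ghost_mul_source (e : E) : ghost K G e * vertex K G (G.s e) = ghost K G e :=
  mk_eq_of_rel K G (.ghost_source e)

theorem ghost_mul_edge_self (e : E) : ghost K G e * edge K G e = vertex K G (G.r e) :=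
  mk_eq_of_rel K G (.ck1_same e)

theorem ghost_mul_edge_of_ne {e f : E} (h : e ≠ f) : ghost K G e * edge K G f = 0 :=
  mk_eq_of_rel K G (.ck1_ne e f h)

theorem sum_edge_mul_ghost {x : V} (hfin : {e : E | G.s e = x}.Finite) (hne : ∃ e : E, G.s e = x) :
    ∑ e ∈ hfin.toFinset, edge K G e * ghost K G e = vertex K G x := by
  have := mk_eq_of_rel K G (.ck2 x hfin hne)
  rwa [mk_sum] at this

theorem vertex_mul_edge_of_ne {x : V} {e : E} (h : x ≠ G.s e) :
    vertex K G x * edge K G e = 0 := by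
  rw [← source_mul_edge, ← mul_assoc, vertex_mul_of_ne K G h, zero_mul]

theorem edge_mul_vertex_of_ne {x : V} {e : E} (h : G.r e ≠ x) :
    edge K G e * vertex K G x = 0 := by
  rw [← edge_mul_range, mul_assoc, vertex_mul_of_ne K G h, mul_zero]

theorem ghost_mul_vertex_of_ne {x : V} {e : E} (h : G.s e ≠ x) :
    ghost K G e * vertex K G x = 0 := by
  rw [← ghost_mul_source, mul_assoc, vertex_mul_of_ne K G h, mul_zero]

end Relations

section Hom

variable {A : Type*} [NonUnitalRing A] [Module K A]

@[simp] theorem lift_ι [IsScalarTower K A A] [SMulCommClass K A A] (f : Gen V E → A)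
    (hf : ∀ p q, Rel K G p q → liftFree K f p = liftFree K f q) (g : Gen V E) :
    lift K G f hf (ι K G g) = f g :=
  liftFree_gen K f g

theorem mk_ofMagma (m : FreeSemigroup (Gen V E)) :
    mk K G (MonoidAlgebra.ofMagma K _ m) = FreeSemigroup.lift (ι K G) m := by
  let φ : FreeSemigroup (Gen V E) →ₙ* LeavittPathAlgebra K G :=
    { toFun := fun m => mk K G (MonoidAlgebra.ofMagma K _ m)
      map_mul' := fun a b => by rw [map_mul, mk_mul] }
  have : φ = FreeSemigroup.lift (ι K G) := FreeSemigroup.hom_ext (by ext g; rfl)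
  exact DFunLike.congr_fun this m

variable {K G} in
theorem word_induction {p : LeavittPathAlgebra K G → Prop} (zero : p 0)
    (add : ∀ a b, p a → p b → p (a + b)) (smul : ∀ (k : K) a, p a → p (k • a))
    (word : ∀ m, p (FreeSemigroup.lift (ι K G) m)) (a : LeavittPathAlgebra K G) : p a := by
  obtain ⟨a, rfl⟩ := mk_surjective a
  induction a using MonoidAlgebra.induction_linear with
  | zero => exact zero
  | add f g hf hg => exact add _ _ hf hg
  | single m k =>
    have : (MonoidAlgebra.single m k : FreeAlg K V E) = k • MonoidAlgebra.ofMagma K _ m := by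
      simp [MonoidAlgebra.ofMagma]
    rw [this, mk_smul, mk_ofMagma]
    exact smul _ _ (word m)

end Hom

section Paths

/-- The path with initial vertex `x` and edges `l`, as an element of `L_K(G)`. -/
noncomputable def pathElem : V → List E → LeavittPathAlgebra K G
  | x, [] => vertex K G x
  | _, e :: l => edge K G e * pathElem (G.r e) l

/-- The ghost of the path with initial vertex `x` and edges `l`. -/
noncomputable def ghostElem : V → List E → LeavittPathAlgebra K G
  | x, [] => vertex K G x
  | _, e :: l => ghostElem (G.r e) l * ghost K G e

@[simp] theorem pathElem_nil (x : V) : pathElem K G x [] = vertex K G x := rfl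

@[simp] theorem pathElem_cons (x : V) (e : E) (l : List E) :
    pathElem K G x (e :: l) = edge K G e * pathElem K G (G.r e) l := rfl

@[simp] theorem ghostElem_nil (x : V) : ghostElem K G x [] = vertex K G x := rfl

@[simp] theorem ghostElem_cons (x : V) (e : E) (l : List E) :
    ghostElem K G x (e :: l) = ghostElem K G (G.r e) l * ghost K G e := rfl

variable {G} {x y z : V} {l l' : List E}

theorem vertex_mul_pathElem (h : G.IsWalk x l y) :
    vertex K G x * pathElem K G x l = pathElem K G x l := by
  cases l with
  | nil => exact vertex_mul_self K G x
  | cons e l => rw [pathElem_cons, ← mul_assoc, ← h.1, source_mul_edge]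

theorem pathElem_mul_vertex (h : G.IsWalk x l y) :
    pathElem K G x l * vertex K G y = pathElem K G x l := by
  induction l generalizing x with
  | nil => obtain rfl := h; exact vertex_mul_self K G x
  | cons e l ih => rw [pathElem_cons, mul_assoc, ih h.2]

theorem ghostElem_mul_vertex (h : G.IsWalk x l y) :
    ghostElem K G x l * vertex K G x = ghostElem K G x l := by
  cases l with
  | nil => exact vertex_mul_self K G x
  | cons e l => rw [ghostElem_cons, mul_assoc, ← h.1, ghost_mul_source]

theorem vertex_mul_ghostElem (h : G.IsWalk x l y) :
    vertex K G y * ghostElem K G x l = ghostElem K G x l := by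
  induction l generalizing x with
  | nil => obtain rfl := h; exact vertex_mul_self K G x
  | cons e l ih => rw [ghostElem_cons, ← mul_assoc, ih h.2]

theorem pathElem_append (h : G.IsWalk x l y) (h' : G.IsWalk y l' z) :
    pathElem K G x (l ++ l') = pathElem K G x l * pathElem K G y l' := by
  induction l generalizing x with
  | nil => obtain rfl := h; exact (vertex_mul_pathElem K h').symm
  | cons e l ih => rw [List.cons_append, pathElem_cons, pathElem_cons, ih h.2, mul_assoc]

theorem ghostElem_append (h : G.IsWalk x l y) (h' : G.IsWalk y l' z) :
    ghostElem K G x (l ++ l') = ghostElem K G y l' * ghostElem K G x l := by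
  induction l generalizing x with
  | nil => obtain rfl := h; exact (ghostElem_mul_vertex K h').symm
  | cons e l ih => rw [List.cons_append, ghostElem_cons, ghostElem_cons, ih h.2, mul_assoc]

theorem ghostElem_mul_pathElem (h : G.IsWalk x l y) :
    ghostElem K G x l * pathElem K G x l = vertex K G y := by
  induction l generalizing x with
  | nil => obtain rfl := h; exact vertex_mul_self K G x
  | cons e l ih =>
    rw [ghostElem_cons, pathElem_cons, mul_assoc, ← mul_assoc (ghost K G e), ghost_mul_edge_self,
      vertex_mul_pathElem K h.2, ih h.2]

theorem vertex_mul_pathElem_of_ne (h : G.IsWalk x l y) (hz : z ≠ x) :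
    vertex K G z * pathElem K G x l = 0 := by
  rw [← vertex_mul_pathElem K h, ← mul_assoc, vertex_mul_of_ne K G hz, zero_mul]

theorem pathElem_mul_vertex_of_ne (h : G.IsWalk x l y) (hz : y ≠ z) :
    pathElem K G x l * vertex K G z = 0 := by
  rw [← pathElem_mul_vertex K h, mul_assoc, vertex_mul_of_ne K G hz, mul_zero]

theorem ghostElem_mul_vertex_of_ne (h : G.IsWalk x l y) (hz : x ≠ z) :
    ghostElem K G x l * vertex K G z = 0 := by
  rw [← ghostElem_mul_vertex K h, mul_assoc, vertex_mul_of_ne K G hz, mul_zero]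

variable (G) in
/-- The monomials `α β*`. -/
def monomials : Set (LeavittPathAlgebra K G) :=
  {a | ∃ x l y l' z, G.IsWalk x l z ∧ G.IsWalk y l' z ∧ a = pathElem K G x l * ghostElem K G y l'}

theorem ι_mul_mem_span (g : Gen V E) {a : LeavittPathAlgebra K G} (ha : a ∈ monomials K G) :
    ι K G g * a ∈ Submodule.span K (monomials K G) := by
  obtain ⟨x, l, y, l', z, h, h', rfl⟩ := ha
  rw [← mul_assoc]
  cases g with
  | vert t =>
    change vertex K G t * _ * _ ∈ _
    by_cases hx : t = x
    · rw [hx, vertex_mul_pathElem K h]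
      exact Submodule.subset_span ⟨x, l, y, l', z, h, h', rfl⟩
    · rw [vertex_mul_pathElem_of_ne K h hx, zero_mul]; exact zero_mem _
  | edge e =>
    change edge K G e * _ * _ ∈ _
    by_cases hx : G.r e = x
    · subst hx
      exact Submodule.subset_span ⟨G.s e, e :: l, y, l', z, ⟨rfl, h⟩, h', by rw [pathElem_cons]⟩
    · rw [← vertex_mul_pathElem K h, ← mul_assoc, edge_mul_vertex_of_ne K G hx]
      simp
  | ghost e =>
    change ghost K G e * _ * _ ∈ _
    cases l with
    | nil =>
      obtain rfl := h
      rw [pathElem_nil]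
      by_cases hx : G.s e = x
      · subst hx
        refine Submodule.subset_span ⟨G.r e, [], y, l' ++ [e], G.r e, rfl,
          h'.append ⟨rfl, rfl⟩, ?_⟩
        rw [ghostElem_append K h' (l' := [e]) (z := G.r e) ⟨rfl, rfl⟩, ghost_mul_source]
        simp only [ghostElem_cons, ghostElem_nil, pathElem_nil]
        rw [range_mul_ghost, ← mul_assoc, range_mul_ghost]
      · rw [ghost_mul_vertex_of_ne K G hx]; simp
    | cons f l =>
      rw [pathElem_cons, ← mul_assoc]
      by_cases hx : e = f
      · subst hx
        rw [ghost_mul_edge_self, vertex_mul_pathElem K h.2]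
        exact Submodule.subset_span ⟨_, l, y, l', z, h.2, h', rfl⟩
      · rw [ghost_mul_edge_of_ne K G hx]; simp

variable (G) in
theorem span_monomials : Submodule.span K (monomials K G) = ⊤ := by
  refine eq_top_iff.2 fun a _ => ?_
  have hmul : ∀ (g : Gen V E) (b), b ∈ Submodule.span K (monomials K G) →
      ι K G g * b ∈ Submodule.span K (monomials K G) := by
    intro g b hb
    induction hb using Submodule.span_induction with
    | mem b hb => exact ι_mul_mem_span K g hb
    | zero => simp
    | add b c _ _ hb hc => rw [mul_add]; exact add_mem hb hc
    | smul k b _ hb => rw [mul_smul_comm]; exact Submodule.smul_mem _ _ hb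
  induction a using word_induction with
  | zero => exact zero_mem _
  | add a b ha hb => exact add_mem (ha trivial) (hb trivial)
  | smul k a ha => exact Submodule.smul_mem _ _ (ha trivial)
  | word m =>
    induction m using FreeSemigroup.recOnMul with
    | ih1 g =>
      rw [FreeSemigroup.lift_of]
      cases g with
      | vert x =>
        exact Submodule.subset_span ⟨x, [], x, [], x, rfl, rfl, (vertex_mul_self K G x).symm⟩
      | edge e =>
        refine Submodule.subset_span ⟨G.s e, [e], G.r e, [], G.r e, ⟨rfl, rfl⟩, rfl, ?_⟩
        simp only [pathElem_cons, pathElem_nil, ghostElem_nil, edge_mul_range]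
        rfl
      | ghost e =>
        refine Submodule.subset_span ⟨G.r e, [], G.s e, [e], G.r e, rfl, ⟨rfl, rfl⟩, ?_⟩
        simp only [ghostElem_cons, pathElem_nil, ghostElem_nil, range_mul_ghost]
        rfl
    | ih2 g m _ hm =>
      rw [map_mul, FreeSemigroup.lift_of]
      exact hmul _ _ (hm trivial)

variable {K}

theorem monomial_induction {p : LeavittPathAlgebra K G → Prop} (zero : p 0)
    (add : ∀ a b, p a → p b → p (a + b)) (smul : ∀ (k : K) a, p a → p (k • a))
    (monomial : ∀ x l y l' z, G.IsWalk x l z → G.IsWalk y l' z →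
      p (pathElem K G x l * ghostElem K G y l')) (a : LeavittPathAlgebra K G) : p a := by
  have ha : a ∈ Submodule.span K (monomials K G) := by rw [span_monomials]; trivial
  induction ha using Submodule.span_induction with
  | mem b hb =>
    obtain ⟨x, l, y, l', z, h, h', rfl⟩ := hb
    exact monomial x l y l' z h h'
  | zero => exact zero
  | add b c _ _ hb hc => exact add _ _ hb hc
  | smul k b _ hb => exact smul _ _ hb

theorem sum_vertex_mul {S : Finset V} (hx : x ∈ S) :
    (∑ t ∈ S, vertex K G t) * vertex K G x = vertex K G x := by
  classical
  rw [Finset.sum_mul, Finset.sum_eq_single x (fun t _ ht => vertex_mul_of_ne K G ht)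
    (fun h => absurd hx h), vertex_mul_self]

theorem mul_sum_vertex {S : Finset V} (hx : x ∈ S) :
    vertex K G x * (∑ t ∈ S, vertex K G t) = vertex K G x := by
  classical
  rw [Finset.mul_sum, Finset.sum_eq_single x (fun t _ ht => vertex_mul_of_ne K G ht.symm)
    (fun h => absurd hx h), vertex_mul_self]

/-- Finite sums of distinct vertices are local units: a monomial `α β*` is fixed on the left by the
source of `α` and on the right by the source of `β`. -/
theorem exists_local_unit (a : LeavittPathAlgebra K G) : ∃ S : Finset V,
    ∀ T, S ⊆ T → (∑ t ∈ T, vertex K G t) * a = a ∧ a * (∑ t ∈ T, vertex K G t) = a := by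
  classical
  induction a using monomial_induction with
  | zero => exact ⟨∅, by simp⟩
  | add a b ha hb =>
    obtain ⟨S, hS⟩ := ha
    obtain ⟨S', hS'⟩ := hb
    refine ⟨S ∪ S', fun T hT => ?_⟩
    have h1 := hS T (Finset.union_subset_left hT)
    have h2 := hS' T (Finset.union_subset_right hT)
    rw [mul_add, add_mul, h1.1, h1.2, h2.1, h2.2]
    exact ⟨rfl, rfl⟩
  | smul k a ha =>
    obtain ⟨S, hS⟩ := ha
    refine ⟨S, fun T hT => ?_⟩
    rw [mul_smul_comm, smul_mul_assoc, (hS T hT).1, (hS T hT).2]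
    exact ⟨rfl, rfl⟩
  | monomial x l y l' z h h' =>
    refine ⟨{x, y}, fun T hT => ⟨?_, ?_⟩⟩
    · rw [← vertex_mul_pathElem K h, ← mul_assoc, ← mul_assoc, sum_vertex_mul (hT (by simp))]
    · rw [← ghostElem_mul_vertex K h', mul_assoc, mul_assoc, mul_sum_vertex (hT (by simp))]

end Paths

section Ideals

variable {K G} {P : TwoSidedIdeal (LeavittPathAlgebra K G)}

/-- Two-sided ideals here are ring ideals; they are closed under scalars because `k • a = (k • u) *
a` for a local unit `u` of `a`. -/
theorem smul_mem (k : K) {a : LeavittPathAlgebra K G} (ha : a ∈ P) : k • a ∈ P := by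
  obtain ⟨S, hS⟩ := exists_local_unit a
  rw [← (hS S subset_rfl).1, ← smul_mul_assoc]
  exact P.mul_mem_left _ _ ha

theorem smul_mem_iff {k : K} (hk : k ≠ 0) {a : LeavittPathAlgebra K G} : k • a ∈ P ↔ a ∈ P :=
  ⟨fun h => by simpa [smul_smul, hk] using smul_mem k⁻¹ h, smul_mem k⟩

theorem mem_of_forall_mul_vertex {a : LeavittPathAlgebra K G} (h : ∀ x, a * vertex K G x ∈ P) :
    a ∈ P := by
  obtain ⟨S, hS⟩ := exists_local_unit a
  rw [← (hS S subset_rfl).2, Finset.mul_sum]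
  exact sum_mem fun x _ => h x

theorem mem_of_forall_vertex_mul {a : LeavittPathAlgebra K G} (h : ∀ x, vertex K G x * a ∈ P) :
    a ∈ P := by
  obtain ⟨S, hS⟩ := exists_local_unit a
  rw [← (hS S subset_rfl).1, Finset.sum_mul]
  exact sum_mem fun x _ => h x

theorem eq_top_of_forall_vertex_mem (h : ∀ x, vertex K G x ∈ P) : P = ⊤ :=
  eq_top_iff.2 fun _ _ => mem_of_forall_mul_vertex fun x => P.mul_mem_left _ _ (h x)

theorem exists_of_reaches {x y : V} (h : G.Reaches x y) : ∃ p q : LeavittPathAlgebra K G,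
    q * p = vertex K G y ∧ vertex K G x * p = p ∧ p * vertex K G y = p ∧
      vertex K G y * q = q ∧ q * vertex K G x = q := by
  obtain ⟨l, hl⟩ := DirGraph.reaches_iff_exists_isWalk.1 h
  exact ⟨pathElem K G x l, ghostElem K G x l, ghostElem_mul_pathElem K hl, vertex_mul_pathElem K hl,
    pathElem_mul_vertex K hl, vertex_mul_ghostElem K hl, ghostElem_mul_vertex K hl⟩

theorem vertex_mem_of_reaches {x y : V} (hx : vertex K G x ∈ P) (h : G.Reaches x y) :
    vertex K G y ∈ P := by
  obtain ⟨p, q, h1, h2, -⟩ := exists_of_reaches (K := K) h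
  rw [← h1, ← h2]
  exact P.mul_mem_left _ _ (P.mul_mem_right _ _ hx)

theorem edge_mem_of_range_mem {e : E} (h : vertex K G (G.r e) ∈ P) : edge K G e ∈ P := by
  rw [← edge_mul_range]
  exact P.mul_mem_left _ _ h

theorem pathElem_mem_of_end_mem {x y : V} {l : List E} (hl : G.IsWalk x l y)
    (h : vertex K G y ∈ P) : pathElem K G x l ∈ P := by
  rw [← pathElem_mul_vertex K hl]
  exact P.mul_mem_left _ _ h

/-- An outgoing edge into the tail exists by the second Cuntz-Krieger relation: if all edges at `x`
had range in `P`, then `x = ∑ e e*` would lie in `P`. Directedness is primeness applied to `x L y`.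
-/
theorem isMaximalTail_tail (hG : G.RowFinite) (P : PrimeSpec (LeavittPathAlgebra K G)) :
    G.IsMaximalTail (tail K G P) where
  nonempty := by
    by_contra h
    rw [Set.not_nonempty_iff_eq_empty, Set.eq_empty_iff_forall_notMem] at h
    exact P.isPrime.ne_top (eq_top_of_forall_vertex_mem fun x => not_not.1 (h x))
  mem_of_reaches x y hy h hx := hy (vertex_mem_of_reaches hx h)
  exists_edge x hx hne := by
    by_contra! hc
    apply hx
    rw [← sum_edge_mul_ghost K G (hG x) hne]
    refine sum_mem fun e he => P.asIdeal.mul_mem_right _ _ (edge_mem_of_range_mem ?_)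
    exact not_not.1 (hc e ((hG x).mem_toFinset.1 he))
  directed x hx y hy := by
    by_contra! hc
    refine (P.isPrime.mem_or_mem (a := vertex K G x) (b := vertex K G y) fun a => ?_).elim hx hy
    induction a using monomial_induction with
    | zero => simp
    | add a b ha hb => rw [mul_add, add_mul]; exact P.asIdeal.add_mem ha hb
    | smul k a ha => rw [mul_smul_comm, smul_mul_assoc]; exact smul_mem k ha
    | monomial x' l y' l' z h h' =>
      by_cases h1 : x = x'
      · by_cases h2 : y' = y
        · subst h1 h2
          have : vertex K G z ∈ P.asIdeal := by
            by_contra hz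
            exact hc z hz h.reaches h'.reaches
          rw [mul_assoc, mul_assoc]
          exact P.asIdeal.mul_mem_left _ _
            (P.asIdeal.mul_mem_right _ _ (pathElem_mem_of_end_mem h this))
        · rw [mul_assoc, mul_assoc, ghostElem_mul_vertex_of_ne K h' h2]; simp
      · rw [← mul_assoc, vertex_mul_pathElem_of_ne K h h1]; simp

theorem mem_stratum_iff {M : Set V} {P : PrimeSpec (LeavittPathAlgebra K G)} :
    P ∈ stratum K G M ↔ ∀ x, vertex K G x ∈ P.asIdeal ↔ x ∉ M := Set.ext_iff

theorem mem_stratum_tail (P : PrimeSpec (LeavittPathAlgebra K G)) :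
    P ∈ stratum K G (tail K G P) := by
  simp [mem_stratum_iff, tail]

theorem tail_eq_iff {M : Set V} {P : PrimeSpec (LeavittPathAlgebra K G)} :
    tail K G P = M ↔ P ∈ stratum K G M := by
  rw [mem_stratum_iff, Set.ext_iff]
  exact forall_congr' fun x => not_iff_comm.trans Iff.comm

end Ideals

end LeavittPathAlgebra

/-! ### Exits of closed paths and Cuntz-Krieger uniqueness -/

namespace DirGraph

variable {V : Type u} {E : Type v} {G : DirGraph V E}

theorem IsWalk.isChain {x y : V} {l : List E} (h : G.IsWalk x l y) :
    l.IsChain (fun e f => G.r e = G.s f) := by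
  induction l generalizing x with
  | nil => exact .nil
  | cons e l ih =>
    cases l with
    | nil => exact .singleton e
    | cons f l => exact List.isChain_cons_cons.2 ⟨h.2.1.symm, ih h.2⟩

theorem IsWalk.range_getLast {x y : V} {l : List E} (h : G.IsWalk x l y) (hl : l ≠ []) :
    G.r (l.getLast hl) = y := by
  induction l generalizing x with
  | nil => exact absurd rfl hl
  | cons e l ih =>
    cases l with
    | nil => exact h.2
    | cons f l => rw [List.getLast_cons (by simp)]; exact ih h.2 (by simp)

theorem IsWalk.source_head {x y : V} {l : List E} (h : G.IsWalk x l y) (hl : l ≠ []) :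
    G.s (l.head hl) = x := by
  cases l with
  | nil => exact absurd rfl hl
  | cons e l => exact h.1

theorem exists_append_of_not_nodup_map {α β : Type*} (f : α → β) {l : List α}
    (h : ¬ (l.map f).Nodup) : ∃ l₁ a l₂ b l₃, l = l₁ ++ a :: (l₂ ++ b :: l₃) ∧ f a = f b := by
  induction l with
  | nil => simp at h
  | cons a l ih =>
    rw [List.map_cons, List.nodup_cons, not_and_or, not_not] at h
    rcases h with h | h
    · obtain ⟨b, hb, hab⟩ := List.mem_map.1 h
      obtain ⟨l₂, l₃, rfl⟩ := List.append_of_mem hb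
      exact ⟨[], a, l₂, b, l₃, rfl, hab.symm⟩
    · obtain ⟨l₁, a', l₂, b, l₃, rfl, h'⟩ := ih h
      exact ⟨a :: l₁, a', l₂, b, l₃, rfl, h'⟩

/-- If a source is repeated, the part of the path between the two occurrences is a shorter closed
path. -/
theorem IsWalk.exists_isCycle {x : V} {l : List E} (h : G.IsWalk x l x) (hl : l ≠ []) :
    ∃ c, G.IsCycle c ∧ c ⊆ l := by
  induction hn : l.length using Nat.strong_induction_on generalizing l x with
  | _ n ih =>
    by_cases hd : (l.map G.s).Nodup
    · exact ⟨l, ⟨h.isChain, ⟨hl, by rw [h.range_getLast, h.source_head]⟩, hd⟩, List.Subset.refl l⟩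
    · obtain ⟨l₁, a, l₂, b, l₃, rfl, hab⟩ := exists_append_of_not_nodup_map G.s hd
      obtain ⟨y, -, h1, h2⟩ := isWalk_append.1 h
      obtain ⟨z, h3, h4, -⟩ := isWalk_append.1 h2
      subst h4
      rw [← hab] at h3
      obtain ⟨c, hc, hcl⟩ := ih (a :: l₂).length (by
        rw [← hn]; simp; omega) (x := G.s a) (l := a :: l₂) ⟨rfl, h3⟩ (by simp) rfl
      refine ⟨c, hc, fun e he => ?_⟩
      have := hcl he
      simp only [List.mem_cons, List.mem_append] at this ⊢
      tauto

variable {M : Set V}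

theorem IsWalk.exists_restrict (hM : ∀ x y : V, y ∈ M → G.Reaches x y → x ∈ M) {x y : V}
    {l : List E} (h : G.IsWalk x l y) (hy : y ∈ M) :
    ∃ (hx : x ∈ M) (l' : List {e : E // G.s e ∈ M ∧ G.r e ∈ M}),
      (G.restrict M).IsWalk ⟨x, hx⟩ l' ⟨y, hy⟩ ∧ l'.map Subtype.val = l := by
  induction l generalizing x with
  | nil => obtain rfl := h; exact ⟨hy, [], rfl, rfl⟩
  | cons e l ih =>
    obtain ⟨hr, l', h1, h2⟩ := ih h.2
    obtain rfl := h.1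
    have hs := hM _ _ hy (IsWalk.reaches (l := e :: l) ⟨rfl, h.2⟩)
    exact ⟨hs, ⟨e, hs, hr⟩ :: l', ⟨rfl, h1⟩, by simp [h2]⟩

/-- The exit of a cycle whose edges occur in `l` is also an exit of `l`. It is recorded together
with the splitting of `l` at the edge `e` that it bypasses, since the path `l₁ f` is what gets used.
-/
theorem IsWalk.exists_exit (hM : ∀ x y : V, y ∈ M → G.Reaches x y → x ∈ M)
    (hL : (G.restrict M).ConditionL) {x : V} (hx : x ∈ M) {l : List E} (h : G.IsWalk x l x)
    (hl : l ≠ []) : ∃ l₁ e l₂ f, l = l₁ ++ e :: l₂ ∧ f ≠ e ∧ G.s f = G.s e ∧ G.r f ∈ M := by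
  obtain ⟨_, l', h1, rfl⟩ := h.exists_restrict hM hx
  obtain ⟨c, hc, hcl⟩ := h1.exists_isCycle (by rintro rfl; exact hl rfl)
  obtain ⟨f, e, he, hs, hne⟩ := hL c hc
  obtain ⟨l₁, l₂, rfl⟩ := List.append_of_mem (hcl he)
  exact ⟨l₁.map Subtype.val, e.1, l₂.map Subtype.val, f.1, by simp, fun h => hne (Subtype.ext h),
    congrArg Subtype.val hs, f.2.2⟩

end DirGraph

namespace LeavittPathAlgebra

open Leavitt

variable {K : Type w} [Field K] {V : Type u} {E : Type v} {G : DirGraph V E}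

theorem ghostElem_mul_pathElem_of_length_le {x y z : V} {l l' : List E} (h : G.IsWalk x l y)
    (h' : G.IsWalk x l' z) (hle : l.length ≤ l'.length) :
    ghostElem K G x l * pathElem K G x l' = 0 ∨ ∃ l'', G.IsWalk y l'' z ∧
      l''.length + l.length = l'.length ∧
      ghostElem K G x l * pathElem K G x l' = pathElem K G y l'' := by
  induction l generalizing x l' with
  | nil =>
    obtain rfl := h
    exact .inr ⟨l', h', by simp, vertex_mul_pathElem K h'⟩
  | cons e l ih =>
    cases l' with
    | nil => simp at hle
    | cons f l' =>
      rw [ghostElem_cons, pathElem_cons, mul_assoc, ← mul_assoc (ghost K G e)]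
      by_cases hef : e = f
      · subst hef
        rw [ghost_mul_edge_self, vertex_mul_pathElem K h'.2]
        rcases ih h.2 h'.2 (by simpa using hle) with h1 | ⟨l'', h1, h2, h3⟩
        · exact .inl h1
        · exact .inr ⟨l'', h1, by simp; omega, h3⟩
      · left
        rw [ghost_mul_edge_of_ne K G hef]
        simp

variable (K G) in
/-- `b` is a linear combination of at most `n` closed paths of positive length at `x`. -/
inductive IsClosedSum : ℕ → V → LeavittPathAlgebra K G → Prop
  | zero (x : V) : IsClosedSum 0 x 0
  | add {n : ℕ} {x : V} {b : LeavittPathAlgebra K G} (k : K) (l : List E) (h : G.IsWalk x l x)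
      (hl : l ≠ []) (hb : IsClosedSum n x b) : IsClosedSum (n + 1) x (k • pathElem K G x l + b)

/-- Conjugation by a path `τ` sends a closed path `p` at its source to `τ* p τ`, which is zero or a
closed path at its end of the same length as `p`. So positivity of lengths is kept and the number of
terms does not grow. -/
theorem IsClosedSum.compress {n : ℕ} {x y : V} {b : LeavittPathAlgebra K G}
    (hb : IsClosedSum K G n x b) {l : List E} (h : G.IsWalk x l y) :
    ∃ m ≤ n, IsClosedSum K G m y (ghostElem K G x l * b * pathElem K G x l) := by
  induction hb with
  | zero x => exact ⟨0, le_rfl, by simpa using IsClosedSum.zero y⟩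
  | @add n x b k l' h' hl' hb ih =>
    obtain ⟨m, hm, hm'⟩ := ih h
    rw [mul_add, add_mul, mul_smul_comm, smul_mul_assoc, mul_assoc, ← pathElem_append K h' h]
    rcases ghostElem_mul_pathElem_of_length_le (K := K) h (h'.append h) (by simp)
      with h1 | ⟨l'', h1, h2, h3⟩
    · exact ⟨m, by omega, by simpa [h1] using hm'⟩
    · refine ⟨m + 1, by omega, ?_⟩
      rw [h3]
      refine .add k l'' h1 ?_ hm'
      rintro rfl
      simp at h2
      exact hl' h2

theorem IsClosedSum.add_add {n m : ℕ} {x : V} {b c : LeavittPathAlgebra K G}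
    (hb : IsClosedSum K G n x b) (hc : IsClosedSum K G m x c) :
    ∃ j, IsClosedSum K G j x (b + c) := by
  induction hb with
  | zero x => exact ⟨m, by simpa using hc⟩
  | add k l h hl hb ih =>
    obtain ⟨j, hj⟩ := ih hc
    exact ⟨j + 1, by rw [add_assoc]; exact .add k l h hl hj⟩

theorem IsClosedSum.smul {n : ℕ} {x : V} {b : LeavittPathAlgebra K G}
    (hb : IsClosedSum K G n x b) (k : K) : IsClosedSum K G n x (k • b) := by
  induction hb with
  | zero x => simpa using IsClosedSum.zero x
  | add k' l h hl hb ih => rw [smul_add, smul_smul]; exact .add _ l h hl ih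

variable {M : Set V} {P Q : TwoSidedIdeal (LeavittPathAlgebra K G)}

/-- Follow the first closed path of `b` up to an exit `f` and leave along it, giving a path `τ`.
Conjugation by `τ` kills that closed path, because `f* e = 0`, and turns `k x` into `k r(f)` with
`r(f) ∈ M`. The number of terms drops, until only a multiple of a vertex of `M` remains in `P`. -/
theorem coeff_eq_zero_of_add_closedSum_mem (hM : ∀ x y : V, y ∈ M → G.Reaches x y → x ∈ M)
    (hL : (G.restrict M).ConditionL) (hP : ∀ x ∈ M, vertex K G x ∉ P) {n : ℕ} {x : V} (hx : x ∈ M)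
    {b : LeavittPathAlgebra K G} (hb : IsClosedSum K G n x b) {k : K}
    (h : k • vertex K G x + b ∈ P) : k = 0 := by
  induction n using Nat.strong_induction_on generalizing x b with
  | _ n ih =>
    cases hb with
    | zero =>
      by_contra hk
      rw [add_zero, smul_mem_iff hk] at h
      exact hP x hx h
    | @add n _ b k' l hl hl0 hb =>
      obtain ⟨l₁, e, l₂, f, rfl, hne, hs, hr⟩ := hl.exists_exit hM hL hx hl0
      obtain ⟨z, h1, h2, -⟩ := DirGraph.isWalk_append.1 hl
      have h3 : G.IsWalk z [f] (G.r f) := ⟨by rw [hs, h2], rfl⟩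
      have hτ : G.IsWalk x (l₁ ++ [f]) (G.r f) := h1.append h3
      obtain ⟨m, hm, hm'⟩ := hb.compress hτ
      refine ih m (by omega) hr hm' ?_
      have h4 : ghostElem K G x (l₁ ++ [f]) * pathElem K G x (l₁ ++ e :: l₂) = 0 := by
        obtain ⟨z', h1', h2'⟩ := DirGraph.isWalk_append.1 hl
        obtain rfl := h1.end_unique h1'
        rw [ghostElem_append K h1 h3, pathElem_append K h1 h2', mul_assoc,
          ← mul_assoc (ghostElem K G x l₁), ghostElem_mul_pathElem K h1,
          vertex_mul_pathElem K h2', ghostElem_cons, pathElem_cons, mul_assoc,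
          ← mul_assoc (ghost K G f), ghost_mul_edge_of_ne K G hne]
        simp
      have h5 := P.mul_mem_left (ghostElem K G x (l₁ ++ [f])) _
        (P.mul_mem_right _ (pathElem K G x (l₁ ++ [f])) h)
      rw [add_mul, add_mul, mul_add, mul_add, smul_mul_assoc, mul_smul_comm,
        vertex_mul_pathElem K hτ, ghostElem_mul_pathElem K hτ, smul_mul_assoc, mul_smul_comm,
        ← mul_assoc, h4, zero_mul, smul_zero, zero_add, ← mul_assoc] at h5
      exact h5

variable (K G) in
/-- The linear combinations of paths of length less than `n`. -/
noncomputable def pathSpan (n : ℕ) : Submodule K (LeavittPathAlgebra K G) :=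
  Submodule.span K {a | ∃ x l y, G.IsWalk x l y ∧ l.length < n ∧ a = pathElem K G x l}

variable (K G) in
/-- The linear combinations of paths from `x` to `y` of positive length at most `n`. -/
noncomputable def posPathSpan (n : ℕ) (x y : V) : Submodule K (LeavittPathAlgebra K G) :=
  Submodule.span K {a | ∃ l, G.IsWalk x l y ∧ l ≠ [] ∧ l.length ≤ n ∧ a = pathElem K G x l}

theorem pathSpan_mono {n m : ℕ} (h : n ≤ m) : pathSpan K G n ≤ pathSpan K G m :=
  Submodule.span_mono fun _ ⟨x, l, y, h1, h2, h3⟩ => ⟨x, l, y, h1, by omega, h3⟩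

theorem exists_vertex_mul_mul_vertex {n : ℕ} {b : LeavittPathAlgebra K G}
    (hb : b ∈ pathSpan K G (n + 1)) (x y : V) : ∃ k : K, ∃ c ∈ posPathSpan K G n x y,
      vertex K G x * b * vertex K G y = k • (vertex K G x * vertex K G y) + c := by
  induction hb using Submodule.span_induction with
  | mem b hb =>
    obtain ⟨x', l, y', h, hl, rfl⟩ := hb
    by_cases hx : x = x'
    · subst hx
      rw [vertex_mul_pathElem K h]
      by_cases hy : y' = y
      · subst hy
        rw [pathElem_mul_vertex K h]
        by_cases h0 : l = []
        · subst h0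
          obtain rfl := h
          exact ⟨1, 0, zero_mem _, by simp [vertex_mul_self]⟩
        · exact ⟨0, _, Submodule.subset_span ⟨l, h, h0, by omega, rfl⟩, by simp⟩
      · exact ⟨0, 0, zero_mem _, by simp [pathElem_mul_vertex_of_ne K h hy]⟩
    · exact ⟨0, 0, zero_mem _, by simp [vertex_mul_pathElem_of_ne K h hx]⟩
  | zero => exact ⟨0, 0, zero_mem _, by simp⟩
  | add a b _ _ ha hb =>
    obtain ⟨k, c, hc, h⟩ := ha
    obtain ⟨k', c', hc', h'⟩ := hb
    exact ⟨k + k', c + c', add_mem hc hc', by rw [mul_add, add_mul, h, h', add_smul]; abel⟩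
  | smul t a _ ha =>
    obtain ⟨k, c, hc, h⟩ := ha
    exact ⟨t * k, t • c, Submodule.smul_mem _ _ hc, by
      rw [mul_smul_comm, smul_mul_assoc, h, smul_add, smul_smul]⟩

theorem exists_isClosedSum {n : ℕ} {x : V} {c : LeavittPathAlgebra K G}
    (hc : c ∈ posPathSpan K G n x x) : ∃ m, IsClosedSum K G m x c := by
  induction hc using Submodule.span_induction with
  | mem c hc =>
    obtain ⟨l, h, h0, -, rfl⟩ := hc
    exact ⟨1, by simpa using IsClosedSum.add (1 : K) l h h0 (.zero x)⟩
  | zero => exact ⟨0, .zero x⟩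
  | add a b _ _ ha hb =>
    obtain ⟨m, hm⟩ := ha
    obtain ⟨m', hm'⟩ := hb
    exact hm.add_add hm'
  | smul t a _ ha =>
    obtain ⟨m, hm⟩ := ha
    exact ⟨m, hm.smul t⟩

theorem ghost_mul_mem_pathSpan {n : ℕ} {x y : V} {c : LeavittPathAlgebra K G}
    (hc : c ∈ posPathSpan K G n x y) (f : E) : ghost K G f * c ∈ pathSpan K G n := by
  induction hc using Submodule.span_induction with
  | mem c hc =>
    obtain ⟨l, h, h0, hl, rfl⟩ := hc
    cases l with
    | nil => exact absurd rfl h0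
    | cons e l =>
      rw [pathElem_cons, ← mul_assoc]
      by_cases hfe : f = e
      · subst hfe
        rw [ghost_mul_edge_self, vertex_mul_pathElem K h.2]
        exact Submodule.subset_span ⟨_, l, y, h.2, by simpa using hl, rfl⟩
      · rw [ghost_mul_edge_of_ne K G hfe, zero_mul]; exact zero_mem _
  | zero => simp
  | add a b _ _ ha hb => rw [mul_add]; exact add_mem ha hb
  | smul t a _ ha => rw [mul_smul_comm]; exact Submodule.smul_mem _ _ ha

/-- No edge at `x` need be assumed: a path of positive length provides one, and at a sink the span
is zero. -/
theorem sum_edge_mul_ghost_mul_of_mem {n : ℕ} {x y : V} {c : LeavittPathAlgebra K G}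
    (hc : c ∈ posPathSpan K G n x y) (hfin : {e : E | G.s e = x}.Finite) :
    ∑ e ∈ hfin.toFinset, edge K G e * (ghost K G e * c) = c := by
  induction hc using Submodule.span_induction with
  | mem c hc =>
    obtain ⟨l, h, h0, hl, rfl⟩ := hc
    have hne : ∃ e, G.s e = x := ⟨l.head h0, h.source_head h0⟩
    simp only [← mul_assoc]
    rw [← Finset.sum_mul, sum_edge_mul_ghost K G hfin hne, vertex_mul_pathElem K h]
  | zero => simp
  | add a b _ _ ha hb => simp only [mul_add, Finset.sum_add_distrib, ha, hb]
  | smul t a _ ha => simp only [mul_smul_comm, ← Finset.smul_sum, ha]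

/-- Induction on path length. In `x b y` with `x ∈ M` the vertex term vanishes by
`coeff_eq_zero_of_add_closedSum_mem`. The rest is `c = ∑ e (e* c)`, where each `e* c` lies in `P`
and involves shorter paths. -/
theorem mem_of_mem_pathSpan (hG : G.RowFinite) (hM : ∀ x y : V, y ∈ M → G.Reaches x y → x ∈ M)
    (hL : (G.restrict M).ConditionL) (hP : ∀ x ∈ M, vertex K G x ∉ P)
    (hQ : ∀ x ∉ M, vertex K G x ∈ Q) {n : ℕ} {b : LeavittPathAlgebra K G}
    (hb : b ∈ pathSpan K G n) (hbP : b ∈ P) : b ∈ Q := by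
  induction n generalizing b with
  | zero =>
    have : pathSpan K G 0 = ⊥ := by
      rw [pathSpan, Submodule.span_eq_bot]
      rintro a ⟨x, l, y, -, h, -⟩
      omega
    rw [this, Submodule.mem_bot] at hb
    rw [hb]; exact Q.zero_mem
  | succ n ih =>
    refine mem_of_forall_mul_vertex fun y => mem_of_forall_vertex_mul fun x => ?_
    rw [← mul_assoc]
    obtain ⟨k, c, hc, h⟩ := exists_vertex_mul_mul_vertex hb x y
    have hPm : vertex K G x * b * vertex K G y ∈ P := P.mul_mem_right _ _ (P.mul_mem_left _ _ hbP)
    by_cases hxM : x ∈ M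
    swap
    · rw [mul_assoc]; exact Q.mul_mem_right _ _ (hQ x hxM)
    have hcQ : c ∈ P → c ∈ Q := fun hcP => by
      rw [← sum_edge_mul_ghost_mul_of_mem hc (hG x)]
      exact sum_mem fun e _ => Q.mul_mem_left _ _
        (ih (ghost_mul_mem_pathSpan hc e) (P.mul_mem_left _ _ hcP))
    rw [h] at hPm ⊢
    by_cases hxy : x = y
    · subst hxy
      obtain ⟨m, hm⟩ := exists_isClosedSum hc
      rw [vertex_mul_self] at hPm ⊢
      have hk := coeff_eq_zero_of_add_closedSum_mem hM hL hP hxM hm hPm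
      rw [hk, zero_smul, zero_add] at hPm ⊢
      exact hcQ hPm
    · rw [vertex_mul_of_ne K G hxy, smul_zero, zero_add] at hPm ⊢
      exact hcQ hPm

variable (K G) in
/-- The linear combinations of monomials `α β*` with `β` of length at most `n`. -/
noncomputable def monomialSpan (n : ℕ) : Submodule K (LeavittPathAlgebra K G) :=
  Submodule.span K {a | ∃ x l y l' z, G.IsWalk x l z ∧ G.IsWalk y l' z ∧ l'.length ≤ n ∧
    a = pathElem K G x l * ghostElem K G y l'}

theorem monomialSpan_mono {n m : ℕ} (h : n ≤ m) : monomialSpan K G n ≤ monomialSpan K G m :=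
  Submodule.span_mono fun _ ⟨x, l, y, l', z, h1, h2, h3, h4⟩ =>
    ⟨x, l, y, l', z, h1, h2, by omega, h4⟩

theorem exists_mem_pathSpan {a : LeavittPathAlgebra K G} (ha : a ∈ monomialSpan K G 0) :
    ∃ n, a ∈ pathSpan K G n := by
  induction ha using Submodule.span_induction with
  | mem a ha =>
    obtain ⟨x, l, y, l', z, h, h', h0, rfl⟩ := ha
    obtain rfl : l' = [] := by simpa using h0
    obtain rfl := h'
    exact ⟨l.length + 1, Submodule.subset_span
      ⟨x, l, y, h, Nat.lt_succ_self _, pathElem_mul_vertex K h⟩⟩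
  | zero => exact ⟨0, zero_mem _⟩
  | add a b _ _ ha hb =>
    obtain ⟨n, hn⟩ := ha
    obtain ⟨m, hm⟩ := hb
    exact ⟨max n m, add_mem (pathSpan_mono (le_max_left _ _) hn)
      (pathSpan_mono (le_max_right _ _) hm)⟩
  | smul t a _ ha =>
    obtain ⟨n, hn⟩ := ha
    exact ⟨n, Submodule.smul_mem _ _ hn⟩

theorem mul_edge_mem_monomialSpan {n : ℕ} {a : LeavittPathAlgebra K G}
    (ha : a ∈ monomialSpan K G (n + 1)) (e : E) : a * edge K G e ∈ monomialSpan K G n := by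
  induction ha using Submodule.span_induction with
  | mem a ha =>
    obtain ⟨x, l, y, l', z, h, h', hn, rfl⟩ := ha
    rw [mul_assoc]
    cases l' with
    | nil =>
      obtain rfl := h'
      by_cases hy : y = G.s e
      · subst hy
        have he : G.IsWalk (G.s e) [e] (G.r e) := ⟨rfl, rfl⟩
        refine Submodule.subset_span ⟨x, l ++ [e], G.r e, [], G.r e, h.append he, rfl,
          Nat.zero_le _, ?_⟩
        simp only [ghostElem_nil, pathElem_append K h he, pathElem_cons, pathElem_nil, mul_assoc,
          source_mul_edge, edge_mul_range]
      · rw [ghostElem_nil, vertex_mul_edge_of_ne K G hy, mul_zero]; exact zero_mem _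
    | cons f l' =>
      rw [ghostElem_cons, mul_assoc]
      by_cases hf : f = e
      · subst hf
        rw [ghost_mul_edge_self, ghostElem_mul_vertex K h'.2]
        exact Submodule.subset_span ⟨x, l, _, l', z, h, h'.2, by simpa using hn, rfl⟩
      · rw [ghost_mul_edge_of_ne K G hf, mul_zero, mul_zero]; exact zero_mem _
  | zero => simp
  | add a b _ _ ha hb => rw [add_mul]; exact add_mem ha hb
  | smul t a _ ha => rw [smul_mul_assoc]; exact Submodule.smul_mem _ _ ha

/-- If `α β* t ≠ 0`, then `β` starts at `t`; at a sink this makes `β` trivial. -/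
theorem mul_sink_mem_monomialSpan {n : ℕ} {a : LeavittPathAlgebra K G}
    (ha : a ∈ monomialSpan K G n) {t : V} (ht : ¬ ∃ e, G.s e = t) :
    a * vertex K G t ∈ monomialSpan K G 0 := by
  induction ha using Submodule.span_induction with
  | mem a ha =>
    obtain ⟨x, l, y, l', z, h, h', hn, rfl⟩ := ha
    rw [mul_assoc]
    by_cases hy : y = t
    · subst hy
      cases l' with
      | nil =>
        exact Submodule.subset_span ⟨x, l, y, [], z, h, h', Nat.zero_le _, by
          rw [ghostElem_mul_vertex K h']⟩
      | cons f l' => exact absurd ⟨f, h'.1⟩ ht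
    · rw [ghostElem_mul_vertex_of_ne K h' hy, mul_zero]; exact zero_mem _
  | zero => simp
  | add a b _ _ ha hb => rw [add_mul]; exact add_mem ha hb
  | smul t a _ ha => rw [smul_mul_assoc]; exact Submodule.smul_mem _ _ ha

theorem exists_mem_monomialSpan (a : LeavittPathAlgebra K G) : ∃ n, a ∈ monomialSpan K G n := by
  induction a using monomial_induction with
  | zero => exact ⟨0, zero_mem _⟩
  | add a b ha hb =>
    obtain ⟨n, hn⟩ := ha
    obtain ⟨m, hm⟩ := hb
    exact ⟨max n m, add_mem (monomialSpan_mono (le_max_left _ _) hn)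
      (monomialSpan_mono (le_max_right _ _) hm)⟩
  | smul t a ha =>
    obtain ⟨n, hn⟩ := ha
    exact ⟨n, Submodule.smul_mem _ _ hn⟩
  | monomial x l y l' z h h' =>
    exact ⟨l'.length, Submodule.subset_span ⟨x, l, y, l', z, h, h', le_rfl, rfl⟩⟩

/-- A form of the Cuntz-Krieger uniqueness theorem: if every cycle in `M` has an exit in `M`, then
an ideal without vertices of `M` is contained in every ideal that contains the other vertices. -/
theorem le_of_conditionL (hG : G.RowFinite) (hM : ∀ x y : V, y ∈ M → G.Reaches x y → x ∈ M)
    (hL : (G.restrict M).ConditionL) (hP : ∀ x ∈ M, vertex K G x ∉ P)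
    (hQ : ∀ x ∉ M, vertex K G x ∈ Q) : P ≤ Q := by
  intro a haP
  obtain ⟨n, hn⟩ := exists_mem_monomialSpan a
  have key : ∀ a ∈ monomialSpan K G 0, a ∈ P → a ∈ Q := fun a ha haP => by
    obtain ⟨m, hm⟩ := exists_mem_pathSpan ha
    exact mem_of_mem_pathSpan hG hM hL hP hQ hm haP
  induction n generalizing a with
  | zero => exact key a hn haP
  | succ n ih =>
    refine mem_of_forall_mul_vertex fun y => ?_
    -- If `y` emits edges, write `a y = ∑ (a e) e*`; right multiplication by `e` shortens the ghost
    -- parts. At a sink `a y` has no ghost part at all.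
    by_cases hy : ∃ e, G.s e = y
    · rw [← sum_edge_mul_ghost K G (hG y) hy, Finset.mul_sum]
      refine sum_mem fun e _ => ?_
      rw [← mul_assoc]
      exact Q.mul_mem_right _ _ (ih (P.mul_mem_right _ _ haP) (mul_edge_mem_monomialSpan hn e))
    · exact key _ (mul_sink_mem_monomialSpan hn hy) (P.mul_mem_right _ _ haP)

end LeavittPathAlgebra

/-! ### Branching systems and nonemptiness of the strata -/

namespace DirGraph

variable {V : Type u} {E : Type v} {G : DirGraph V E}

/-- A branching system on `M × ℕ`: injections `a e : ℕ → ℕ` such that the images of those with the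
same source form a partition of `ℕ`. -/
theorem exists_branching (hG : G.RowFinite) (M : Set V) : ∃ a : E → ℕ → ℕ,
    (∀ e f n m, G.r e ∈ M → G.r f ∈ M → G.s e = G.s f → a e n = a f m → e = f ∧ n = m) ∧
    ∀ x, (∃ e, G.s e = x ∧ G.r e ∈ M) → ∀ n, ∃ e m, G.s e = x ∧ G.r e ∈ M ∧ a e m = n := by
  classical
  let F : V → Type v := fun x => {e : E // G.s e = x ∧ G.r e ∈ M}
  have hψ : ∀ x, ∃ ψ : F x × ℕ → ℕ, Function.Injective ψ ∧ (Nonempty (F x) → ψ.Surjective) := by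
    intro x
    have hfin : Finite (F x) := ((hG x).subset (fun e he => he.1 : {e | G.s e = x ∧ G.r e ∈ M} ⊆ _))
    by_cases h : Nonempty (F x)
    · obtain ⟨ψ⟩ : Nonempty (F x × ℕ ≃ ℕ) := nonempty_equiv_of_countable
      exact ⟨ψ, ψ.injective, fun _ => ψ.surjective⟩
    · exact ⟨fun _ => 0, fun p => absurd ⟨p.1⟩ h, fun h' => absurd h' h⟩
  choose ψ hinj hsurj using hψ
  -- The value `0` is arbitrary: only edges with range in `M` occur in the conclusion.
  let a : E → ℕ → ℕ := fun e n =>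
    if h : G.r e ∈ M then ψ (G.s e) (⟨e, rfl, h⟩, n) else 0
  have ha : ∀ x e n (hs : G.s e = x) (hr : G.r e ∈ M), a e n = ψ x (⟨e, hs, hr⟩, n) := by
    rintro x e n rfl hr
    exact dif_pos hr
  refine ⟨a, fun e f n m he hf hs h => ?_, fun x ⟨e, hs, hr⟩ n => ?_⟩
  · rw [ha _ e n hs he, ha _ f m rfl hf] at h
    have := hinj _ h
    rw [Prod.mk.injEq, Subtype.mk.injEq] at this
    exact this
  · obtain ⟨⟨⟨f, hf⟩, m⟩, h⟩ := hsurj x ⟨⟨e, hs, hr⟩⟩ n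
    exact ⟨f, m, hf.1, hf.2, by rw [ha x f m hf.1 hf.2, h]⟩

end DirGraph

namespace LeavittPathAlgebra

open Leavitt

variable {K : Type w} [Field K] {V : Type u} {E : Type v} {G : DirGraph V E} {M : Set V}

variable (K) in
open Classical in
/-- The representation of the generators given by a branching system. -/
noncomputable def branchingAction (G : DirGraph V E) (M : Set V) (a : E → ℕ → ℕ) :
    Gen V E → Module.End K (V × ℕ →₀ K)
  | .vert x => Finsupp.linearCombination K fun p =>
      if p.1 = x ∧ x ∈ M then Finsupp.single p 1 else 0
  | .edge e => Finsupp.linearCombination K fun p =>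
      if p.1 = G.r e ∧ G.r e ∈ M then Finsupp.single (G.s e, a e p.2) 1 else 0
  | .ghost e => Finsupp.linearCombination K fun p =>
      if h : p.1 = G.s e ∧ G.r e ∈ M ∧ ∃ m, a e m = p.2 then
        Finsupp.single (G.r e, h.2.2.choose) 1 else 0

open Classical in
theorem branchingAction_vert (a : E → ℕ → ℕ) (x y : V) (n : ℕ) :
    branchingAction K G M a (.vert x) (Finsupp.single (y, n) 1) =
      if y = x ∧ x ∈ M then Finsupp.single (y, n) 1 else 0 := by
  simp [branchingAction]

open Classical in
theorem branchingAction_edge (a : E → ℕ → ℕ) (e : E) (y : V) (n : ℕ) :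
    branchingAction K G M a (.edge e) (Finsupp.single (y, n) 1) =
      if y = G.r e ∧ G.r e ∈ M then Finsupp.single (G.s e, a e n) 1 else 0 := by
  simp [branchingAction]

theorem branchingAction_ghost_of_eq {a : E → ℕ → ℕ}
    (ha : ∀ e f n m, G.r e ∈ M → G.r f ∈ M → G.s e = G.s f → a e n = a f m → e = f ∧ n = m)
    {e : E} (he : G.r e ∈ M) (m : ℕ) :
    branchingAction K G M a (.ghost e) (Finsupp.single (G.s e, a e m) 1) =
      Finsupp.single (G.r e, m) 1 := by
  have h : G.s e = G.s e ∧ G.r e ∈ M ∧ ∃ m', a e m' = a e m := ⟨rfl, he, m, rfl⟩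
  have h' := (ha e e _ _ he he rfl h.2.2.choose_spec).2
  simp only [branchingAction, Finsupp.linearCombination_single, one_smul]
  rw [dif_pos h, h']

theorem branchingAction_ghost_of_not (a : E → ℕ → ℕ) (e : E) (y : V) (n : ℕ)
    (h : ¬ (y = G.s e ∧ G.r e ∈ M ∧ ∃ m, a e m = n)) :
    branchingAction K G M a (.ghost e) (Finsupp.single (y, n) 1) = 0 := by
  simp only [branchingAction, Finsupp.linearCombination_single, one_smul]
  rw [dif_neg h]

theorem branching_ext {f g : Module.End K (V × ℕ →₀ K)}
    (h : ∀ y n, f (Finsupp.single (y, n) 1) = g (Finsupp.single (y, n) 1)) : f = g :=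
  Finsupp.lhom_ext' fun p => LinearMap.ext_ring (h p.1 p.2)

/-- Vertices of `M` act as projections onto their copies of `ℕ`, the other vertices as zero. Edges
into `M` act by the injections `a e`, ghosts by the partial inverses. The first Cuntz-Krieger
relation expresses injectivity and disjointness of images, the second that the images cover `ℕ`. -/
theorem branchingAction_rel (hM : G.IsMaximalTail M) {a : E → ℕ → ℕ}
    (ha : ∀ e f n m, G.r e ∈ M → G.r f ∈ M → G.s e = G.s f → a e n = a f m → e = f ∧ n = m)
    (ha' : ∀ x, (∃ e, G.s e = x ∧ G.r e ∈ M) → ∀ n, ∃ e m, G.s e = x ∧ G.r e ∈ M ∧ a e m = n)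
    (p q : FreeAlg K V E) (h : Rel K G p q) :
    liftFree K (branchingAction K G M a) p = liftFree K (branchingAction K G M a) q := by
  have hs : ∀ e, G.r e ∈ M → G.s e ∈ M := fun e he =>
    hM.mem_of_reaches _ _ he (.single ⟨e, rfl, rfl⟩)
  cases h with
  | vert_idem x =>
    rw [map_mul, liftFree_gen]
    refine branching_ext fun y n => ?_
    rw [Module.End.mul_apply, branchingAction_vert]
    split_ifs with h
    · rw [branchingAction_vert, if_pos h]
    · rw [map_zero]
  | vert_orth x y hxy =>
    rw [map_mul, liftFree_gen, liftFree_gen, map_zero]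
    refine branching_ext fun z n => ?_
    rw [Module.End.mul_apply, branchingAction_vert]
    split_ifs with h
    · rw [branchingAction_vert, if_neg (by rintro ⟨h1, -⟩; exact hxy (h1.symm.trans h.1))]
      rfl
    · rw [map_zero]; rfl
  | source_edge e =>
    rw [map_mul, liftFree_gen, liftFree_gen]
    refine branching_ext fun y n => ?_
    rw [Module.End.mul_apply, branchingAction_edge]
    split_ifs with h
    · rw [branchingAction_vert, if_pos ⟨rfl, hs e h.2⟩]
    · rw [map_zero]
  | edge_range e =>
    rw [map_mul, liftFree_gen, liftFree_gen]
    refine branching_ext fun y n => ?_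
    rw [Module.End.mul_apply, branchingAction_vert]
    split_ifs with h
    · rfl
    · rw [map_zero, branchingAction_edge, if_neg h]
  | range_ghost e =>
    rw [map_mul, liftFree_gen, liftFree_gen]
    refine branching_ext fun y n => ?_
    rw [Module.End.mul_apply]
    by_cases h : y = G.s e ∧ G.r e ∈ M ∧ ∃ m, a e m = n
    · obtain ⟨rfl, hr, m, rfl⟩ := h
      rw [branchingAction_ghost_of_eq ha hr, branchingAction_vert, if_pos ⟨rfl, hr⟩]
    · rw [branchingAction_ghost_of_not _ _ _ _ h, map_zero]
  | ghost_source e =>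
    rw [map_mul, liftFree_gen, liftFree_gen]
    refine branching_ext fun y n => ?_
    rw [Module.End.mul_apply, branchingAction_vert]
    split_ifs with h
    · rfl
    · rw [map_zero, branchingAction_ghost_of_not]
      rintro ⟨h1, h2, -⟩
      exact h ⟨h1, hs e h2⟩
  | ck1_same e =>
    rw [map_mul, liftFree_gen, liftFree_gen, liftFree_gen]
    refine branching_ext fun y n => ?_
    rw [Module.End.mul_apply, branchingAction_edge, branchingAction_vert]
    split_ifs with h
    · rw [branchingAction_ghost_of_eq ha h.2, h.1]
    · rw [map_zero]
  | ck1_ne e f hef =>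
    rw [map_mul, liftFree_gen, liftFree_gen, map_zero]
    refine branching_ext fun y n => ?_
    rw [Module.End.mul_apply, branchingAction_edge]
    split_ifs with h
    · rw [branchingAction_ghost_of_not]
      · rfl
      · rintro ⟨h1, h2, m, h3⟩
        exact hef (ha e f m n h2 h.2 h1.symm h3).1
    · rw [map_zero]; rfl
  | ck2 x hfin hne =>
    rw [map_sum, liftFree_gen]
    simp only [map_mul, liftFree_gen]
    refine branching_ext fun y n => ?_
    rw [branchingAction_vert, LinearMap.sum_apply]
    simp only [Module.End.mul_apply]
    split_ifs with h
    · obtain ⟨rfl, hy⟩ := h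
      -- A vertex of `M` that is not a sink emits an edge into `M`, so its copy of `ℕ` is
      -- partitioned; `n` lies in one block and only that summand survives.
      obtain ⟨e, m, rfl, hr, rfl⟩ := ha' _ (hM.exists_edge _ hy hne) n
      rw [Finset.sum_eq_single e]
      · rw [branchingAction_ghost_of_eq ha hr, branchingAction_edge, if_pos ⟨rfl, hr⟩]
      · intro f _ hfe
        rw [branchingAction_ghost_of_not, map_zero]
        rintro ⟨h1, h2, m', h3⟩
        exact hfe (ha f e m' m h2 hr h1.symm h3).1
      · intro he
        exact absurd (hfin.mem_toFinset.2 rfl) he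
    · refine Finset.sum_eq_zero fun e he => ?_
      rw [branchingAction_ghost_of_not, map_zero]
      rintro ⟨h1, h2, -⟩
      have h3 : G.s e = x := hfin.mem_toFinset.1 he
      exact h ⟨h1.trans h3, h3 ▸ hs e h2⟩

theorem exists_representation (hG : G.RowFinite) (hM : G.IsMaximalTail M) :
    ∃ (A : Type (max u w)) (_ : NonUnitalRing A) (_ : Module K A) (_ : IsScalarTower K A A)
      (_ : SMulCommClass K A A) (f : LeavittPathAlgebra K G →ₙₐ[K] A),
      ∀ x, f (vertex K G x) = 0 ↔ x ∉ M := by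
  obtain ⟨a, ha, ha'⟩ := G.exists_branching hG M
  refine ⟨Module.End K (V × ℕ →₀ K), inferInstance, inferInstance, inferInstance, inferInstance,
    lift K G (branchingAction K G M a) (branchingAction_rel hM ha ha'), fun x => ?_⟩
  rw [vertex, lift_ι]
  refine ⟨fun h hx => ?_, fun hx => branching_ext fun y n => ?_⟩
  · have := LinearMap.congr_fun h (Finsupp.single (x, 0) 1)
    rw [branchingAction_vert, if_pos ⟨rfl, hx⟩] at this
    simp at this
  · rw [branchingAction_vert, if_neg fun h => hx h.2]
    rfl

variable (K G) in
/-- The ideal generated by the vertices outside `M`. -/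
noncomputable def coIdeal (M : Set V) : TwoSidedIdeal (LeavittPathAlgebra K G) :=
  TwoSidedIdeal.span (vertex K G '' Mᶜ)

theorem coIdeal_le_iff {P : TwoSidedIdeal (LeavittPathAlgebra K G)} :
    coIdeal K G M ≤ P ↔ ∀ x ∉ M, vertex K G x ∈ P := by
  rw [coIdeal, TwoSidedIdeal.span_le, Set.image_subset_iff]
  rfl

theorem vertex_mem_coIdeal {x : V} (hx : x ∉ M) : vertex K G x ∈ coIdeal K G M :=
  coIdeal_le_iff.1 le_rfl x hx

/-- Take `P` maximal among the ideals whose vertices are exactly those outside `M`; the kernel of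
the representation is one. If `I, J ≰ P`, maximality puts vertices `x, y ∈ M` into `P ⊔ I` and `P ⊔
J`. A common successor `z ∈ M` lies in both, so `I J ⊆ P` would give `z = z z ∈ P`. -/
theorem stratum_nonempty (hG : G.RowFinite) (hM : G.IsMaximalTail M) :
    (stratum K G M).Nonempty := by
  obtain ⟨_, _, _, _, _, f, hf⟩ := exists_representation (K := K) hG hM
  let S : Set (TwoSidedIdeal (LeavittPathAlgebra K G)) := {P | ∀ x, vertex K G x ∈ P ↔ x ∉ M}
  have hker : TwoSidedIdeal.ker f ∈ S := fun x => by rw [TwoSidedIdeal.mem_ker]; exact hf x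
  obtain ⟨P, -, hP, hmax⟩ := zorn_le_nonempty₀ S (by
    intro c hc hch P₀ hP₀
    let U : TwoSidedIdeal (LeavittPathAlgebra K G) := .mk' {a | ∃ P ∈ c, a ∈ P}
      ⟨P₀, hP₀, P₀.zero_mem⟩
      (by
        rintro x y ⟨P, hP, hx⟩ ⟨Q, hQ, hy⟩
        rcases hch.total hP hQ with h | h
        exacts [⟨Q, hQ, Q.add_mem (h hx) hy⟩, ⟨P, hP, P.add_mem hx (h hy)⟩])
      (fun ⟨P, hP, hx⟩ => ⟨P, hP, P.neg_mem hx⟩)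
      (fun ⟨P, hP, hx⟩ => ⟨P, hP, P.mul_mem_left _ _ hx⟩)
      (fun ⟨P, hP, hx⟩ => ⟨P, hP, P.mul_mem_right _ _ hx⟩)
    have hU : ∀ a, a ∈ U ↔ ∃ P ∈ c, a ∈ P := fun a => TwoSidedIdeal.mem_mk' _ _ _ _ _ _ _
    refine ⟨U, fun x => ?_, fun P hP a ha => (hU a).2 ⟨P, hP, ha⟩⟩
    rw [hU]
    exact ⟨fun ⟨P, hP, h⟩ => (hc hP x).1 h, fun h => ⟨P₀, hP₀, (hc hP₀ x).2 h⟩⟩) _ hker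
  have hvert : ∀ I, ¬ I ≤ P → ∃ x ∈ M, vertex K G x ∈ P ⊔ I := by
    intro I hI
    by_contra! hc
    refine hI (le_sup_right.trans (hmax (fun x => ⟨fun h hx => hc x hx h, fun hx => ?_⟩)
      le_sup_left))
    exact TwoSidedIdeal.mem_sup_left ((hP x).2 hx)
  refine ⟨⟨P, ⟨?_, fun I J hIJ => ?_⟩⟩, Set.ext hP⟩
  · rintro rfl
    obtain ⟨x, hx⟩ := hM.nonempty
    exact (hP x).1 trivial hx
  · by_contra! hc
    obtain ⟨x, hx, hxI⟩ := hvert I hc.1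
    obtain ⟨y, hy, hyJ⟩ := hvert J hc.2
    obtain ⟨z, hz, hxz, hyz⟩ := hM.directed x hx y hy
    obtain ⟨p, hp, i, hi, h1⟩ := TwoSidedIdeal.mem_sup.1 (vertex_mem_of_reaches hxI hxz)
    obtain ⟨q, hq, j, hj, h2⟩ := TwoSidedIdeal.mem_sup.1 (vertex_mem_of_reaches hyJ hyz)
    refine (hP z).1 ?_ hz
    rw [← vertex_mul_self]
    nth_rewrite 1 [← h1]
    rw [← h2, add_mul, mul_add i]
    exact P.add_mem (P.mul_mem_right _ _ hp) (P.add_mem (P.mul_mem_left _ _ hq) (hIJ i hi j hj))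

/-- If every cycle in `M` has an exit in `M`, the stratum of `M` has at most one element. -/
theorem subsingleton_stratum (hG : G.RowFinite) (hM : M ∈ G.maximalTailsGamma) :
    (stratum K G M).Subsingleton := by
  intro P hP Q hQ
  rw [mem_stratum_iff] at hP hQ
  have key : ∀ P Q : TwoSidedIdeal (LeavittPathAlgebra K G),
      (∀ x, vertex K G x ∈ P ↔ x ∉ M) → (∀ x, vertex K G x ∈ Q ↔ x ∉ M) → P ≤ Q :=
    fun P Q hP hQ => le_of_conditionL hG hM.1.mem_of_reaches hM.2
      (fun x hx h => (hP x).1 h hx) (fun x hx => (hQ x).2 hx)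
  exact PrimeSpec.ext (le_antisymm (key _ _ hP hQ) (key _ _ hQ hP))

theorem nonempty_homeomorph_of_gamma (hG : G.RowFinite) (hM : M ∈ G.maximalTailsGamma) :
    Nonempty (stratum K G M ≃ₜ PrimeSpectrum K) := by
  obtain ⟨P, hP⟩ := stratum_nonempty (K := K) hG hM.1
  let _ : Unique (stratum K G M) :=
    { default := ⟨P, hP⟩
      uniq := fun Q => Subtype.ext (subsingleton_stratum hG hM Q.2 hP) }
  exact ⟨Homeomorph.homeomorphOfUnique _ _⟩

end LeavittPathAlgebra

/-! ### Cycles without exit in a maximal tail -/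

namespace DirGraph

variable {V : Type u} {E : Type v} {G : DirGraph V E} {M : Set V}

theorem isWalk_of_isChain {l : List E} (h : l.IsChain (fun e f => G.r e = G.s f)) (hl : l ≠ []) :
    G.IsWalk (G.s (l.head hl)) l (G.r (l.getLast hl)) := by
  induction l with
  | nil => exact absurd rfl hl
  | cons e l ih =>
    cases l with
    | nil => exact ⟨rfl, rfl⟩
    | cons f l =>
      rw [List.isChain_cons_cons] at h
      refine ⟨rfl, ?_⟩
      rw [h.1, List.getLast_cons (by simp)]
      exact ih h.2 (by simp)

/-- `c` is a cycle at `x ∈ M` without exits in `M`. -/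
structure IsCycleWithoutExit (G : DirGraph V E) (M : Set V) (x : V) (c : List E) : Prop where
  mem : x ∈ M
  isWalk : G.IsWalk x c x
  ne_nil : c ≠ []
  nodup : (c.map G.s).Nodup
  eq_of_mem : ∀ e ∈ c, ∀ f, G.s f = G.s e → G.r f ∈ M → f = e

theorem IsWalk.of_restrict {x y : M} {l : List {e : E // G.s e ∈ M ∧ G.r e ∈ M}}
    (h : (G.restrict M).IsWalk x l y) : G.IsWalk x (l.map Subtype.val) y := by
  induction l generalizing x with
  | nil => exact congrArg Subtype.val h
  | cons e l ih => exact ⟨congrArg Subtype.val h.1, ih h.2⟩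

theorem exists_isCycleWithoutExit (hM : M ∈ G.maximalTailsTau) :
    ∃ x c, G.IsCycleWithoutExit M x c := by
  have hreach := hM.1.mem_of_reaches
  have : ¬ (G.restrict M).ConditionL := fun h => hM.2 ⟨hM.1, h⟩
  simp only [ConditionL] at this
  push Not at this
  obtain ⟨c, ⟨hc1, ⟨hc2, hc3⟩, hc4⟩, hc⟩ := this
  have hw := isWalk_of_isChain hc1 hc2
  rw [hc3] at hw
  refine ⟨_, c.map Subtype.val, ((G.restrict M).s (c.head hc2)).2, hw.of_restrict,
    fun h => hc2 (List.map_eq_nil_iff.1 h),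
    ?_, ?_⟩
  · have : (c.map Subtype.val).map G.s = (c.map (G.restrict M).s).map Subtype.val := by
      rw [List.map_map, List.map_map]; rfl
    rw [this]
    exact hc4.map Subtype.val_injective
  · intro e he f hs hr
    obtain ⟨e, he', rfl⟩ := List.mem_map.1 he
    by_contra hne
    exact hc ⟨f, hs ▸ e.2.1, hr⟩ ⟨e, he', Subtype.ext hs, fun h => hne (congrArg Subtype.val h)⟩

namespace IsCycleWithoutExit

variable {x : V} {c : List E}

theorem source_mem (hc : G.IsCycleWithoutExit M x c) : x ∈ c.map G.s := by
  rw [← hc.isWalk.source_head hc.ne_nil]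
  exact List.mem_map_of_mem (List.head_mem hc.ne_nil)

theorem exists_split (hc : G.IsCycleWithoutExit M x c) {y : V} (hy : y ∈ c.map G.s) :
    ∃ l₁ l₂, c = l₁ ++ l₂ ∧ l₂ ≠ [] ∧ G.IsWalk x l₁ y ∧ G.IsWalk y l₂ x := by
  obtain ⟨e, he, rfl⟩ := List.mem_map.1 hy
  obtain ⟨l₁, l₂, h⟩ := List.append_of_mem he
  have hw := hc.isWalk
  nth_rewrite 1 [h] at hw
  obtain ⟨z, h1, h2, h3⟩ := isWalk_append.1 hw
  subst h2
  exact ⟨l₁, e :: l₂, h, by simp, h1, rfl, h3⟩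

theorem range_mem (hc : G.IsCycleWithoutExit M x c) {e : E} (he : e ∈ c) : G.r e ∈ c.map G.s := by
  obtain ⟨l₁, l₂, h⟩ := List.append_of_mem he
  have hw := hc.isWalk
  nth_rewrite 1 [h] at hw
  obtain ⟨z, h1, h2, h3⟩ := isWalk_append.1 hw
  cases l₂ with
  | nil => rw [h3]; exact hc.source_mem
  | cons f l₂ => rw [← h3.1, h]; simp

theorem edge_mem (hc : G.IsCycleWithoutExit M x c) {f : E} (hf : G.s f ∈ c.map G.s)
    (hr : G.r f ∈ M) : f ∈ c := by
  obtain ⟨e, he, h⟩ := List.mem_map.1 hf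
  rw [hc.eq_of_mem e he f h.symm hr]
  exact he

/-- Every vertex of a path that ends in `M` lies in `M`, and the cycle has no exit into `M`, so the
path cannot leave the cycle. -/
theorem end_mem (hc : G.IsCycleWithoutExit M x c)
    (hM : ∀ x y : V, y ∈ M → G.Reaches x y → x ∈ M) {y z : V} {l : List E}
    (h : G.IsWalk y l z) (hy : y ∈ c.map G.s) (hz : z ∈ M) : z ∈ c.map G.s := by
  induction l generalizing y with
  | nil => obtain rfl := h; exact hy
  | cons f l ih =>
    obtain ⟨rfl, h⟩ := h
    exact ih h (hc.range_mem (hc.edge_mem hy (hM _ _ hz h.reaches)))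

/-- A common successor of `y` and `x` in `M` lies on the cycle by `end_mem`, and from there the
cycle leads back to `x`. -/
theorem reaches_base (hc : G.IsCycleWithoutExit M x c) (hM : G.IsMaximalTail M) {y : V}
    (hy : y ∈ M) : G.Reaches y x := by
  obtain ⟨z, hz, h1, h2⟩ := hM.directed y hy x hc.mem
  obtain ⟨l, hl⟩ := reaches_iff_exists_isWalk.1 h2
  obtain ⟨l₁, l₂, -, -, -, h⟩ := hc.exists_split (hc.end_mem hM.mem_of_reaches hl hc.source_mem hz)
  exact h1.trans h.reaches

/-- At each vertex of the cycle only one edge stays in `M`, so two such paths agree for as long as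
both continue. -/
theorem isPrefix (hc : G.IsCycleWithoutExit M x c)
    (hM : ∀ x y : V, y ∈ M → G.Reaches x y → x ∈ M) {y z z' : V} {l l' : List E}
    (h : G.IsWalk y l z) (h' : G.IsWalk y l' z') (hy : y ∈ c.map G.s) (hz : z ∈ M) (hz' : z' ∈ M)
    (hle : l.length ≤ l'.length) : l <+: l' := by
  induction l generalizing y l' with
  | nil => exact List.nil_prefix
  | cons e l ih =>
    cases l' with
    | nil => simp at hle
    | cons f l' =>
      obtain ⟨rfl, h⟩ := h
      obtain ⟨hfe, h'⟩ := h'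
      have he := hc.edge_mem hy (hM _ _ hz h.reaches)
      obtain rfl := hc.eq_of_mem e he f hfe (hM _ _ hz' h'.reaches)
      rw [List.cons_prefix_cons]
      exact ⟨rfl, ih h h' (hc.range_mem he) (by simpa using hle)⟩

/-- A closed path in `M` that starts at the base point of a cycle without exits is a power of
that cycle. -/
theorem exists_eq_flatten (hc : G.IsCycleWithoutExit M x c)
    (hM : ∀ x y : V, y ∈ M → G.Reaches x y → x ∈ M) {l : List E} (h : G.IsWalk x l x) :
    ∃ n, l = (List.replicate n c).flatten := by
  induction hn : l.length using Nat.strong_induction_on generalizing l with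
  | _ n ih =>
    rcases lt_or_ge l.length c.length with hlt | hle
    · refine ⟨0, ?_⟩
      -- A nonempty proper initial segment of `c` that returns to `x` would make `x` the source of
      -- two edges of `c`.
      obtain ⟨t, ht⟩ := hc.isPrefix hM h hc.isWalk hc.source_mem hc.mem hc.mem hlt.le
      cases l with
      | nil => rfl
      | cons e l =>
        exfalso
        cases t with
        | nil => rw [List.append_nil] at ht; rw [ht] at hlt; exact lt_irrefl _ hlt
        | cons f t =>
          have hw := hc.isWalk
          nth_rewrite 1 [← ht] at hw
          obtain ⟨z, h1, h2, -⟩ := isWalk_append.1 hw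
          obtain rfl := h.end_unique h1
          have hd := hc.nodup
          rw [← ht, List.cons_append, List.map_cons, List.nodup_cons, h.1, ← h2] at hd
          exact hd.1 (List.mem_map_of_mem (by simp))
    · obtain ⟨t, rfl⟩ := hc.isPrefix hM hc.isWalk h hc.source_mem hc.mem hc.mem hle
      obtain ⟨z, h1, h2⟩ := isWalk_append.1 h
      obtain rfl := hc.isWalk.end_unique h1
      obtain ⟨m, rfl⟩ := ih t.length (by
        have := List.length_pos_iff.2 hc.ne_nil
        rw [← hn, List.length_append]; omega) h2 rfl
      exact ⟨m + 1, by rw [List.replicate_succ, List.flatten_cons]⟩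

theorem isWalk_pow (hc : G.IsCycleWithoutExit M x c) (n : ℕ) :
    G.IsWalk x (List.replicate n c).flatten x := by
  induction n with
  | zero => simp
  | succ n ih => rw [List.replicate_succ, List.flatten_cons]; exact hc.isWalk.append ih

end IsCycleWithoutExit

end DirGraph

/-! ### The corner at a cycle without exit is a Laurent polynomial ring -/

namespace LeavittPathAlgebra

open Leavitt

variable {K : Type w} [Field K] {V : Type u} {E : Type v} {G : DirGraph V E} {M : Set V}

section Twist

variable {A : Type*} [NonUnitalRing A] [Module K A] [IsScalarTower K A A] [SMulCommClass K A A]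

theorem twist_rel (f : LeavittPathAlgebra K G →ₙₐ[K] A) (p q : FreeAlg K V E) (hpq : Rel K G p q) :
    liftFree K (fun g : Gen V E => f (ι K G g) ⊗ₜ[K] (LaurentPolynomial.T (weight g) : K[T;T⁻¹])) p =
      liftFree K (fun g : Gen V E =>
        f (ι K G g) ⊗ₜ[K] (LaurentPolynomial.T (weight g) : K[T;T⁻¹])) q := by
  have key := congrArg f (mk_eq_of_rel K G hpq)
  cases hpq <;>
    simp only [map_mul, map_zero, map_sum, liftFree_gen, weight,
      Algebra.TensorProduct.tmul_mul_tmul, ← LaurentPolynomial.T_add, ι, mk_mul, mk_sum, mk_zero,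
      ← TensorProduct.sum_tmul, add_zero, zero_add, neg_add_cancel, add_neg_cancel] at key ⊢ <;>
    simp only [key, TensorProduct.zero_tmul]

/-- The homomorphism `L_K(G) → A ⊗ K[x,x⁻¹]` that maps `a` of degree `n` to `f a ⊗ xⁿ`. -/
noncomputable def twist (f : LeavittPathAlgebra K G →ₙₐ[K] A) :
    LeavittPathAlgebra K G →ₙₐ[K] A ⊗[K] K[T;T⁻¹] :=
  lift K G _ (twist_rel f)

theorem twist_ι (f : LeavittPathAlgebra K G →ₙₐ[K] A) (g : Gen V E) :
    twist f (ι K G g) = f (ι K G g) ⊗ₜ[K] (LaurentPolynomial.T (weight g) : K[T;T⁻¹]) :=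
  lift_ι K G _ _ g

theorem twist_vertex (f : LeavittPathAlgebra K G →ₙₐ[K] A) (x : V) :
    twist f (vertex K G x) = f (vertex K G x) ⊗ₜ[K] (LaurentPolynomial.T 0 : K[T;T⁻¹]) :=
  twist_ι f _

theorem twist_pathElem (f : LeavittPathAlgebra K G →ₙₐ[K] A) (x : V) (l : List E) :
    twist f (pathElem K G x l) =
      f (pathElem K G x l) ⊗ₜ[K] (LaurentPolynomial.T (l.length : ℤ) : K[T;T⁻¹]) := by
  induction l generalizing x with
  | nil => exact twist_ι f _
  | cons e l ih =>
    rw [pathElem_cons, map_mul, map_mul, ih, edge, twist_ι, Algebra.TensorProduct.tmul_mul_tmul,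
      ← LaurentPolynomial.T_add]
    simp [weight, add_comm]

theorem twist_ghostElem (f : LeavittPathAlgebra K G →ₙₐ[K] A) (x : V) (l : List E) :
    twist f (ghostElem K G x l) =
      f (ghostElem K G x l) ⊗ₜ[K] (LaurentPolynomial.T (-(l.length : ℤ)) : K[T;T⁻¹]) := by
  induction l generalizing x with
  | nil => exact twist_ι f _
  | cons e l ih =>
    rw [ghostElem_cons, map_mul, map_mul, ih, ghost, twist_ι, Algebra.TensorProduct.tmul_mul_tmul,
      ← LaurentPolynomial.T_add]
    simp [weight, add_comm]

end Twist

section TensorCoeff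

variable {A : Type*} [NonUnitalRing A] [Module K A]

variable (K A) in
/-- The coefficient of `xⁿ`. -/
noncomputable def tensorCoeff (n : ℤ) : A ⊗[K] K[T;T⁻¹] →ₗ[K] A :=
  (TensorProduct.rid K A).toLinearMap ∘ₗ
    LinearMap.lTensor A
      ({ toFun := fun p => p.coeff n
         map_add' := fun _ _ => rfl
         map_smul' := fun _ _ => rfl } : K[T;T⁻¹] →ₗ[K] K)

open Classical in
theorem tensorCoeff_tmul_T (n m : ℤ) (a : A) :
    tensorCoeff K A n (a ⊗ₜ LaurentPolynomial.T m) = if m = n then a else 0 := by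
  change TensorProduct.rid K A (a ⊗ₜ ((LaurentPolynomial.T m : K[T;T⁻¹]).coeff n)) = _
  rw [TensorProduct.rid_tmul, LaurentPolynomial.T, AddMonoidAlgebra.coeff_single,
    Finsupp.single_apply, ite_smul, one_smul, zero_smul]

end TensorCoeff

/-- In `∑ f f*` over the edges at `s(e)`, every `f ≠ e` has range outside `M` and hence lies in the
ideal. -/
theorem edge_mul_ghost_sub_vertex_mem (hG : G.RowFinite) {e : E}
    (he : ∀ f, G.s f = G.s e → G.r f ∈ M → f = e) :
    edge K G e * ghost K G e - vertex K G (G.s e) ∈ coIdeal K G M := by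
  classical
  have hmem : e ∈ (hG (G.s e)).toFinset := (hG _).mem_toFinset.2 rfl
  rw [← sum_edge_mul_ghost K G (hG (G.s e)) ⟨e, rfl⟩, ← Finset.add_sum_erase _ _ hmem,
    sub_add_cancel_left]
  refine TwoSidedIdeal.neg_mem _ (sum_mem fun f hf => ?_)
  rw [Finset.mem_erase] at hf
  refine TwoSidedIdeal.mul_mem_right _ _ _ (edge_mem_of_range_mem (vertex_mem_coIdeal fun h => ?_))
  exact hf.1 (he f ((hG _).mem_toFinset.1 hf.2) h)

section Cycle

variable {x : V} {c : List E}

theorem pathElem_mul_ghostElem_sub_vertex_mem (hG : G.RowFinite)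
    (hM : ∀ x y : V, y ∈ M → G.Reaches x y → x ∈ M) (hc : G.IsCycleWithoutExit M x c) {y z : V}
    {l : List E} (h : G.IsWalk y l z) (hy : y ∈ c.map G.s) (hz : z ∈ M) :
    pathElem K G y l * ghostElem K G y l - vertex K G y ∈ coIdeal K G M := by
  induction l generalizing y with
  | nil => simp [vertex_mul_self]
  | cons e l ih =>
    obtain ⟨rfl, h⟩ := h
    have he := hc.edge_mem hy (hM _ _ hz h.reaches)
    have h1 := edge_mul_ghost_sub_vertex_mem (K := K) hG (hc.eq_of_mem e he)
    have h2 := (coIdeal K G M).mul_mem_left (edge K G e) _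
      ((coIdeal K G M).mul_mem_right _ (ghost K G e) (ih h (hc.range_mem he)))
    have h3 := (coIdeal K G M).add_mem h2 h1
    rw [sub_mul, mul_sub, range_mul_ghost, sub_add_sub_cancel] at h3
    simpa [mul_assoc] using h3

/-- The element `cⁱ (c*)ʲ`. -/
noncomputable def cycleElem (K : Type w) [Field K] (G : DirGraph V E) (x : V) (c : List E)
    (i j : ℕ) : LeavittPathAlgebra K G :=
  pathElem K G x (List.replicate i c).flatten * ghostElem K G x (List.replicate j c).flatten

theorem ghostElem_mul_cycleElem_mul_pathElem (hc : G.IsCycleWithoutExit M x c) (i j : ℕ) :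
    ghostElem K G x (List.replicate i c).flatten * cycleElem K G x c i j *
      pathElem K G x (List.replicate j c).flatten = vertex K G x := by
  rw [cycleElem, ← mul_assoc, ghostElem_mul_pathElem K (hc.isWalk_pow i),
    vertex_mul_ghostElem K (hc.isWalk_pow j), ghostElem_mul_pathElem K (hc.isWalk_pow j)]

theorem pathElem_pow_add (hc : G.IsCycleWithoutExit M x c) (i j : ℕ) :
    pathElem K G x (List.replicate (i + j) c).flatten =
      pathElem K G x (List.replicate i c).flatten * pathElem K G x (List.replicate j c).flatten := by
  rw [List.replicate_add, List.flatten_append,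
    pathElem_append K (hc.isWalk_pow i) (hc.isWalk_pow j)]

theorem ghostElem_pow_add (hc : G.IsCycleWithoutExit M x c) (i j : ℕ) :
    ghostElem K G x (List.replicate (i + j) c).flatten =
      ghostElem K G x (List.replicate j c).flatten *
        ghostElem K G x (List.replicate i c).flatten := by
  rw [List.replicate_add, List.flatten_append,
    ghostElem_append K (hc.isWalk_pow i) (hc.isWalk_pow j)]

theorem cycleElem_zero_zero : cycleElem K G x c 0 0 = vertex K G x := vertex_mul_self K G x

theorem cycleElem_add_add_sub_mem (hG : G.RowFinite)
    (hM : ∀ x y : V, y ∈ M → G.Reaches x y → x ∈ M) (hc : G.IsCycleWithoutExit M x c)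
    (i j k : ℕ) :
    cycleElem K G x c (i + k) (j + k) - cycleElem K G x c i j ∈ coIdeal K G M := by
  have h := pathElem_mul_ghostElem_sub_vertex_mem (K := K) hG hM hc (hc.isWalk_pow k) hc.source_mem
    hc.mem
  have h1 := (coIdeal K G M).mul_mem_left (pathElem K G x (List.replicate i c).flatten) _
    ((coIdeal K G M).mul_mem_right _ (ghostElem K G x (List.replicate j c).flatten) h)
  rw [sub_mul, mul_sub, vertex_mul_ghostElem K (hc.isWalk_pow j)] at h1
  rw [cycleElem, cycleElem, pathElem_pow_add hc, ghostElem_pow_add hc]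
  simpa [mul_assoc] using h1

theorem cycleElem_mul_cycleElem (hc : G.IsCycleWithoutExit M x c) (i j i' j' : ℕ) :
    cycleElem K G x c i j * cycleElem K G x c i' j' =
      cycleElem K G x c (i + (i' - j)) (j' + (j - i')) := by
  -- Natural subtraction truncates: at most one of `i' - j` and `j - i'` is nonzero, according to
  -- which power survives the cancellation.
  have key : ghostElem K G x (List.replicate j c).flatten *
      pathElem K G x (List.replicate i' c).flatten = cycleElem K G x c (i' - j) (j - i') := by
    rcases le_total j i' with h | h
    · obtain ⟨k, rfl⟩ := Nat.exists_eq_add_of_le h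
      rw [pathElem_pow_add hc, ← mul_assoc, ghostElem_mul_pathElem K (hc.isWalk_pow j),
        vertex_mul_pathElem K (hc.isWalk_pow k), Nat.add_sub_cancel_left,
        Nat.sub_eq_zero_of_le h, cycleElem]
      exact (pathElem_mul_vertex K (hc.isWalk_pow k)).symm
    · obtain ⟨k, rfl⟩ := Nat.exists_eq_add_of_le h
      rw [ghostElem_pow_add hc, mul_assoc, ghostElem_mul_pathElem K (hc.isWalk_pow i'),
        ghostElem_mul_vertex K (hc.isWalk_pow k), Nat.add_sub_cancel_left,
        Nat.sub_eq_zero_of_le h, cycleElem]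
      exact (vertex_mul_ghostElem K (hc.isWalk_pow k)).symm
  rw [cycleElem, cycleElem, mul_assoc, ← mul_assoc (ghostElem K G x _), key, cycleElem, cycleElem,
    pathElem_pow_add hc, ghostElem_pow_add hc]
  simp only [mul_assoc]

/-- The Laurent monomial `cⁿ`. -/
noncomputable def cyclePow (K : Type w) [Field K] (G : DirGraph V E) (x : V) (c : List E) (n : ℤ) :
    LeavittPathAlgebra K G :=
  cycleElem K G x c n.toNat (-n).toNat

theorem cycleElem_sub_cyclePow_mem (hG : G.RowFinite)
    (hM : ∀ x y : V, y ∈ M → G.Reaches x y → x ∈ M) (hc : G.IsCycleWithoutExit M x c) (i j : ℕ) :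
    cycleElem K G x c i j - cyclePow K G x c (i - j) ∈ coIdeal K G M := by
  -- Cancelling `min i j` from both exponents leaves the positive and negative parts of `i - j`.
  have := cycleElem_add_add_sub_mem (K := K) hG hM hc ((i : ℤ) - j).toNat (-((i : ℤ) - j)).toNat
    (min i j)
  rwa [show ((i : ℤ) - j).toNat + min i j = i by omega,
    show (-((i : ℤ) - j)).toNat + min i j = j by omega] at this

theorem cyclePow_add_sub_mem (hG : G.RowFinite)
    (hM : ∀ x y : V, y ∈ M → G.Reaches x y → x ∈ M) (hc : G.IsCycleWithoutExit M x c) (n m : ℤ) :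
    cyclePow K G x c (n + m) - cyclePow K G x c n * cyclePow K G x c m ∈ coIdeal K G M := by
  rw [cyclePow.eq_def K G x c n, cyclePow.eq_def K G x c m, cycleElem_mul_cycleElem hc]
  have := (coIdeal K G M).neg_mem (cycleElem_sub_cyclePow_mem (K := K) hG hM hc
    (n.toNat + (m.toNat - (-n).toNat)) ((-m).toNat + ((-n).toNat - m.toNat)))
  rwa [neg_sub, show ((n.toNat + (m.toNat - (-n).toNat) : ℕ) : ℤ) -
    ((-m).toNat + ((-n).toNat - m.toNat) : ℕ) = n + m by omega] at this

/-- The map from `K[x,x⁻¹]` that substitutes `c` for `x`. -/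
noncomputable def cycleMap (K : Type w) [Field K] (G : DirGraph V E) (x : V) (c : List E) :
    K[T;T⁻¹] →+ LeavittPathAlgebra K G where
  toFun p := Finsupp.linearCombination K (cyclePow K G x c) p.coeff
  map_zero' := map_zero (Finsupp.linearCombination K (cyclePow K G x c))
  map_add' p q := map_add (Finsupp.linearCombination K (cyclePow K G x c)) p.coeff q.coeff

theorem cycleMap_apply (p : K[T;T⁻¹]) :
    cycleMap K G x c p = ∑ n ∈ p.coeff.support, p.coeff n • cyclePow K G x c n := rfl

theorem cycleMap_single (n : ℤ) (k : K) :
    cycleMap K G x c (.single n k) = k • cyclePow K G x c n :=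
  Finsupp.linearCombination_single K k n

theorem cycleMap_one : cycleMap K G x c 1 = vertex K G x := by
  rw [AddMonoidAlgebra.one_def, cycleMap_single, one_smul]
  exact cycleElem_zero_zero

theorem cyclePow_notMem (hc : G.IsCycleWithoutExit M x c)
    {P : TwoSidedIdeal (LeavittPathAlgebra K G)} (hP : vertex K G x ∉ P) (n : ℤ) :
    cyclePow K G x c n ∉ P := fun h => hP (by
  rw [← ghostElem_mul_cycleElem_mul_pathElem hc n.toNat (-n).toNat]
  exact P.mul_mem_right _ _ (P.mul_mem_left _ _ h))

theorem cycleMap_mul_sub_mem (hG : G.RowFinite) (hM : G.IsMaximalTail M)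
    (hc : G.IsCycleWithoutExit M x c) (p q : K[T;T⁻¹]) :
    cycleMap K G x c (p * q) - cycleMap K G x c p * cycleMap K G x c q ∈ coIdeal K G M := by
  induction p using AddMonoidAlgebra.induction_linear with
  | zero => simp
  | add f g hf hg =>
    have := (coIdeal K G M).add_mem hf hg
    rwa [show ∀ a b c d : LeavittPathAlgebra K G, a - b + (c - d) = a + c - (b + d) by
      intros; abel, ← map_add, ← add_mul, ← add_mul, ← map_add] at this
  | single n k =>
    induction q using AddMonoidAlgebra.induction_linear with
    | zero => simp
    | add f g hf hg =>
      have := (coIdeal K G M).add_mem hf hg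
      rwa [show ∀ a b c d : LeavittPathAlgebra K G, a - b + (c - d) = a + c - (b + d) by
        intros; abel, ← map_add, ← mul_add, ← mul_add, ← map_add] at this
    | single m l =>
      rw [AddMonoidAlgebra.single_mul_single, cycleMap_single, cycleMap_single, cycleMap_single,
        smul_mul_assoc, mul_smul_comm, smul_smul, ← smul_sub]
      exact smul_mem _ (cyclePow_add_sub_mem hG hM.mem_of_reaches hc n m)

theorem exists_cycleMap_sub_mem (hG : G.RowFinite) (hM : G.IsMaximalTail M)
    (hc : G.IsCycleWithoutExit M x c) (a : LeavittPathAlgebra K G) :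
    ∃ p, cycleMap K G x c p - cycleMap K G x c 1 * a * cycleMap K G x c 1 ∈ coIdeal K G M := by
  rw [cycleMap_one]
  induction a using monomial_induction with
  | zero => exact ⟨0, by simp⟩
  | add a b ha hb =>
    obtain ⟨p, hp⟩ := ha
    obtain ⟨q, hq⟩ := hb
    refine ⟨p + q, ?_⟩
    have := (coIdeal K G M).add_mem hp hq
    rwa [show ∀ a b c d : LeavittPathAlgebra K G, a - b + (c - d) = a + c - (b + d) by
      intros; abel, ← map_add, ← add_mul, ← mul_add] at this
  | smul k a ha =>
    obtain ⟨p, hp⟩ := ha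
    refine ⟨k • p, ?_⟩
    have h1 : cycleMap K G x c (k • p) = k • cycleMap K G x c p :=
      map_smul (Finsupp.linearCombination K (cyclePow K G x c)) k p.coeff
    rw [h1, mul_smul_comm, smul_mul_assoc, ← smul_sub]
    exact smul_mem k hp
  | monomial y l y' l' z h h' =>
    by_cases hy : x = y
    swap
    · exact ⟨0, by rw [← mul_assoc, vertex_mul_pathElem_of_ne K h hy]; simp⟩
    by_cases hy' : y' = x
    swap
    · exact ⟨0, by rw [mul_assoc, mul_assoc, ghostElem_mul_vertex_of_ne K h' hy']; simp⟩
    subst hy hy'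
    rw [← mul_assoc, vertex_mul_pathElem K h, mul_assoc, ghostElem_mul_vertex K h']
    by_cases hz : z ∈ M
    swap
    · refine ⟨0, ?_⟩
      rw [map_zero, zero_sub]
      exact (coIdeal K G M).neg_mem ((coIdeal K G M).mul_mem_right _ _
        (pathElem_mem_of_end_mem h (vertex_mem_coIdeal hz)))
    have hzc := hc.end_mem hM.mem_of_reaches h hc.source_mem hz
    -- Close up both paths by the segment `γ` of the cycle from `z` to `x`. Then `α γ = cⁱ` and `β γ
    -- = cʲ`, and `γ γ* ≡ z` gives `α β* ≡ α γ γ* β* = cⁱ (c*)ʲ ≡ cⁱ⁻ʲ`.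
    obtain ⟨l₁, l₂, -, -, -, h₂⟩ := hc.exists_split hzc
    obtain ⟨i, hi⟩ := hc.exists_eq_flatten hM.mem_of_reaches (h.append h₂)
    obtain ⟨j, hj⟩ := hc.exists_eq_flatten hM.mem_of_reaches (h'.append h₂)
    refine ⟨.single (i - j) 1, ?_⟩
    have h3 := cycleElem_sub_cyclePow_mem (K := K) hG hM.mem_of_reaches hc i j
    have h4 := pathElem_mul_ghostElem_sub_vertex_mem (K := K) hG hM.mem_of_reaches hc h₂ hzc hc.mem
    have h5 := (coIdeal K G M).mul_mem_left (pathElem K G y' l) _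
      ((coIdeal K G M).mul_mem_right _ (ghostElem K G y' l') h4)
    rw [cycleElem, ← hi, ← hj, pathElem_append K h h₂, ghostElem_append K h' h₂] at h3
    have h6 := (coIdeal K G M).neg_mem ((coIdeal K G M).sub_mem h3 h5)
    rw [sub_mul, mul_sub, vertex_mul_ghostElem K h'] at h6
    rw [cycleMap_single, one_smul]
    convert h6 using 1
    noncomm_ring

/-- Twisting the representation `f` by the degree separates the powers of `c`: `cⁿ` goes to `f (cⁿ)
⊗ T^(n |c|)`, with distinct exponents as `|c| > 0`. The twisted map kills the ideal, and `f (cⁿ) ≠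
0` because `cⁿ` can be cancelled to `x` and `f x ≠ 0`. So every coefficient vanishes. -/
theorem eq_zero_of_cycleMap_mem (hG : G.RowFinite) (hM : G.IsMaximalTail M)
    (hc : G.IsCycleWithoutExit M x c) {p : K[T;T⁻¹]}
    (hp : cycleMap K G x c p ∈ coIdeal K G M) : p = 0 := by
  classical
  obtain ⟨A, _, _, _, _, f, hf⟩ := exists_representation (K := K) hG hM
  have hker : coIdeal K G M ≤ TwoSidedIdeal.ker (twist f) := coIdeal_le_iff.2 fun y hy => by
    rw [TwoSidedIdeal.mem_ker, twist_vertex, (hf y).2 hy, TensorProduct.zero_tmul]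
  have h0 : twist f (cycleMap K G x c p) = 0 := (TwoSidedIdeal.mem_ker _).1 (hker hp)
  have hcl : 0 < c.length := List.length_pos_iff.2 hc.ne_nil
  have htw : ∀ n, twist f (cyclePow K G x c n) = f (cyclePow K G x c n) ⊗ₜ[K]
      (LaurentPolynomial.T (n * c.length) : K[T;T⁻¹]) := fun n => by
    rw [cyclePow, cycleElem, map_mul, map_mul, twist_pathElem, twist_ghostElem,
      Algebra.TensorProduct.tmul_mul_tmul, ← LaurentPolynomial.T_add]
    congr 2
    simp only [List.length_flatten, List.map_replicate, List.sum_replicate, smul_eq_mul]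
    push_cast
    rw [← neg_mul, ← add_mul]
    congr 1
    omega
  refine LaurentPolynomial.ext fun n => ?_
  by_contra hn
  have h1 := congrArg (tensorCoeff K A (n * c.length)) h0
  rw [cycleMap_apply, map_sum, map_sum, Finset.sum_eq_single n] at h1
  · rw [map_smul, map_smul, htw, tensorCoeff_tmul_T, if_pos rfl, map_zero, smul_eq_zero] at h1
    refine cyclePow_notMem hc (P := TwoSidedIdeal.ker f) (fun h => ?_) n
      ((TwoSidedIdeal.mem_ker _).2 (h1.resolve_left hn))
    exact (hf x).1 ((TwoSidedIdeal.mem_ker _).1 h) hc.mem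
  · intro m _ hm
    rw [map_smul, map_smul, htw, tensorCoeff_tmul_T, if_neg, smul_zero]
    intro h
    exact hm (mul_right_cancel₀ (by exact_mod_cast hcl.ne') h)
  · intro h
    exact absurd (Finsupp.notMem_support_iff.1 h) hn

theorem isCornerMap_cycleMap (hG : G.RowFinite) (hM : G.IsMaximalTail M)
    (hc : G.IsCycleWithoutExit M x c) :
    IsCornerMap (coIdeal K G M) (cycleMap K G x c) where
  mul := cycleMap_mul_sub_mem hG hM hc
  surj := exists_cycleMap_sub_mem hG hM hc
  inj _ := eq_zero_of_cycleMap_mem hG hM hc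

/-- All vertices of `M` reach `x`, so a single vertex of `M` in `P` would force `x ∈ P`. -/
theorem mem_stratum_iff_of_cycle (hM : G.IsMaximalTail M) (hc : G.IsCycleWithoutExit M x c)
    (P : PrimeSpec (LeavittPathAlgebra K G)) :
    P ∈ stratum K G M ↔ coIdeal K G M ≤ P.asIdeal ∧ cycleMap K G x c 1 ∉ P.asIdeal := by
  rw [mem_stratum_iff, cycleMap_one, coIdeal_le_iff]
  refine ⟨fun h => ⟨fun y hy => (h y).2 hy, fun hx => (h x).1 hx hc.mem⟩, fun h y => ⟨?_, h.1 y⟩⟩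
  exact fun hy hyM => h.2 (vertex_mem_of_reaches hy (hc.reaches_base hM hyM))

theorem nonempty_homeomorph_of_tau (hG : G.RowFinite) (hM : M ∈ G.maximalTailsTau) :
    Nonempty (stratum K G M ≃ₜ PrimeSpectrum K[T;T⁻¹]) := by
  obtain ⟨x, c, hc⟩ := DirGraph.exists_isCycleWithoutExit hM
  exact (isCornerMap_cycleMap hG hM.1 hc).nonempty_homeomorph _ (mem_stratum_iff_of_cycle hM.1 hc)

end Cycle

end LeavittPathAlgebra

/-! ### Countable cofinality and left primitive ideals -/

namespace DirGraph

variable {V : Type u} {E : Type v} {G : DirGraph V E}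

theorem countable_setOf_reaches (hG : G.RowFinite) (x : V) : {y | G.Reaches x y}.Countable := by
  -- `R n` is the set of vertices reached in exactly `n` steps.
  let R : ℕ → Set V := fun n => n.rec {x} fun _ S => ⋃ y ∈ S, G.r '' {e | G.s e = y}
  have hR : ∀ n, (R n).Countable := fun n => by
    induction n with
    | zero => exact Set.countable_singleton x
    | succ n ih => exact ih.biUnion fun y _ => ((hG y).image _).countable
  refine (Set.countable_iUnion hR).mono fun y hy => ?_
  induction hy with
  | refl => exact Set.mem_iUnion.2 ⟨0, rfl⟩
  | tail _ h ih =>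
    obtain ⟨n, hn⟩ := Set.mem_iUnion.1 ih
    obtain ⟨e, he, rfl⟩ := h
    exact Set.mem_iUnion.2 ⟨n + 1, Set.mem_biUnion hn ⟨e, he, rfl⟩⟩

end DirGraph

namespace LeavittPathAlgebra

open Leavitt

variable {K : Type w} [Field K] {V : Type u} {E : Type v} {G : DirGraph V E} {M : Set V}

section Primitive

/-- A decreasing sequence of idempotents that is cofinal for the vertices in `M`. -/
theorem exists_idempotent_sequence (hG : G.RowFinite) (hM : G.IsMaximalTail M) :
    ∃ e : ℕ → LeavittPathAlgebra K G, (∀ i j, i ≤ j → e i * e j = e j) ∧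
      (∀ n, ∃ w ∈ M, ∀ P : TwoSidedIdeal (LeavittPathAlgebra K G),
        e n ∈ P ↔ vertex K G w ∈ P) ∧
      ∀ x ∈ M, ∃ n, ∀ P : TwoSidedIdeal (LeavittPathAlgebra K G), vertex K G x ∈ P → e n ∈ P := by
  obtain ⟨v, hv⟩ := hM.nonempty
  obtain ⟨y, hy⟩ := ((DirGraph.countable_setOf_reaches hG v).mono
    (fun z hz => hz.2 : {z | z ∈ M ∧ G.Reaches v z} ⊆ _)).exists_eq_range ⟨v, hv, .refl⟩
  have hyM : ∀ n, y n ∈ M := fun n => (hy.symm ▸ Set.mem_range_self n : y n ∈ {z | _ ∧ _}).1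
  -- Vertices are mutually orthogonal, so they do not form a decreasing sequence. They are replaced
  -- by the idempotents `p q` with `q p = w`, which generate the same ideals as the vertices `w`.
  let S := {s : V × LeavittPathAlgebra K G × LeavittPathAlgebra K G //
    s.1 ∈ M ∧ s.2.2 * s.2.1 = vertex K G s.1 ∧ s.2.1 * vertex K G s.1 = s.2.1 ∧
      vertex K G s.1 * s.2.2 = s.2.2}
  let e : S → LeavittPathAlgebra K G := fun s => s.1.2.1 * s.1.2.2
  have hstep : ∀ (n : ℕ) (s : S), ∃ s' : S, e s * e s' = e s' ∧ G.Reaches (y n) s'.1.1 := by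
    rintro n ⟨⟨w, p, q⟩, hw, h1, h2, h3⟩
    -- The new vertex `z` lies below both the current one and the next vertex `y n` of the
    -- enumeration. Extending `p` and `q` along a path from `w` to `z` makes the idempotent smaller.
    obtain ⟨z, hz, hwz, hyz⟩ := hM.directed w hw (y n) (hyM n)
    obtain ⟨p', q', h1', h2', h3', h4', h5'⟩ := exists_of_reaches (K := K) hwz
    simp only at h1 h2 h3
    refine ⟨⟨⟨z, p * p', q' * q⟩, hz, ?_, ?_, ?_⟩, ?_, hyz⟩
    · calc q' * q * (p * p') = q' * (q * p * p') := by noncomm_ring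
        _ = vertex K G z := by rw [h1, h2', h1']
    · rw [mul_assoc, h3']
    · rw [← mul_assoc, h4']
    · calc p * q * (p * p' * (q' * q)) = p * (q * p * p') * (q' * q) := by noncomm_ring
        _ = p * p' * (q' * q) := by rw [h1, h2']
  choose next hnext using hstep
  let s : ℕ → S := fun n => n.rec ⟨⟨v, vertex K G v, vertex K G v⟩, hv, vertex_mul_self K G v,
    vertex_mul_self K G v, vertex_mul_self K G v⟩ next
  have hs : ∀ n, s (n + 1) = next n (s n) := fun n => rfl
  have hidem : ∀ s, e s * e s = e s := by
    rintro ⟨⟨w, p, q⟩, hw, h1, h2, h3⟩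
    simp only at h1 h2 h3
    calc p * q * (p * q) = p * (q * p) * q := by noncomm_ring
      _ = p * q := by rw [h1, h2]
  have hmem : ∀ (s : S) (P : TwoSidedIdeal (LeavittPathAlgebra K G)),
      e s ∈ P ↔ vertex K G s.1.1 ∈ P := by
    rintro ⟨⟨w, p, q⟩, hw, h1, h2, h3⟩ P
    simp only at h1 h2 h3
    constructor
    · intro h
      have h4 : q * (p * q) * p = vertex K G w := by
        calc q * (p * q) * p = q * p * (q * p) := by noncomm_ring
          _ = vertex K G w := by rw [h1, vertex_mul_self]
      rw [← h4]
      exact P.mul_mem_right _ _ (P.mul_mem_left _ _ h)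
    · intro h
      change p * q ∈ P
      rw [← h2]
      exact P.mul_mem_right _ _ (P.mul_mem_left _ _ h)
  refine ⟨fun n => e (s n), fun i j hij => ?_, fun n => ⟨_, (s n).2.1, hmem _⟩, fun x hx => ?_⟩
  · induction j, hij using Nat.le_induction with
    | base => exact hidem _
    | succ j _ ih =>
      change e (s i) * e (s (j + 1)) = e (s (j + 1))
      rw [hs, ← (hnext j (s j)).1, ← mul_assoc, ih]
  · obtain ⟨z, hz, hxz, hvz⟩ := hM.directed x hx v hv
    obtain ⟨n, rfl⟩ : z ∈ Set.range y := hy ▸ ⟨hz, hvz⟩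
    exact ⟨n + 1, fun P hP =>
      (hmem _ P).2 (vertex_mem_of_reaches (vertex_mem_of_reaches hP hxz) (hnext n (s n)).2)⟩

/-- A primitive ideal is maximal in its stratum either because the stratum is a point or by
`le_of_isLeftPrimitive`. Conversely, for `P` maximal in the stratum of `M`, the primitive ideal
above `P` that avoids all the idempotents contains no vertex of `M`, so it lies in the same stratum
and equals `P`. -/
theorem isLeftPrimitive_iff (hG : G.RowFinite) (P : TwoSidedIdeal (LeavittPathAlgebra K G)) :
    P.IsLeftPrimitive ↔
      ∃ M ∈ G.maximalTails, Maximal (· ∈ PrimeSpec.asIdeal '' stratum K G M) P := by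
  constructor
  · intro hP
    let P' : PrimeSpec (LeavittPathAlgebra K G) := ⟨P, hP.isPrimeIdeal⟩
    have hM := isMaximalTail_tail hG P'
    have hP' := mem_stratum_tail P'
    refine ⟨tail K G P', hM, ⟨P', hP', rfl⟩, ?_⟩
    rintro _ ⟨Q, hQ, rfl⟩ hPQ
    by_cases hL : tail K G P' ∈ G.maximalTailsGamma
    · rw [subsingleton_stratum hG hL hQ hP']
    · obtain ⟨x, c, hc⟩ := DirGraph.exists_isCycleWithoutExit ⟨hM, hL⟩
      exact (isCornerMap_cycleMap hG hM hc).le_of_isLeftPrimitive hP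
        ((mem_stratum_iff_of_cycle hM hc _).1 hP').1 hPQ
        ((mem_stratum_iff_of_cycle hM hc _).1 hQ).2
  · rintro ⟨M, hM, ⟨P, hP, rfl⟩, hmax⟩
    obtain ⟨e, he, hw, hx⟩ := exists_idempotent_sequence (K := K) hG hM
    rw [mem_stratum_iff] at hP
    obtain ⟨Q, hQ, hPQ, heQ⟩ := TwoSidedIdeal.exists_isLeftPrimitive P.asIdeal e he fun n h => by
      obtain ⟨w, hwM, hw⟩ := hw n
      exact (hP w).1 ((hw _).1 h) hwM
    have hQM : (⟨Q, hQ.isPrimeIdeal⟩ : PrimeSpec (LeavittPathAlgebra K G)) ∈ stratum K G M := by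
      refine mem_stratum_iff.2 fun x => ⟨fun h hxM => ?_, fun h => hPQ ((hP x).2 h)⟩
      obtain ⟨n, hn⟩ := hx x hxM
      exact heQ n (hn Q h)
    rw [le_antisymm hPQ (hmax ⟨_, hQM, rfl⟩ hPQ)]
    exact hQ

end Primitive

/-! ### The involution and right primitive ideals -/

section Adjoint

/-- The involution on the generators that interchanges edges and ghost edges. -/
def genAdjoint : Gen V E → Gen V E
  | .vert x => .vert x
  | .edge e => .ghost e
  | .ghost e => .edge e

theorem genAdjoint_genAdjoint (g : Gen V E) : genAdjoint (genAdjoint g) = g := by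
  cases g <;> rfl

theorem adjoint_rel (p q : FreeAlg K V E) (hpq : Rel K G p q) :
    liftFree K (fun g => MulOpposite.op (ι K G (genAdjoint g))) p =
      liftFree K (fun g => MulOpposite.op (ι K G (genAdjoint g))) q := by
  cases hpq with
  | vert_idem x =>
    simp only [map_mul, liftFree_gen, genAdjoint, ← MulOpposite.op_mul]
    exact congrArg MulOpposite.op (vertex_mul_self K G x)
  | vert_orth x y h =>
    simp only [map_mul, liftFree_gen, genAdjoint, ← MulOpposite.op_mul, map_zero]
    exact congrArg MulOpposite.op (vertex_mul_of_ne K G h.symm)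
  | source_edge e =>
    simp only [map_mul, liftFree_gen, genAdjoint, ← MulOpposite.op_mul]
    exact congrArg MulOpposite.op (ghost_mul_source K G e)
  | edge_range e =>
    simp only [map_mul, liftFree_gen, genAdjoint, ← MulOpposite.op_mul]
    exact congrArg MulOpposite.op (range_mul_ghost K G e)
  | range_ghost e =>
    simp only [map_mul, liftFree_gen, genAdjoint, ← MulOpposite.op_mul]
    exact congrArg MulOpposite.op (edge_mul_range K G e)
  | ghost_source e =>
    simp only [map_mul, liftFree_gen, genAdjoint, ← MulOpposite.op_mul]
    exact congrArg MulOpposite.op (source_mul_edge K G e)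
  | ck1_same e =>
    simp only [map_mul, liftFree_gen, genAdjoint, ← MulOpposite.op_mul]
    exact congrArg MulOpposite.op (ghost_mul_edge_self K G e)
  | ck1_ne e f h =>
    simp only [map_mul, liftFree_gen, genAdjoint, ← MulOpposite.op_mul, map_zero]
    exact congrArg MulOpposite.op (ghost_mul_edge_of_ne K G h.symm)
  | ck2 x hfin hne =>
    simp only [map_mul, map_sum, liftFree_gen, genAdjoint, ← MulOpposite.op_mul,
      ← Finset.op_sum]
    exact congrArg MulOpposite.op (sum_edge_mul_ghost K G hfin hne)

variable (K G) in
/-- The involution of `L_K(G)`, as a homomorphism to the opposite algebra. -/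
noncomputable def adjointHom : LeavittPathAlgebra K G →ₙₐ[K] (LeavittPathAlgebra K G)ᵐᵒᵖ :=
  lift K G _ adjoint_rel

/-- The involution of `L_K(G)`. -/
noncomputable def adjoint (a : LeavittPathAlgebra K G) : LeavittPathAlgebra K G :=
  (adjointHom K G a).unop

theorem adjoint_ι (g : Gen V E) : adjoint (ι K G g) = ι K G (genAdjoint g) :=
  congrArg MulOpposite.unop (lift_ι K G _ _ g)

theorem adjoint_mul (a b : LeavittPathAlgebra K G) : adjoint (a * b) = adjoint b * adjoint a := by
  simp [adjoint]

theorem adjoint_add (a b : LeavittPathAlgebra K G) : adjoint (a + b) = adjoint a + adjoint b := by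
  simp [adjoint]

theorem adjoint_zero : adjoint (0 : LeavittPathAlgebra K G) = 0 := by
  simp [adjoint]

theorem adjoint_smul (k : K) (a : LeavittPathAlgebra K G) : adjoint (k • a) = k • adjoint a := by
  simp [adjoint]

theorem adjoint_adjoint (a : LeavittPathAlgebra K G) : adjoint (adjoint a) = a := by
  induction a using word_induction with
  | zero => rw [adjoint_zero, adjoint_zero]
  | add a b ha hb => rw [adjoint_add, adjoint_add, ha, hb]
  | smul k a ha => rw [adjoint_smul, adjoint_smul, ha]
  | word m =>
    induction m using FreeSemigroup.recOnMul with
    | ih1 g => rw [FreeSemigroup.lift_of, adjoint_ι, adjoint_ι, genAdjoint_genAdjoint]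
    | ih2 g m hg hm => rw [map_mul, adjoint_mul, adjoint_mul, hg, hm]

/-- The image of an ideal under the involution. -/
noncomputable def adjointIdeal (P : TwoSidedIdeal (LeavittPathAlgebra K G)) :
    TwoSidedIdeal (LeavittPathAlgebra K G) :=
  P.op.comap (adjointHom K G)

variable {P Q : TwoSidedIdeal (LeavittPathAlgebra K G)}

theorem mem_adjointIdeal {a : LeavittPathAlgebra K G} : a ∈ adjointIdeal P ↔ adjoint a ∈ P := by
  rw [adjointIdeal, TwoSidedIdeal.mem_comap, TwoSidedIdeal.mem_op_iff]
  rfl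

theorem adjointIdeal_adjointIdeal (P : TwoSidedIdeal (LeavittPathAlgebra K G)) :
    adjointIdeal (adjointIdeal P) = P :=
  TwoSidedIdeal.ext fun a => by rw [mem_adjointIdeal, mem_adjointIdeal, adjoint_adjoint]

theorem adjointIdeal_mono (h : P ≤ Q) : adjointIdeal P ≤ adjointIdeal Q :=
  fun _ ha => mem_adjointIdeal.2 (h (mem_adjointIdeal.1 ha))

theorem isPrimeIdeal_adjointIdeal (hP : P.IsPrimeIdeal) : (adjointIdeal P).IsPrimeIdeal := by
  refine TwoSidedIdeal.isPrimeIdeal_of_mem_or_mem (fun h => hP.ne_top ?_) fun a b h => ?_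
  · refine eq_top_iff.2 fun a _ => ?_
    have : adjoint a ∈ adjointIdeal P := h ▸ trivial
    rwa [mem_adjointIdeal, adjoint_adjoint] at this
  · rw [mem_adjointIdeal, mem_adjointIdeal, or_comm]
    refine hP.mem_or_mem fun x => ?_
    have := mem_adjointIdeal.1 (h (adjoint x))
    rwa [adjoint_mul, adjoint_mul, adjoint_adjoint, ← mul_assoc] at this

theorem adjointIdeal_mem_image_stratum (h : P ∈ PrimeSpec.asIdeal '' stratum K G M) :
    adjointIdeal P ∈ PrimeSpec.asIdeal '' stratum K G M := by
  obtain ⟨P, hP, rfl⟩ := h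
  refine ⟨⟨_, isPrimeIdeal_adjointIdeal P.isPrime⟩, mem_stratum_iff.2 fun x => ?_, rfl⟩
  rw [← mem_stratum_iff.1 hP x, mem_adjointIdeal, vertex, adjoint_ι]
  rfl

theorem maximal_adjointIdeal (h : Maximal (· ∈ PrimeSpec.asIdeal '' stratum K G M) P) :
    Maximal (· ∈ PrimeSpec.asIdeal '' stratum K G M) (adjointIdeal P) := by
  refine ⟨adjointIdeal_mem_image_stratum h.1, fun Q hQ hPQ => ?_⟩
  have h1 := h.2 (adjointIdeal_mem_image_stratum hQ)
    (by simpa [adjointIdeal_adjointIdeal] using adjointIdeal_mono hPQ)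
  simpa [adjointIdeal_adjointIdeal] using adjointIdeal_mono h1

theorem isRightPrimitive_iff_isLeftPrimitive_adjointIdeal :
    P.IsRightPrimitive ↔ (adjointIdeal P).IsLeftPrimitive := by
  constructor
  · rintro ⟨N, _, ρ, ⟨a, n, h0⟩, hs, hN⟩
    refine ⟨N, inferInstance,
      { toFun := fun a => (ρ (adjoint a)).unop
        map_mul' := fun a b => by rw [adjoint_mul, map_mul, MulOpposite.unop_mul]
        map_zero' := by rw [adjoint_zero, map_zero, MulOpposite.unop_zero]
        map_add' := fun a b => by rw [adjoint_add, map_add, MulOpposite.unop_add] },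
      ⟨adjoint a, n, ?_⟩, fun W hW => hs W fun a n hn => ?_, fun a => ?_⟩
    · change (ρ (adjoint (adjoint a))).unop n ≠ 0
      rwa [adjoint_adjoint]
    · have h1 : (ρ (adjoint (adjoint a))).unop n ∈ W := hW (adjoint a) n hn
      rwa [adjoint_adjoint] at h1
    · rw [mem_adjointIdeal]
      exact hN _
  · rintro ⟨N, _, ρ, ⟨a, n, h0⟩, hs, hN⟩
    refine ⟨N, inferInstance,
      { toFun := fun a => MulOpposite.op (ρ (adjoint a))
        map_mul' := fun a b => by rw [adjoint_mul, map_mul, MulOpposite.op_mul]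
        map_zero' := by rw [adjoint_zero, map_zero, MulOpposite.op_zero]
        map_add' := fun a b => by rw [adjoint_add, map_add, MulOpposite.op_add] },
      ⟨adjoint a, n, ?_⟩, fun W hW => hs W fun a n hn => ?_, fun a => ?_⟩
    · change ρ (adjoint (adjoint a)) n ≠ 0
      rwa [adjoint_adjoint]
    · have h1 : ρ (adjoint (adjoint a)) n ∈ W := hW (adjoint a) n hn
      rwa [adjoint_adjoint] at h1
    · have h1 := hN (adjoint a)
      rw [mem_adjointIdeal, adjoint_adjoint] at h1
      exact h1

/-- The involution turns right modules into left modules and preserves inclusions of ideals. It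
fixes the vertices, so it maps each stratum to itself. -/
theorem isRightPrimitive_iff (hG : G.RowFinite) (P : TwoSidedIdeal (LeavittPathAlgebra K G)) :
    P.IsRightPrimitive ↔
      ∃ M ∈ G.maximalTails, Maximal (· ∈ PrimeSpec.asIdeal '' stratum K G M) P := by
  rw [isRightPrimitive_iff_isLeftPrimitive_adjointIdeal, isLeftPrimitive_iff hG]
  refine exists_congr fun M => and_congr_right fun _ => ⟨fun h => ?_, maximal_adjointIdeal⟩
  simpa [adjointIdeal_adjointIdeal] using maximal_adjointIdeal h

end Adjoint

end LeavittPathAlgebra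

/-! ### The action of the multiplicative group and its strata -/

theorem exists_units_zpow_ne_one (K : Type*) [Field K] [Infinite K] {n : ℤ} (hn : n ≠ 0) :
    ∃ h : Kˣ, h ^ n ≠ 1 := by
  classical
  have hm : 0 < n.natAbs := Int.natAbs_pos.2 hn
  have hp : (Polynomial.X ^ n.natAbs - 1 : Polynomial K) ≠ 0 :=
    (Polynomial.monic_X_pow_sub_C (1 : K) hm.ne').ne_zero
  -- The factor `X` makes the chosen non-root `k` nonzero, hence a unit.
  obtain ⟨k, hk⟩ := Infinite.exists_notMem_finset
    ((Polynomial.X * (Polynomial.X ^ n.natAbs - 1) : Polynomial K).roots.toFinset)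
  rw [Multiset.mem_toFinset, Polynomial.mem_roots (mul_ne_zero Polynomial.X_ne_zero hp)] at hk
  simp only [Polynomial.IsRoot.def, Polynomial.eval_mul, Polynomial.eval_X, Polynomial.eval_sub,
    Polynomial.eval_pow, Polynomial.eval_one, mul_eq_zero, not_or, sub_eq_zero] at hk
  refine ⟨Units.mk0 k hk.1, fun h => hk.2 ?_⟩
  have h1 := pow_natAbs_eq_one.2 h
  simpa using congrArg Units.val h1

namespace LeavittPathAlgebra

open Leavitt

variable {K : Type w} [Field K] {V : Type u} {E : Type v} {G : DirGraph V E} {M : Set V}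

section Gauge

@[simp] theorem wordWeight_of (g : Gen V E) : wordWeight (FreeSemigroup.of g) = weight g := by
  simp [wordWeight]

@[simp] theorem wordWeight_mul (m m' : FreeSemigroup (Gen V E)) :
    wordWeight (m * m') = wordWeight m + wordWeight m' := by
  simp [wordWeight]

theorem gauge_ι (h : Kˣ) (g : Gen V E) :
    gauge K G h (ι K G g) = ((h ^ weight g : Kˣ) : K) • ι K G g :=
  lift_ι K G _ _ g

theorem gauge_word (h : Kˣ) (m : FreeSemigroup (Gen V E)) :
    gauge K G h (FreeSemigroup.lift (ι K G) m) =
      ((h ^ wordWeight m : Kˣ) : K) • FreeSemigroup.lift (ι K G) m := by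
  induction m using FreeSemigroup.recOnMul with
  | ih1 g => rw [FreeSemigroup.lift_of, gauge_ι, wordWeight_of]
  | ih2 g m hg hm =>
    rw [map_mul, map_mul, hg, hm, wordWeight_mul, zpow_add, Units.val_mul, smul_mul_smul_comm]

theorem gauge_of_mem_homogeneous (h : Kˣ) (n : ℤ) {a : LeavittPathAlgebra K G}
    (ha : a ∈ homogeneous K G n) : gauge K G h a = ((h ^ n : Kˣ) : K) • a := by
  induction ha using Submodule.span_induction with
  | mem a ha =>
    obtain ⟨m, rfl, rfl⟩ := ha
    exact gauge_word h m
  | zero => simp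
  | add a b _ _ ha hb => rw [map_add, ha, hb, smul_add]
  | smul k a _ ha => rw [map_smul, ha, smul_comm]

theorem gauge_one (a : LeavittPathAlgebra K G) : gauge K G 1 a = a := by
  induction a using word_induction with
  | zero => simp
  | add a b ha hb => rw [map_add, ha, hb]
  | smul k a ha => rw [map_smul, ha]
  | word m => rw [gauge_word, one_zpow, Units.val_one, one_smul]

theorem gauge_mul (g h : Kˣ) (a : LeavittPathAlgebra K G) :
    gauge K G (g * h) a = gauge K G g (gauge K G h a) := by
  induction a using word_induction with
  | zero => simp
  | add a b ha hb => simp only [map_add, ha, hb]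
  | smul k a ha => simp only [map_smul, ha]
  | word m =>
    rw [gauge_word, gauge_word, map_smul, gauge_word, smul_smul, mul_zpow, mul_comm (g ^ _),
      Units.val_mul]

theorem twist_word {A : Type*} [NonUnitalRing A] [Module K A] [IsScalarTower K A A]
    [SMulCommClass K A A] (f : LeavittPathAlgebra K G →ₙₐ[K] A) (m : FreeSemigroup (Gen V E)) :
    twist f (FreeSemigroup.lift (ι K G) m) =
      f (FreeSemigroup.lift (ι K G) m) ⊗ₜ[K] (LaurentPolynomial.T (wordWeight m) : K[T;T⁻¹]) := by
  induction m using FreeSemigroup.recOnMul with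
  | ih1 g => rw [FreeSemigroup.lift_of, twist_ι, wordWeight_of]
  | ih2 g m hg hm =>
    rw [map_mul, map_mul, hg, hm, map_mul, wordWeight_mul, LaurentPolynomial.T_add,
      Algebra.TensorProduct.tmul_mul_tmul]

/-- The coaction is the twist of the identity, `a ↦ a ⊗ Tⁿ` in degree `n`; evaluating `T` at `h`
gives `hⁿ a`. -/
theorem isRationalAction_gauge : IsRationalAction (gauge K G) where
  one := gauge_one
  mul := gauge_mul
  rational := by
    refine ⟨twist (NonUnitalAlgHom.id K (LeavittPathAlgebra K G)), fun h a => ?_⟩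
    induction a using word_induction with
    | zero => simp
    | add a b ha hb => simp only [map_add, ha, hb]
    | smul k a ha => simp only [map_smul, ha]
    | word m =>
      rw [gauge_word, twist_word, LinearMap.lTensor_tmul, TensorProduct.rid_tmul]
      congr 1
      exact (LaurentPolynomial.smeval_T_pow (R := K) (wordWeight m) h).symm

theorem gauge_vertex (h : Kˣ) (x : V) : gauge K G h (vertex K G x) = vertex K G x := by
  rw [vertex, gauge_ι]
  simp [weight]

theorem gauge_pathElem (h : Kˣ) (x : V) (l : List E) :
    gauge K G h (pathElem K G x l) = ((h ^ (l.length : ℤ) : Kˣ) : K) • pathElem K G x l := by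
  induction l generalizing x with
  | nil => simpa using gauge_vertex h x
  | cons e l ih =>
    rw [pathElem_cons, map_mul, ih, edge, gauge_ι, smul_mul_smul_comm, ← Units.val_mul, ← zpow_add]
    simp [weight, add_comm]

theorem gauge_ghostElem (h : Kˣ) (x : V) (l : List E) :
    gauge K G h (ghostElem K G x l) = ((h ^ (-(l.length : ℤ)) : Kˣ) : K) • ghostElem K G x l := by
  induction l generalizing x with
  | nil => simpa using gauge_vertex h x
  | cons e l ih =>
    rw [ghostElem_cons, map_mul, ih, ghost, gauge_ι, smul_mul_smul_comm, ← Units.val_mul,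
      ← zpow_add, weight, List.length_cons, Nat.cast_succ, neg_add]

theorem gauge_cyclePow (h : Kˣ) (x : V) (c : List E) (n : ℤ) :
    gauge K G h (cyclePow K G x c n) =
      ((h ^ (n * c.length) : Kˣ) : K) • cyclePow K G x c n := by
  rw [cyclePow, cycleElem, map_mul, gauge_pathElem, gauge_ghostElem, smul_mul_smul_comm,
    ← Units.val_mul, ← zpow_add]
  congr 3
  simp only [List.length_flatten, List.map_replicate, List.sum_replicate, smul_eq_mul]
  push_cast
  rw [← neg_mul, ← add_mul]
  congr 1
  omega

/-- If `K` is infinite, an invariant ideal is graded. -/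
theorem mem_of_sum_mem [Infinite K] {J : TwoSidedIdeal (LeavittPathAlgebra K G)}
    (hJ : ∀ h, ∀ a ∈ J, gauge K G h a ∈ J) {ι : Type*} {d : ι → ℤ} (hd : Function.Injective d)
    (s : Finset ι) (a : ι → LeavittPathAlgebra K G)
    (ha : ∀ i h, gauge K G h (a i) = ((h ^ d i : Kˣ) : K) • a i) (hs : ∑ i ∈ s, a i ∈ J) :
    ∀ i ∈ s, a i ∈ J := by
  classical
  induction s using Finset.induction_on generalizing a with
  | empty => simp
  | insert j s hj ih =>
    have key : ∀ i ∈ s, a i ∈ J := by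
      intro i hi
      have hij : d i - d j ≠ 0 := sub_ne_zero.2 fun h => hj (hd h ▸ hi)
      -- Subtracting `h ^ d j` times the sum from its translate by `h` removes the term `j` and
      -- multiplies the term `i` by `h ^ d i - h ^ d j`, which is nonzero for this `h`. The choice
      -- of `h` depends on `i`.
      obtain ⟨h, hh⟩ := exists_units_zpow_ne_one K hij
      have h1 := J.sub_mem (hJ h _ hs) (smul_mem ((h ^ d j : Kˣ) : K) hs)
      rw [map_sum, Finset.smul_sum, ← Finset.sum_sub_distrib, Finset.sum_insert hj, ha, sub_self,
        zero_add] at h1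
      simp only [ha, ← sub_smul] at h1
      refine (smul_mem_iff ?_).1 (ih (fun i => (((h ^ d i : Kˣ) : K) - ((h ^ d j : Kˣ) : K)) • a i)
        (fun i h => by rw [map_smul, ha, smul_comm]) h1 i hi)
      rw [sub_ne_zero]
      intro h2
      rw [zpow_sub, Units.ext h2, mul_inv_cancel] at hh
      exact hh rfl
    rw [Finset.forall_mem_insert]
    refine ⟨?_, key⟩
    rw [Finset.sum_insert hj] at hs
    simpa using J.sub_mem hs (sum_mem key)

/-- The translate of a prime ideal by the action. -/
noncomputable def gaugeComap (h : Kˣ) (P : PrimeSpec (LeavittPathAlgebra K G)) :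
    PrimeSpec (LeavittPathAlgebra K G) where
  asIdeal := P.asIdeal.comap (gauge K G h)
  isPrime := by
    have hinv : ∀ a, gauge K G h (gauge K G h⁻¹ a) = a := fun a => by
      rw [← gauge_mul, mul_inv_cancel, gauge_one]
    refine TwoSidedIdeal.isPrimeIdeal_of_mem_or_mem (fun ht => P.isPrime.ne_top ?_) fun a b hab => ?_
    · refine eq_top_iff.2 fun a _ => ?_
      have : gauge K G h⁻¹ a ∈ P.asIdeal.comap (gauge K G h) := ht ▸ trivial
      rwa [TwoSidedIdeal.mem_comap, hinv] at this
    · simp only [TwoSidedIdeal.mem_comap] at hab ⊢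
      refine P.isPrime.mem_or_mem fun x => ?_
      have := hab (gauge K G h⁻¹ x)
      rwa [map_mul, map_mul, hinv] at this

theorem mem_gaugeComap {h : Kˣ} {P : PrimeSpec (LeavittPathAlgebra K G)}
    {a : LeavittPathAlgebra K G} : a ∈ (gaugeComap h P).asIdeal ↔ gauge K G h a ∈ P.asIdeal :=
  TwoSidedIdeal.mem_comap _

theorem gaugeComap_mem_stratum {P : PrimeSpec (LeavittPathAlgebra K G)} (hP : P ∈ stratum K G M)
    (h : Kˣ) : gaugeComap h P ∈ stratum K G M := by
  rw [mem_stratum_iff] at hP ⊢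
  intro x
  rw [mem_gaugeComap, gauge_vertex, hP]

/-- A stratum has a least element, which contains every invariant ideal that is contained in some
element of the stratum. -/
theorem exists_least_of_stratum [Infinite K] (hG : G.RowFinite) (hM : G.IsMaximalTail M) :
    ∃ P ∈ stratum K G M, (∀ Q ∈ stratum K G M, P.asIdeal ≤ Q.asIdeal) ∧
      ∀ J : TwoSidedIdeal (LeavittPathAlgebra K G), (∀ h, ∀ a ∈ J, gauge K G h a ∈ J) →
        ∀ Q ∈ stratum K G M, J ≤ Q.asIdeal → J ≤ P.asIdeal := by
  by_cases hL : M ∈ G.maximalTailsGamma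
  · obtain ⟨P, hP⟩ := stratum_nonempty (K := K) hG hM
    refine ⟨P, hP, fun Q hQ => ?_, fun J _ Q hQ hJQ => ?_⟩
    · rw [subsingleton_stratum hG hL hQ hP]
    · rwa [subsingleton_stratum hG hL hQ hP] at hJQ
  · obtain ⟨x, c, hc⟩ := DirGraph.exists_isCycleWithoutExit ⟨hM, hL⟩
    have hθ := isCornerMap_cycleMap (K := K) hG hM hc
    have hstr := mem_stratum_iff_of_cycle (K := K) hM hc
    -- The least element of the stratum is the extension of the zero ideal of the Laurent polynomial
    -- ring.
    refine ⟨⟨hθ.extendIdeal ⊥, hθ.isPrimeIdeal_extendIdeal Ideal.isPrime_bot⟩,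
      (hstr _).2 ⟨hθ.le_extendIdeal _, ?_⟩, fun Q hQ a ha => ?_, fun J hJ Q hQ hJQ a ha => ?_⟩
    · rw [hθ.apply_mem_extendIdeal]
      simp
    · rw [hθ.mem_iff_forall_coord Q.isPrime ((hstr Q).1 hQ).1 ((hstr Q).1 hQ).2]
      intro y z
      rw [(hθ.mem_extendIdeal.1 ha y z : hθ.coord (y * a * z) = 0), map_zero]
      exact Q.asIdeal.zero_mem
    · refine hθ.mem_extendIdeal.2 fun y z => ?_
      -- `J` need not contain `coIdeal K G M`. The intersection of all translates of `Q` does, and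
      -- it is an invariant ideal between `J` and `Q`.
      let J' : TwoSidedIdeal (LeavittPathAlgebra K G) := ⨅ h : Kˣ, (gaugeComap h Q).asIdeal
      have hJ' : ∀ a, a ∈ J' ↔ ∀ h, gauge K G h a ∈ Q.asIdeal := fun a => by
        rw [TwoSidedIdeal.mem_iInf]
        exact forall_congr' fun h => mem_gaugeComap
      have hIJ' : coIdeal K G M ≤ J' := coIdeal_le_iff.2 fun y hy => (hJ' _).2 fun h => by
        rw [gauge_vertex]
        exact (mem_stratum_iff.1 hQ y).2 hy
      have hJJ' : J ≤ J' := fun b hb => (hJ' _).2 fun h => hJQ (hJ h b hb)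
      have hinv : ∀ h, ∀ b ∈ J', gauge K G h b ∈ J' := fun h b hb => (hJ' _).2 fun g => by
        rw [← gauge_mul]
        exact (hJ' _).1 hb _
      have hmem : cycleMap K G x c (hθ.coord (y * a * z)) ∈ J' :=
        (hθ.apply_coord_mem_iff hIJ' _).2 (J'.mul_mem_right _ _ (J'.mul_mem_left _ _
          (J'.mul_mem_right _ _ (J'.mul_mem_left _ _ (hJJ' ha)))))
      have hcl : (c.length : ℤ) ≠ 0 := by
        exact_mod_cast (List.length_pos_iff.2 hc.ne_nil).ne'
      rw [Ideal.mem_bot]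
      refine LaurentPolynomial.ext fun n => ?_
      by_contra hn
      rw [cycleMap_apply] at hmem
      -- Were the coordinate nonzero, gradedness would put some `cⁿ` into `J' ≤ Q`, and then `x ∈
      -- Q`.
      have h1 := mem_of_sum_mem hinv (d := fun n : ℤ => n * c.length)
        (fun i j hij => mul_right_cancel₀ hcl hij) _ _
        (fun i h => by rw [map_smul, gauge_cyclePow, smul_comm]) hmem n
        (Finsupp.mem_support_iff.2 hn)
      have h2 := (hJ' _).1 ((smul_mem_iff hn).1 h1) 1
      rw [gauge_one] at h2
      refine cyclePow_notMem hc (fun h => ?_) n h2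
      exact (mem_stratum_iff.1 hQ x).1 h hc.mem

/-- Translates of the least element stay in the stratum, because the action fixes vertices; so they
contain it, which is its invariance. -/
theorem exists_mem_hSpec_least [Infinite K] (hG : G.RowFinite) (hM : G.IsMaximalTail M) :
    ∃ P ∈ hSpec (gauge K G), P ∈ stratum K G M ∧ (∀ Q ∈ stratum K G M, P.asIdeal ≤ Q.asIdeal) ∧
      ∀ P' ∈ hSpec (gauge K G), ∀ Q ∈ stratum K G M,
        P'.asIdeal ≤ Q.asIdeal → P'.asIdeal ≤ P.asIdeal := by
  obtain ⟨P, hP, h1, h2⟩ := exists_least_of_stratum (K := K) hG hM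
  exact ⟨P, fun h a ha => mem_gaugeComap.1 (h1 _ (gaugeComap_mem_stratum hP h) ha), hP, h1,
    fun P' hP' => h2 P'.asIdeal hP'⟩

/-- An invariant prime lies above the least element `P₀` of its stratum and, being an invariant
ideal inside a member of the stratum, also below it. -/
theorem bijOn_tail [Infinite K] (hG : G.RowFinite) :
    Set.BijOn (tail K G) (hSpec (gauge K G)) G.maximalTails := by
  refine ⟨fun P _ => isMaximalTail_tail hG P, fun P hP P' hP' h => ?_, fun M hM => ?_⟩
  · obtain ⟨P₀, -, -, h1, h2⟩ := exists_mem_hSpec_least (K := K) hG (isMaximalTail_tail hG P)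
    have key : ∀ P' ∈ hSpec (gauge K G), tail K G P = tail K G P' → P'.asIdeal = P₀.asIdeal := by
      intro P' hP' h
      have hP's : P' ∈ stratum K G (tail K G P) := h ▸ mem_stratum_tail P'
      exact le_antisymm (h2 P' hP' P' hP's le_rfl) (h1 P' hP's)
    exact PrimeSpec.ext ((key P hP rfl).trans (key P' hP' h).symm)
  · obtain ⟨P, hP, hPs, -⟩ := exists_mem_hSpec_least (K := K) hG hM
    exact ⟨P, hP, tail_eq_iff.2 hPs⟩

/-- If `Q` lies in the stratum of `P` under the action, the least element `P₀` of the stratum of `Q`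
by vertices is an invariant prime. Hence `P₀ ≤ P ≤ Q`, and all three contain the same vertices. -/
theorem hStratum_eq_stratum [Infinite K] (hG : G.RowFinite)
    {P : PrimeSpec (LeavittPathAlgebra K G)} (hP : P ∈ hSpec (gauge K G)) :
    hStratum (gauge K G) P = stratum K G (tail K G P) := by
  ext Q
  constructor
  · rintro ⟨-, hPQ, hmax⟩
    obtain ⟨P₀, hP₀, hP₀s, h1, -⟩ :=
      exists_mem_hSpec_least (K := K) hG (isMaximalTail_tail hG Q)
    have hP₀P := hmax P₀ hP₀ (h1 Q (mem_stratum_tail Q))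
    refine mem_stratum_iff.2 fun x => ?_
    rw [← mem_stratum_iff.1 (mem_stratum_tail P) x]
    refine ⟨fun hx => hP₀P ?_, fun hx => hPQ hx⟩
    rw [mem_stratum_iff.1 hP₀s x]
    exact not_not.2 hx
  · intro hQ
    obtain ⟨P₀, hP₀, hP₀s, h1, h2⟩ :=
      exists_mem_hSpec_least (K := K) hG (isMaximalTail_tail hG P)
    have hPP₀ : P = P₀ := (bijOn_tail hG).injOn hP hP₀ (tail_eq_iff.2 hP₀s).symm
    subst hPP₀
    exact ⟨hP, h1 Q hQ, fun P' hP' hP'Q => h2 P' hP' Q hQ hP'Q⟩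

end Gauge

/-! ### The partition of the spectrum and the final statement -/

theorem pairwiseDisjoint_stratum : G.maximalTails.PairwiseDisjoint (stratum K G) := by
  intro M _ M' _ hne
  refine Set.disjoint_left.2 fun P hP hP' => hne ?_
  rw [← tail_eq_iff.2 hP, ← tail_eq_iff.2 hP']

theorem iUnion_stratum (hG : G.RowFinite) : (⋃ M ∈ G.maximalTails, stratum K G M) = Set.univ :=
  Set.eq_univ_of_forall fun P =>
    Set.mem_biUnion (isMaximalTail_tail hG P) (mem_stratum_tail P)

end LeavittPathAlgebra

theorem theorem2 {V : Type u} {E : Type v} (G : DirGraph V E) (hG : G.RowFinite)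
    (K : Type w) [Field K] :
    -- the spectrum is the disjoint union of the strata
    (⋃ M ∈ G.maximalTails, LeavittPathAlgebra.stratum K G M) = Set.univ ∧
    G.maximalTails.PairwiseDisjoint (LeavittPathAlgebra.stratum K G) ∧
    -- the strata up to homeomorphism
    (∀ M ∈ G.maximalTailsTau, Nonempty (LeavittPathAlgebra.stratum K G M ≃ₜ PrimeSpectrum K[T;T⁻¹])) ∧
    (∀ M ∈ G.maximalTailsGamma, Nonempty (LeavittPathAlgebra.stratum K G M ≃ₜ PrimeSpectrum K)) ∧
    -- the primitive ideals are exactly the primes that are maximal in their stratum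
    (∀ P : TwoSidedIdeal (LeavittPathAlgebra K G),
      P.IsLeftPrimitive ↔
        ∃ M ∈ G.maximalTails,
          Maximal (· ∈ PrimeSpec.asIdeal '' LeavittPathAlgebra.stratum K G M) P) ∧
    (∀ P : TwoSidedIdeal (LeavittPathAlgebra K G),
      P.IsRightPrimitive ↔
        ∃ M ∈ G.maximalTails,
          Maximal (· ∈ PrimeSpec.asIdeal '' LeavittPathAlgebra.stratum K G M) P) ∧
    -- if `K` is infinite, the strata are the strata of the rational action given by the grading
    (Infinite K →
      IsRationalAction (LeavittPathAlgebra.gauge K G) ∧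
      (∀ (h : Kˣ) (n : ℤ), ∀ a ∈ LeavittPathAlgebra.homogeneous K G n,
        LeavittPathAlgebra.gauge K G h a = ((h ^ n : Kˣ) : K) • a) ∧
      Set.BijOn (LeavittPathAlgebra.tail K G)
        (hSpec (LeavittPathAlgebra.gauge K G)) G.maximalTails ∧
      ∀ P ∈ hSpec (LeavittPathAlgebra.gauge K G), hStratum (LeavittPathAlgebra.gauge K G) P =
        LeavittPathAlgebra.stratum K G (LeavittPathAlgebra.tail K G P)) := by
  open LeavittPathAlgebra in
  exact ⟨iUnion_stratum hG, pairwiseDisjoint_stratum, fun M hM => nonempty_homeomorph_of_tau hG hM,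
    fun M hM => nonempty_homeomorph_of_gamma hG hM, isLeftPrimitive_iff hG,
    isRightPrimitive_iff hG, fun _ => ⟨isRationalAction_gauge,
      fun h n a ha => gauge_of_mem_homogeneous h n ha, bijOn_tail hG,
      fun P hP => hStratum_eq_stratum hG hP⟩⟩
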